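/- Let $n, m \ge 0$. Let $\mathbb{C}^{2n}$ carry Darboux coordinates $(z,w)$, let $\{-,-\}$ be the Poisson bracket $\{z_i,w_j\}=\delta_{ij}$ of its standard holomorphic symplectic structure, extended to forms by $\{f\,\omega, g\,\eta\}=\{f,g\}\,\omega\wedge\eta$ for $\omega,\eta$ products of the $d\bar z_i, d\bar w_i, dt_j$, and let $L_n=(\Omega^{0,\bullet}(\mathbb{C}^{2n}),\bar\partial,\{-,-\})$. Let $(L_n)_{dR}=L_n\oplus\varepsilon L_n$, with $\varepsilon$ of degree $-1$, $d(\alpha+\varepsilon\beta)=\bar\partial\alpha+\beta-\varepsilon\bar\partial\beta$, $[\alpha,\varepsilon\beta]=(-1)^{|\alpha|}\varepsilon\{\alpha,\beta\}$ and $[\varepsilon\alpha,\varepsilon\beta]=0$; this is the cone of $\mathrm{id}\colon L_n[1]\to L_n$. Classical Poisson BF theory on $\mathbb{C}^{2n}\times\mathbb{R}^m$ has fields $A\in\Omega^{0,\bullet}(\mathbb{C}^{2n})\,\widehat\otimes\,\Omega^\bullet(\mathbb{R}^m)[1]$ and $B\in\Omega^{2n,\bullet}(\mathbb{C}^{2n})\,\widehat\otimes\,\Omega^\bullet(\mathbb{R}^m)[2n+m-2]$,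 the $(-1)$-shifted symplectic pairing given by integration of $B\wedge A$, and action functional $S(A,B)=\int B\wedge\big((\bar\partial+d_{dR})A+\tfrac12\{A,A\}\big)$. Let $\mathcal O_{loc}$ be its graded space of (reduced) local functionals, with BV bracket $\{-,-\}_{BV}$, so that $\mathcal O_{loc}[-1]$ carries the differential $\{S,-\}_{BV}$ and the bracket $\{-,-\}_{BV}$. Let $\mathrm{Obs}^{cl}$ be the factorization algebra of classical observables: $\mathrm{Obs}^{cl}(U)$ is the completed symmetric algebra on the continuous dual of the fields on $U$, with differential $\{S,-\}_{BV}$. For $\alpha\in L_n$ let $p^*\alpha$ be its pullback along $p\colon\mathbb{C}^{2n}\times\mathbb{R}^m\to\mathbb{C}^{2n}$ and put $$P_\alpha(A,B)=\int B\wedge\{p^*\alpha,A\},\qquad Q_\alpha(A,B)=\int B\wedge p^*\alpha .$$ **Theorem.** The linear map $\Phi\colon(L_n)_{dR}\to\mathcal O_{loc}[-1]$ given by $\Phi(\alpha)=P_\alpha$ and, for $\alpha$ of form degree $k$, $\Phi(\varepsilon\alpha)=(-1)^{k+1}Q_\alpha$ takes values in local functionals, has degree $0$, and satisfies $\Phi(dx)=\{S,\Phi(x)\}_{BV}$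 and $\Phi([x,y])=\{\Phi(x),\Phi(y)\}_{BV}$ for all $x,y\in(L_n)_{dR}$. Hence it is a (strict) inner action of $(L_n)_{dR}$ on Poisson BF theory. The operators $\rho(x)=\{\Phi(x),-\}_{BV}$ on $\mathrm{Obs}^{cl}$ define a de Rham action of $L_n$ on the classical observables: for $x$ of degree $j$, $\rho(x)$ is a degree $j$ derivation of the factorization algebra $\mathrm{Obs}^{cl}$, and $\rho\colon(L_n)_{dR}\to\mathrm{Der}(\mathrm{Obs}^{cl})$ is compatible with differentials and brackets. -/

import Mathlib

open scoped TensorProduct ContDiff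
open TopologicalSpace

namespace PoissonBF

noncomputable section

/-! ## Super vector spaces and their graded-symmetric (co)algebras -/

/-- A super vector space, presented by its parity involution: `par v = v` on even
vectors and `par v = -v` on odd vectors. -/
class SuperSpace (V : Type) [AddCommGroup V] [Module ℂ V] where
  par : V →ₗ[ℂ] V
  par_par : ∀ v, par (par v) = v

open SuperSpace

instance : SuperSpace ℂ where
  par := LinearMap.id
  par_par _ := rfl

section Super

variable (V : Type) [AddCommGroup V] [Module ℂ V] [SuperSpace V]
variable {W : Type} [AddCommGroup W] [Module ℂ W] [SuperSpace W]

/-- Koszul commutation rules: even vectors commute with everything, odd vectors anticommute. -/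
inductive SymRel : TensorAlgebra ℂ V → TensorAlgebra ℂ V → Prop
  | even (a b : V) (ha : par a = a) :
      SymRel (TensorAlgebra.ι ℂ a * TensorAlgebra.ι ℂ b)
        (TensorAlgebra.ι ℂ b * TensorAlgebra.ι ℂ a)
  | odd (a b : V) (ha : par a = -a) (hb : par b = -b) :
      SymRel (TensorAlgebra.ι ℂ a * TensorAlgebra.ι ℂ b)
        (-(TensorAlgebra.ι ℂ b * TensorAlgebra.ι ℂ a))

/-- The graded-symmetric algebra of a super vector space. -/
def GSym : Type := RingQuot (SymRel V)

instance : Ring (GSym V) := inferInstanceAs (Ring (RingQuot (SymRel V)))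
instance : Algebra ℂ (GSym V) := inferInstanceAs (Algebra ℂ (RingQuot (SymRel V)))

variable {V}

namespace GSym

/-- The quotient map from the tensor algebra. -/
def mk : TensorAlgebra ℂ V →ₐ[ℂ] GSym V := RingQuot.mkAlgHom ℂ (SymRel V)

/-- The inclusion of the generators. -/
def ι : V →ₗ[ℂ] GSym V := mk.toLinearMap ∘ₗ TensorAlgebra.ι ℂ

theorem ι_comm_even (a b : V) (ha : par a = a) : ι a * ι b = ι b * ι a := by
  have := RingQuot.mkAlgHom_rel ℂ (SymRel.even a b ha)
  rw [map_mul, map_mul] at this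
  exact this

theorem ι_comm_odd (a b : V) (ha : par a = -a) (hb : par b = -b) :
    ι a * ι b = -(ι b * ι a) := by
  have := RingQuot.mkAlgHom_rel ℂ (SymRel.odd a b ha hb)
  rw [map_mul, map_neg, map_mul] at this
  exact this

/-- The universal property. -/
def lift {A : Type} [Ring A] [Algebra ℂ A] (f : V →ₗ[ℂ] A)
    (h0 : ∀ a b : V, par a = a → f a * f b = f b * f a)
    (h1 : ∀ a b : V, par a = -a → par b = -b → f a * f b = -(f b * f a)) :
    GSym V →ₐ[ℂ] A :=
  RingQuot.liftAlgHom ℂ ⟨TensorAlgebra.lift ℂ f, by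
    rintro _ _ (⟨a, b, ha⟩ | ⟨a, b, ha, hb⟩)
    · simpa using h0 a b ha
    · simpa using h1 a b ha hb⟩

@[simp] theorem lift_ι {A : Type} [Ring A] [Algebra ℂ A] (f : V →ₗ[ℂ] A)
    (h0 : ∀ a b : V, par a = a → f a * f b = f b * f a)
    (h1 : ∀ a b : V, par a = -a → par b = -b → f a * f b = -(f b * f a)) (v : V) :
    lift f h0 h1 (ι v) = f v := by
  change RingQuot.liftAlgHom ℂ _ (RingQuot.mkAlgHom ℂ (SymRel V) _) = _
  rw [RingQuot.liftAlgHom_mkAlgHom_apply]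
  simp

/-- Functoriality for parity-preserving linear maps. -/
def map (f : V →ₗ[ℂ] W) (hf : ∀ v, f (par v) = par (f v)) : GSym V →ₐ[ℂ] GSym W :=
  lift (ι ∘ₗ f)
    (fun a b ha => ι_comm_even _ _ (by rw [← hf, ha]))
    (fun a b ha hb => ι_comm_odd _ _ (by rw [← hf, ha, map_neg]) (by rw [← hf, hb, map_neg]))

@[simp] theorem map_ι (f : V →ₗ[ℂ] W) (hf : ∀ v, f (par v) = par (f v)) (v : V) :
    map f hf (ι v) = ι (f v) := by simp [map]

/-- The parity involution of `GSym V`, as an algebra map. -/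
def parHom : GSym V →ₐ[ℂ] GSym V := map par (fun _ => rfl)

@[simp] theorem parHom_ι (v : V) : parHom (ι v) = ι (par v) := by simp [parHom]

theorem hom_ext {A : Type} [Ring A] [Algebra ℂ A] {f g : GSym V →ₐ[ℂ] A}
    (h : ∀ v, f (ι v) = g (ι v)) : f = g := by
  apply RingQuot.ringQuot_ext'
  apply TensorAlgebra.hom_ext
  ext v
  exact h v

instance : SuperSpace (GSym V) where
  par := parHom.toLinearMap
  par_par w := by
    have : (parHom (V := V)).comp parHom = AlgHom.id ℂ _ :=
      hom_ext (fun v => by simp [par_par])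
    exact DFunLike.congr_fun this w

/-- The monomial `φ₁ ⋯ φ_k`. -/
def mon {k : ℕ} (φ : Fin k → V) : GSym V := (List.ofFn fun i => ι (φ i)).prod

/-- `v ↦ ((c, u) ↦ (0, c v))`, used to extract the components of symmetric degree `0` and `1`. -/
def stepLow : V →ₗ[ℂ] Module.End ℂ (ℂ × V) where
  toFun v := (LinearMap.inr ℂ ℂ V) ∘ₗ ((LinearMap.toSpanSingleton ℂ V v) ∘ₗ LinearMap.fst ℂ ℂ V)
  map_add' a b := by ext <;> simp
  map_smul' c a := by ext <;> simp

/-- The components of symmetric degree `0` and `1` of an element of `GSym V`. -/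
def low : GSym V →ₗ[ℂ] ℂ × V :=
  (LinearMap.applyₗ ((1 : ℂ), (0 : V))) ∘ₗ
    (lift stepLow
      (fun a b _ => by ext <;> simp [stepLow])
      (fun a b _ _ => by ext <;> simp [stepLow])).toLinearMap

/-- The augmentation `Sym V → Sym⁰ V = ℂ`. -/
def aug : GSym V →ₗ[ℂ] ℂ := LinearMap.fst ℂ ℂ V ∘ₗ low

/-- The projection `Sym V → Sym¹ V = V`. -/
def lin : GSym V →ₗ[ℂ] V := LinearMap.snd ℂ ℂ V ∘ₗ low

/-- The even part of a vector. -/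
def ev : V →ₗ[ℂ] V := (1 / 2 : ℂ) • (LinearMap.id + par)

/-- The odd part of a vector. -/
def od : V →ₗ[ℂ] V := (1 / 2 : ℂ) • (LinearMap.id - par)

/-- The operator `x ⊗ y ↦ v x ⊗ y + (-1)^{|v||x|} x ⊗ v y` on `GSym V ⊗ GSym V`. -/
def stepComul : V →ₗ[ℂ] Module.End ℂ (GSym V ⊗[ℂ] GSym V) where
  toFun v :=
    TensorProduct.map (LinearMap.mulLeft ℂ (ι v)) LinearMap.id
      + TensorProduct.map LinearMap.id (LinearMap.mulLeft ℂ (ι (ev v)))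
      + TensorProduct.map par (LinearMap.mulLeft ℂ (ι (od v)))
  map_add' a b := by
    apply TensorProduct.ext'
    intro x y
    simp [add_mul, TensorProduct.add_tmul, TensorProduct.tmul_add]
    abel
  map_smul' c a := by
    apply TensorProduct.ext'
    intro x y
    simp [TensorProduct.smul_tmul', TensorProduct.tmul_smul]

theorem ev_of_even {a : V} (ha : par a = a) : ev a = a := by
  simp only [ev, LinearMap.smul_apply, LinearMap.add_apply, LinearMap.id_apply, ha]
  rw [← two_smul ℂ a, smul_smul]; norm_num

theorem od_of_even {a : V} (ha : par a = a) : od a = 0 := by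
  simp [od, ha]

theorem ev_of_odd {a : V} (ha : par a = -a) : ev a = 0 := by
  simp [ev, ha]

theorem od_of_odd {a : V} (ha : par a = -a) : od a = a := by
  simp only [od, LinearMap.smul_apply, LinearMap.sub_apply, LinearMap.id_apply, ha, sub_neg_eq_add]
  rw [← two_smul ℂ a, smul_smul]; norm_num

theorem par_mul (x y : GSym V) : par (x * y) = par x * par y := map_mul parHom x y

theorem par_ι (v : V) : par (ι v) = ι (par v) := parHom_ι v

/-- The unshuffle coproduct `φ₁ ⋯ φ_k ↦ ∑ ± φ_S ⊗ φ_{Sᶜ}`, the signs being the Koszul signs. -/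
def comul : GSym V →ₗ[ℂ] GSym V ⊗[ℂ] GSym V :=
  (LinearMap.applyₗ ((1 : GSym V) ⊗ₜ[ℂ] (1 : GSym V))) ∘ₗ
    (lift stepComul
      (fun a b ha => by
        apply TensorProduct.ext'
        intro x y
        have e1 : ∀ c : V, ∀ z : GSym V, ι a * (ι c * z) = ι c * (ι a * z) := fun c z => by
          rw [← mul_assoc, ι_comm_even a c ha, mul_assoc]
        simp only [stepComul, LinearMap.coe_mk, AddHom.coe_mk, Module.End.mul_apply,
          LinearMap.add_apply, TensorProduct.map_tmul, LinearMap.mulLeft_apply,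
          LinearMap.id_apply, map_add, ev_of_even ha, od_of_even ha, map_zero, zero_mul,
          TensorProduct.tmul_zero, add_zero, par_mul, par_ι, ha, e1]
        abel)
      (fun a b ha hb => by
        apply TensorProduct.ext'
        intro x y
        have e1 : ∀ z : GSym V, ι a * (ι b * z) = -(ι b * (ι a * z)) := fun z => by
          rw [← mul_assoc, ι_comm_odd a b ha hb, neg_mul, mul_assoc]
        simp only [stepComul, LinearMap.coe_mk, AddHom.coe_mk, Module.End.mul_apply,
          LinearMap.add_apply, TensorProduct.map_tmul, LinearMap.mulLeft_apply,
          LinearMap.id_apply, map_add, ev_of_odd ha, od_of_odd ha, ev_of_odd hb, od_of_odd hb,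
          map_zero, zero_mul, TensorProduct.tmul_zero, add_zero, par_mul, par_ι, ha, hb, e1,
          LinearMap.neg_apply, map_neg, neg_mul, TensorProduct.neg_tmul, TensorProduct.tmul_neg]
        abel)).toLinearMap

end GSym

section Koszul

variable {X Y Z : Type} [AddCommGroup X] [Module ℂ X] [AddCommGroup Y] [Module ℂ Y]
  [SuperSpace Y] [AddCommGroup Z] [Module ℂ Z]

/-- The parity-preserving part of a linear map. -/
def evenPart (g : V →ₗ[ℂ] W) : V →ₗ[ℂ] W := (1 / 2 : ℂ) • (g + par ∘ₗ g ∘ₗ par)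

/-- The parity-reversing part of a linear map. -/
def oddPart (g : V →ₗ[ℂ] W) : V →ₗ[ℂ] W := (1 / 2 : ℂ) • (g - par ∘ₗ g ∘ₗ par)

/-- The tensor product of linear maps with the Koszul sign:
`(f ⊗ g) (v ⊗ w) = (-1)^{|g||v|} f v ⊗ g w`. -/
def koszulMap (f : V →ₗ[ℂ] X) (g : W →ₗ[ℂ] Y) : V ⊗[ℂ] W →ₗ[ℂ] X ⊗[ℂ] Y :=
  TensorProduct.map f (evenPart g) + TensorProduct.map (f ∘ₗ par) (oddPart g)

/-- The convolution product of `X`- and `Y`-valued functionals along a bilinear map `β`. -/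
def conv (β : X →ₗ[ℂ] Y →ₗ[ℂ] Z) (f : GSym V →ₗ[ℂ] X) (g : GSym V →ₗ[ℂ] Y) :
    GSym V →ₗ[ℂ] Z :=
  TensorProduct.lift β ∘ₗ koszulMap f g ∘ₗ GSym.comul

end Koszul

/-- A functional `F` on `Sym V` has degree `d` (for a grading `𝒱` of `V`) if `F (φ₁ ⋯ φ_k)`
vanishes unless the degrees of the `φᵢ` add up to `-d`. -/
def HasDegree (𝒱 : ℤ → Submodule ℂ V) (F : Module.Dual ℂ (GSym V)) (d : ℤ) : Prop :=
  ∀ (k : ℕ) (φ : Fin k → V) (e : Fin k → ℤ), (∀ i, φ i ∈ 𝒱 (e i)) → ∑ i, e i ≠ -d →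
    F (GSym.mon φ) = 0

end Super

/-! ## Spacetime, smooth functions, and differential forms -/

/-- `ℂ²ⁿ × ℝᵐ`, with coordinates `(z, w, t)`; `(z, w)` are Darboux coordinates. -/
abbrev Spacetime (n m : ℕ) : Type := (Fin n → ℂ) × (Fin n → ℂ) × (Fin m → ℝ)

section Smooth

variable {n m : ℕ}

/-- Extension by zero of a function on `U`. -/
def extendZero {U : Opens (Spacetime n m)} (f : U → ℂ) : Spacetime n m → ℂ :=
  Function.extend Subtype.val f 0

theorem extendZero_apply {U : Opens (Spacetime n m)} (f : U → ℂ) (x : U) :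
    extendZero f x = f x := Subtype.val_injective.extend_apply f 0 x

/-- Smooth complex-valued functions on the open set `U`. -/
def Smooth (U : Opens (Spacetime n m)) : Subalgebra ℂ (U → ℂ) where
  carrier := {f | ContDiffOn ℝ ∞ (extendZero f) U}
  mul_mem' {f g} hf hg :=
    (ContDiffOn.mul hf hg).congr fun x hx => by
      simp only [extendZero_apply (U := U) _ ⟨x, hx⟩, Pi.mul_apply]
  add_mem' {f g} hf hg :=
    (ContDiffOn.add hf hg).congr fun x hx => by
      simp only [Pi.add_apply, extendZero_apply f ⟨x, hx⟩,
        extendZero_apply g ⟨x, hx⟩, extendZero_apply (f + g) ⟨x, hx⟩]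
  algebraMap_mem' c :=
    (contDiffOn_const (c := c)).congr fun x hx => extendZero_apply (algebraMap ℂ (U → ℂ) c) ⟨x, hx⟩

theorem differentiableAt_smooth {U : Opens (Spacetime n m)} (f : Smooth U) (x : U) :
    DifferentiableAt ℝ (extendZero f.1) x :=
  (f.2.contDiffAt (U.isOpen.mem_nhds x.2)).differentiableAt (by simp)

/-- The directional derivative `∂_v f`. -/
def dirDeriv {U : Opens (Spacetime n m)} (v : Spacetime n m) : Smooth U →ₗ[ℂ] Smooth U where
  toFun f := ⟨fun x => fderiv ℝ (extendZero f.1) x v, by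
    have h : ContDiffOn ℝ ∞ (fun x => fderiv ℝ (extendZero f.1) x v) U :=
      (f.2.fderiv_of_isOpen U.isOpen (by simp)).clm_apply contDiffOn_const
    exact h.congr fun x hx => extendZero_apply (U := U) _ ⟨x, hx⟩⟩
  map_add' f g := by
    ext x
    have e : extendZero (f + g : Smooth U).1 =ᶠ[nhds (x : Spacetime n m)]
        extendZero f.1 + extendZero g.1 := by
      filter_upwards [U.isOpen.mem_nhds x.2] with y hy
      simp [extendZero_apply _ (⟨y, hy⟩ : U)]
    change fderiv ℝ (extendZero (f + g : Smooth U).1) x v = _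
    rw [e.fderiv_eq, fderiv_add (differentiableAt_smooth f x) (differentiableAt_smooth g x)]
    rfl
  map_smul' c f := by
    ext x
    have e : extendZero (c • f : Smooth U).1 =ᶠ[nhds (x : Spacetime n m)]
        c • extendZero f.1 := by
      filter_upwards [U.isOpen.mem_nhds x.2] with y hy
      simp [extendZero_apply _ (⟨y, hy⟩ : U)]
    change fderiv ℝ (extendZero (c • f : Smooth U).1) x v = _
    rw [e.fderiv_eq, fderiv_const_smul (differentiableAt_smooth f x)]
    rfl

/-- Restriction of functions along `V ≤ U`. -/
def resFun {U V : Opens (Spacetime n m)} (h : V ≤ U) : Smooth U →ₐ[ℂ] Smooth V where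
  toFun f := ⟨fun x => f.1 ⟨x, h x.2⟩, (f.2.mono h).congr fun x hx => by
    rw [extendZero_apply _ (⟨x, hx⟩ : V), extendZero_apply _ (⟨x, h hx⟩ : U)]⟩
  map_one' := rfl
  map_mul' _ _ := rfl
  map_zero' := rfl
  map_add' _ _ := rfl
  commutes' _ := rfl

/-- The coordinate vectors `∂/∂x` and `∂/∂y` for the coordinates `zᵢ = x + i y` (`c = 1`, `c = I`). -/
def vecZ (c : ℂ) (i : Fin n) : Spacetime n m := (Pi.single i c, 0, 0)

/-- The coordinate vectors for the coordinates `wᵢ`. -/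
def vecW (c : ℂ) (i : Fin n) : Spacetime n m := (0, Pi.single i c, 0)

/-- The coordinate vectors for the coordinates `tⱼ`. -/
def vecT (j : Fin m) : Spacetime n m := (0, 0, Pi.single j 1)

variable {U : Opens (Spacetime n m)}

/-- `∂/∂zᵢ = (∂/∂x - i ∂/∂y) / 2`. -/
def dZ (i : Fin n) : Smooth U →ₗ[ℂ] Smooth U :=
  (1 / 2 : ℂ) • (dirDeriv (U := U) (vecZ 1 i) - Complex.I • dirDeriv (U := U) (vecZ Complex.I i))

/-- `∂/∂z̄ᵢ = (∂/∂x + i ∂/∂y) / 2`. -/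
def dZbar (i : Fin n) : Smooth U →ₗ[ℂ] Smooth U :=
  (1 / 2 : ℂ) • (dirDeriv (U := U) (vecZ 1 i) + Complex.I • dirDeriv (U := U) (vecZ Complex.I i))

/-- `∂/∂wᵢ`. -/
def dW (i : Fin n) : Smooth U →ₗ[ℂ] Smooth U :=
  (1 / 2 : ℂ) • (dirDeriv (U := U) (vecW 1 i) - Complex.I • dirDeriv (U := U) (vecW Complex.I i))

/-- `∂/∂w̄ᵢ`. -/
def dWbar (i : Fin n) : Smooth U →ₗ[ℂ] Smooth U :=
  (1 / 2 : ℂ) • (dirDeriv (U := U) (vecW 1 i) + Complex.I • dirDeriv (U := U) (vecW Complex.I i))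

end Smooth

/-- The exterior algebra on `dz̄₁, …, dz̄ₙ, dw̄₁, …, dw̄ₙ, dt₁, …, dtₘ` (in this order). -/
abbrev Lam (n m : ℕ) : Type := ExteriorAlgebra ℂ (Fin (n + n + m) → ℂ)

/-- The generators of `Lam`. -/
def gen {n m : ℕ} (k : Fin (n + n + m)) : Lam n m := ExteriorAlgebra.ι ℂ (Pi.single k 1)

/-- `Ω^{0,•}(ℂ²ⁿ) ⊗̂ Ω^•(ℝᵐ)` on the open set `U`: forms `∑ f_{IJK} dz̄_I dw̄_J dt_K` with smooth
coefficients. -/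
def Forms (n m : ℕ) (U : Opens (Spacetime n m)) : Type := Smooth U ⊗[ℂ] Lam n m

section Forms

variable {n m : ℕ} {U V : Opens (Spacetime n m)}

instance : Ring (Forms n m U) := inferInstanceAs (Ring (Smooth U ⊗[ℂ] Lam n m))
instance : Algebra ℂ (Forms n m U) := inferInstanceAs (Algebra ℂ (Smooth U ⊗[ℂ] Lam n m))

/-- The operator on forms which acts by `D` on coefficients and by `L` on `Lam`. -/
def formOp (D : Smooth U →ₗ[ℂ] Smooth U) (L : Lam n m →ₗ[ℂ] Lam n m) :
    Forms n m U →ₗ[ℂ] Forms n m U :=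
  TensorProduct.map D L

/-- Parity with respect to the form degree. -/
instance : SuperSpace (Forms n m U) where
  par := formOp LinearMap.id (ExteriorAlgebra.map (-LinearMap.id)).toLinearMap
  par_par v := by
    have h : (ExteriorAlgebra.map (-LinearMap.id : (Fin (n + n + m) → ℂ) →ₗ[ℂ] _)).comp
        (ExteriorAlgebra.map (-LinearMap.id)) = AlgHom.id ℂ (Lam n m) := by
      rw [ExteriorAlgebra.map_comp_map]
      simp
    have h' := congrArg AlgHom.toLinearMap h
    rw [AlgHom.comp_toLinearMap] at h'
    change (TensorProduct.map _ _ ∘ₗ TensorProduct.map _ _) v = v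
    rw [← TensorProduct.map_comp, h']
    change TensorProduct.map LinearMap.id LinearMap.id v = v
    rw [TensorProduct.map_id]
    rfl

/-- Forms of degree `p` (zero if `p < 0`). -/
def formsDeg (U : Opens (Spacetime n m)) (p : ℤ) : Submodule ℂ (Forms n m U) :=
  Submodule.span ℂ {a | ∃ (k : ℕ) (f : Smooth U) (l : Lam n m), (k : ℤ) = p ∧
    l ∈ ⋀[ℂ]^k (Fin (n + n + m) → ℂ) ∧ a = (f ⊗ₜ[ℂ] l : Smooth U ⊗[ℂ] Lam n m)}

/-- Restriction of forms. -/
def res (h : V ≤ U) : Forms n m U →ₐ[ℂ] Forms n m V :=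
  Algebra.TensorProduct.map (resFun h) (AlgHom.id ℂ (Lam n m))

/-- The coefficient function of a form with respect to a linear functional on `Lam`. -/
def coeff (l : Module.Dual ℂ (Lam n m)) : Forms n m U →ₗ[ℂ] Smooth U :=
  (TensorProduct.rid ℂ (Smooth U)).toLinearMap ∘ₗ TensorProduct.map LinearMap.id l

/-- The differential `∂̄ + d_{dR}`. -/
def dForm : Forms n m U →ₗ[ℂ] Forms n m U :=
  ∑ i : Fin n, formOp (dZbar i) (LinearMap.mulLeft ℂ (gen (Fin.castAdd m (Fin.castAdd n i))))
    + ∑ i : Fin n, formOp (dWbar i) (LinearMap.mulLeft ℂ (gen (Fin.castAdd m (Fin.natAdd n i))))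
    + ∑ j : Fin m, formOp (dirDeriv (vecT j)) (LinearMap.mulLeft ℂ (gen (Fin.natAdd (n + n) j)))

/-- The wedge product, as a bilinear map. -/
def wedge : Forms n m U →ₗ[ℂ] Forms n m U →ₗ[ℂ] Forms n m U := LinearMap.mul ℂ (Forms n m U)

/-- The Poisson bracket of the standard holomorphic symplectic structure, extended to forms:
`{f dx_I, g dx_J} = ∑ᵢ (∂_{zᵢ} f ∂_{wᵢ} g - ∂_{wᵢ} f ∂_{zᵢ} g) dx_I ∧ dx_J`. -/
def poisson : Forms n m U →ₗ[ℂ] Forms n m U →ₗ[ℂ] Forms n m U :=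
  ∑ i : Fin n,
    (wedge.compl₁₂ (formOp (dZ i) LinearMap.id) (formOp (dW i) LinearMap.id)
      - wedge.compl₁₂ (formOp (dW i) LinearMap.id) (formOp (dZ i) LinearMap.id))

theorem res_par (h : V ≤ U) (a : Forms n m U) : res h (par a) = par (res h a) := by
  have : (res h).toLinearMap ∘ₗ (par : Forms n m U →ₗ[ℂ] Forms n m U)
      = par ∘ₗ (res h).toLinearMap := by
    change TensorProduct.map _ _ ∘ₗ TensorProduct.map _ _
      = TensorProduct.map _ _ ∘ₗ TensorProduct.map _ _
    rw [← TensorProduct.map_comp, ← TensorProduct.map_comp]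
    rfl
  exact DFunLike.congr_fun this a

/-- The coefficient of the top form `dz̄₁ ⋯ dz̄ₙ dw̄₁ ⋯ dw̄ₙ dt₁ ⋯ dtₘ`. -/
def topLam : Module.Dual ℂ (Lam n m) :=
  ExteriorAlgebra.liftAlternating (R := ℂ)
    (Function.update 0 (n + n + m) Matrix.detRowAlternating)

/-- `∫ dz₁ ⋯ dzₙ dw₁ ⋯ dwₙ ∧ a` for a form `a` on `ℂ²ⁿ × ℝᵐ` (with compactly supported
coefficients); the constant is `dⁿz dⁿw dⁿz̄ dⁿw̄ dᵐt = 4ⁿ · (Lebesgue measure)`. -/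
def integral (a : Forms n m ⊤) : ℂ :=
  4 ^ n * ∫ x : Spacetime n m, (coeff topLam a).1 ⟨x, trivial⟩

/-- Compactly supported forms on `ℂ²ⁿ × ℝᵐ`. -/
def FormsC (n m : ℕ) : Submodule ℂ (Forms n m ⊤) where
  carrier := {a | ∃ K : Set (Spacetime n m), IsCompact K ∧
    ∀ V : Opens (Spacetime n m), Disjoint (V : Set (Spacetime n m)) K →
      res (le_top : V ≤ ⊤) a = 0}
  add_mem' := by
    rintro a b ⟨K, hK, ha⟩ ⟨L, hL, hb⟩
    refine ⟨K ∪ L, hK.union hL, fun V hV => ?_⟩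
    rw [Set.disjoint_union_right] at hV
    rw [map_add, ha V hV.1, hb V hV.2, add_zero]
  zero_mem' := ⟨∅, isCompact_empty, fun V _ => map_zero _⟩
  smul_mem' := by
    rintro c a ⟨K, hK, ha⟩
    exact ⟨K, hK, fun V hV => by rw [map_smul, ha V hV, smul_zero]⟩

theorem par_mem_FormsC {a : Forms n m ⊤} (ha : a ∈ FormsC n m) : par a ∈ FormsC n m := by
  obtain ⟨K, hK, h⟩ := ha
  exact ⟨K, hK, fun V hV => by rw [res_par, h V hV, map_zero]⟩

theorem mul_mem_FormsC {a : Forms n m ⊤} (ha : a ∈ FormsC n m) (b : Forms n m ⊤) :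
    a * b ∈ FormsC n m := by
  obtain ⟨K, hK, h⟩ := ha
  exact ⟨K, hK, fun V hV => by rw [map_mul, h V hV, zero_mul]⟩

theorem coeff_res (h : V ≤ U) (l : Module.Dual ℂ (Lam n m)) (a : Forms n m U) :
    coeff l (res h a) = resFun h (coeff l a) := by
  have : coeff l ∘ₗ (res h).toLinearMap = (resFun h).toLinearMap ∘ₗ coeff (U := U) l := by
    apply TensorProduct.ext'
    intro f x
    change (TensorProduct.rid ℂ (Smooth V)) (resFun h f ⊗ₜ l x)
      = resFun h ((TensorProduct.rid ℂ (Smooth U)) (f ⊗ₜ l x))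
    simp
  exact DFunLike.congr_fun this a

theorem integrable_of_FormsC {a : Forms n m ⊤} (ha : a ∈ FormsC n m)
    (l : Module.Dual ℂ (Lam n m)) :
    MeasureTheory.Integrable (fun x : Spacetime n m => (coeff l a).1 ⟨x, trivial⟩) := by
  obtain ⟨K, hK, h⟩ := ha
  have hc : Continuous (fun x : Spacetime n m => (coeff l a).1 ⟨x, trivial⟩) := by
    have := (coeff l a).2.continuousOn
    rw [Opens.coe_top, continuousOn_univ] at this
    exact this.congr fun x => extendZero_apply _ (⟨x, trivial⟩ : (⊤ : Opens (Spacetime n m)))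
  refine hc.integrable_of_hasCompactSupport (HasCompactSupport.intro hK fun x hx => ?_)
  let V : Opens (Spacetime n m) := ⟨Kᶜ, hK.isClosed.isOpen_compl⟩
  have hV := h V (Set.disjoint_left.2 fun _ h1 h2 => h1 h2)
  have h0 := coeff_res (le_top : V ≤ ⊤) l a
  rw [hV, map_zero] at h0
  exact (congrFun (congrArg Subtype.val h0) ⟨x, hx⟩).symm

/-- Integration of compactly supported forms. -/
def integralC : FormsC n m →ₗ[ℂ] ℂ where
  toFun a := integral a.1
  map_add' a b := by
    simp only [integral, Submodule.coe_add, map_add]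
    rw [← mul_add, ← MeasureTheory.integral_add (integrable_of_FormsC a.2 _)
      (integrable_of_FormsC b.2 _)]
    rfl
  map_smul' c a := by
    simp only [integral, Submodule.coe_smul, map_smul, RingHom.id_apply]
    rw [smul_eq_mul, mul_left_comm, ← smul_eq_mul c, ← MeasureTheory.integral_smul]
    rfl

/-- Wedge product of a compactly supported form with a form. -/
def wedgeC : FormsC n m →ₗ[ℂ] Forms n m ⊤ →ₗ[ℂ] FormsC n m :=
  LinearMap.mk₂ ℂ (fun a b => ⟨a.1 * b, mul_mem_FormsC a.2 b⟩)
    (fun a a' b => Subtype.ext (add_mul a.1 a'.1 b))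
    (fun c a b => Subtype.ext (smul_mul_assoc c a.1 b))
    (fun a b b' => Subtype.ext (mul_add a.1 b b'))
    (fun c a b => Subtype.ext (mul_smul_comm c a.1 b))

instance : SuperSpace (FormsC n m) where
  par := (par ∘ₗ (FormsC n m).subtype).codRestrict (FormsC n m) fun a => par_mem_FormsC a.2
  par_par v := Subtype.ext (par_par v.1)

end Forms

/-! ## The dg Lie algebra `L_n` and its de Rham version -/

/-- `L_n = Ω^{0,•}(ℂ²ⁿ)`, with differential `dForm` and bracket `poisson`. -/
abbrev L (n : ℕ) : Type := Forms n 0 ⊤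

/-- `(L_n)_{dR} = L_n ⊕ L_n[1]`: the pair `(α, β)` stands for `α + ε β`, where `ε` has degree
`-1`, `ε² = 0` and `dε = 1`. -/
abbrev LdR (n : ℕ) : Type := L n × L n

/-- The degree `j` part of `(L_n)_{dR}`. -/
def dRDeg (n : ℕ) (j : ℤ) : Submodule ℂ (LdR n) := (formsDeg ⊤ j).prod (formsDeg ⊤ (j + 1))

/-- `d (α + ε β) = dα + β - ε dβ`: the cone of the identity `L_n[1] → L_n`. -/
def dRDiff {n : ℕ} (x : LdR n) : LdR n := (dForm x.1 + x.2, -dForm x.2)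

/-- `[α + ε β, α' + ε β'] = {α, α'} + ε ({β, α'} + (-1)^{|α|} {α, β'})`. -/
def dRBracket {n : ℕ} (x y : LdR n) : LdR n :=
  (poisson x.1 y.1, poisson x.2 y.1 + poisson (par x.1) y.2)

/-! ## The fields of Poisson BF theory -/

section Theory

variable {n m : ℕ}

/-- Functions on `ℂ²ⁿ` pulled back to an open subset of `ℂ²ⁿ × ℝᵐ`. -/
def pullFun (U : Opens (Spacetime n m)) : Smooth (⊤ : Opens (Spacetime n 0)) →ₐ[ℂ] Smooth U where
  toFun f := ⟨fun x => f.1 ⟨(x.1.1, x.1.2.1, 0), trivial⟩, by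
    have hf : ContDiff ℝ ∞ (extendZero f.1) := by
      have := f.2
      change ContDiffOn ℝ ∞ (extendZero f.1) Set.univ at this
      exact contDiffOn_univ.1 this
    have hg : ContDiff ℝ ∞ (fun x : Spacetime n m => ((x.1, x.2.1, 0) : Spacetime n 0)) := by
      fun_prop
    refine (hf.comp hg).contDiffOn.congr fun x hx => ?_
    rw [extendZero_apply _ (⟨x, hx⟩ : U)]
    exact (extendZero_apply f.1
      (⟨(x.1, x.2.1, 0), trivial⟩ : (⊤ : Opens (Spacetime n 0)))).symm⟩
  map_one' := rfl
  map_mul' _ _ := rfl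
  map_zero' := rfl
  map_add' _ _ := rfl
  commutes' _ := rfl

/-- `dz̄ᵢ ↦ dz̄ᵢ`, `dw̄ᵢ ↦ dw̄ᵢ`. -/
def pullGen (n m : ℕ) : (Fin (n + n + 0) → ℂ) →ₗ[ℂ] (Fin (n + n + m) → ℂ) :=
  LinearMap.pi (Fin.addCases (fun i => LinearMap.proj (Fin.castAdd 0 i)) (fun _ => 0))

/-- The pullback `p^* : Ω^{0,•}(ℂ²ⁿ) → Ω^{0,•}(ℂ²ⁿ) ⊗̂ Ω^•(ℝᵐ)` along the projection. -/
def pull (m : ℕ) : L n →ₐ[ℂ] Forms n m ⊤ :=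
  Algebra.TensorProduct.map (pullFun ⊤) (ExteriorAlgebra.map (pullGen n m))

/-- The fields over `U`: pairs `(A, b)` standing for `(A, B)` with `B = b dz₁⋯dzₙ dw₁⋯dwₙ`. -/
def Fields (n m : ℕ) (U : Opens (Spacetime n m)) : Type := Forms n m U × Forms n m U

instance (U : Opens (Spacetime n m)) : AddCommGroup (Fields n m U) :=
  inferInstanceAs (AddCommGroup (Forms n m U × Forms n m U))
instance (U : Opens (Spacetime n m)) : Module ℂ (Fields n m U) :=
  inferInstanceAs (Module ℂ (Forms n m U × Forms n m U))

/-- The compactly supported fields on `ℂ²ⁿ × ℝᵐ`. -/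
def FieldsC (n m : ℕ) : Type := FormsC n m × FormsC n m

instance : AddCommGroup (FieldsC n m) := inferInstanceAs (AddCommGroup (FormsC n m × FormsC n m))
instance : Module ℂ (FieldsC n m) := inferInstanceAs (Module ℂ (FormsC n m × FormsC n m))

/-- The grading of the fields: `A ∈ Ω^{0,•} ⊗̂ Ω^• [1]` and `B ∈ Ω^{2n,•} ⊗̂ Ω^• [2n + m - 2]`. -/
def fieldsDeg (U : Opens (Spacetime n m)) (d : ℤ) : Submodule ℂ (Fields n m U) :=
  (formsDeg U (d + 1)).prod (formsDeg U (d + (2 * n + m - 2)))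

/-- Parity of the fields: `|A|` is the form degree plus `1`, `|B|` is the form degree plus `m`. -/
instance (U : Opens (Spacetime n m)) : SuperSpace (Fields n m U) where
  par := LinearMap.prodMap (-par : Forms n m U →ₗ[ℂ] Forms n m U)
    ((-1 : ℂ) ^ m • par : Forms n m U →ₗ[ℂ] Forms n m U)
  par_par v := by
    refine Prod.ext ?_ ?_
    · change -par (-par v.1) = v.1
      rw [map_neg, neg_neg, par_par]
    · change (-1 : ℂ) ^ m • par ((-1 : ℂ) ^ m • par v.2) = v.2
      rw [map_smul, smul_smul, par_par, ← mul_pow]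
      simp

instance : SuperSpace (FieldsC n m) where
  par := LinearMap.prodMap (-par : FormsC n m →ₗ[ℂ] FormsC n m)
    ((-1 : ℂ) ^ m • par : FormsC n m →ₗ[ℂ] FormsC n m)
  par_par v := by
    refine Prod.ext ?_ ?_
    · change -par (-par v.1) = v.1
      rw [map_neg, neg_neg, par_par]
    · change (-1 : ℂ) ^ m • par ((-1 : ℂ) ^ m • par v.2) = v.2
      rw [map_smul, smul_smul, par_par, ← mul_pow]
      simp

/-- Restriction of fields. -/
def resFields {U V : Opens (Spacetime n m)} (h : V ≤ U) : Fields n m U →ₗ[ℂ] Fields n m V :=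
  LinearMap.prodMap (res h).toLinearMap (res h).toLinearMap

theorem resFields_par {U V : Opens (Spacetime n m)} (h : V ≤ U) (φ : Fields n m U) :
    resFields h (par φ) = par (resFields h φ) := by
  refine Prod.ext ?_ ?_
  · change res h (-par φ.1) = -par (res h φ.1)
    rw [map_neg, res_par]
  · change res h ((-1 : ℂ) ^ m • par φ.2) = (-1 : ℂ) ^ m • par (res h φ.2)
    rw [map_smul, res_par]

/-- The inclusion of the compactly supported fields. -/
def inclC : FieldsC n m →ₗ[ℂ] Fields n m ⊤ :=
  LinearMap.prodMap (FormsC n m).subtype (FormsC n m).subtype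

theorem inclC_par (φ : FieldsC n m) : inclC (par φ) = par (inclC φ) := rfl

/-- Restriction on graded-symmetric algebras of fields. -/
def resSym {U V : Opens (Spacetime n m)} (h : V ≤ U) :
    GSym (Fields n m U) →ₐ[ℂ] GSym (Fields n m V) :=
  GSym.map (resFields h) (resFields_par h)

/-- Inclusion on graded-symmetric algebras of fields. -/
def inclSym : GSym (FieldsC n m) →ₐ[ℂ] GSym (Fields n m ⊤) := GSym.map inclC inclC_par

/-- The grading of the compactly supported fields. -/
def fieldsCDeg (n m : ℕ) (d : ℤ) : Submodule ℂ (FieldsC n m) := (fieldsDeg ⊤ d).comap inclC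

/-! ## Functionals of the fields -/

/-- Functionals on compactly supported fields: `∏_k Hom(Sym^k E_c, ℂ)`. -/
abbrev Functional (n m : ℕ) : Type := Module.Dual ℂ (GSym (FieldsC n m))

/-- The `A`-field as a form-valued functional. -/
def fieldA : GSym (FieldsC n m) →ₗ[ℂ] Forms n m ⊤ :=
  (FormsC n m).subtype ∘ₗ LinearMap.fst ℂ (FormsC n m) (FormsC n m) ∘ₗ GSym.lin

/-- The `B`-field as a form-valued functional. -/
def fieldB : GSym (FieldsC n m) →ₗ[ℂ] FormsC n m :=
  LinearMap.snd ℂ (FormsC n m) (FormsC n m) ∘ₗ GSym.lin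

/-- The constant form-valued functional with value `a`. -/
def constForm (a : Forms n m ⊤) : GSym (FieldsC n m) →ₗ[ℂ] Forms n m ⊤ :=
  (LinearMap.toSpanSingleton ℂ (Forms n m ⊤) a) ∘ₗ GSym.aug

/-- The functional `∫ B ∧ T` for a form-valued functional `T`. -/
def intB (T : GSym (FieldsC n m) →ₗ[ℂ] Forms n m ⊤) : Functional n m :=
  integralC ∘ₗ conv wedgeC fieldB T

/-- The action functional `S(A, B) = ∫ B ∧ (dA + ½ {A, A})`, with `d = ∂̄ + d_{dR}`. -/
def actionS (n m : ℕ) : Functional n m :=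
  intB (dForm ∘ₗ fieldA + (1 / 2 : ℂ) • conv poisson fieldA fieldA)

/-- `P_α(A, B) = ∫ B ∧ {p^*α, A}`. -/
def funP (m : ℕ) (α : L n) : Functional n m :=
  intB (conv poisson (constForm (pull m α)) fieldA)

/-- `Q_α(A, B) = ∫ B ∧ p^*α`. -/
def funQ (m : ℕ) (α : L n) : Functional n m := intB (constForm (pull m α))

/-- Labels of the jet coordinates of the fields: `A` or `B`, a linear functional on `Lam`, and a
list of directions of differentiation. -/
abbrev JetIndex (n m : ℕ) : Type := Bool × Module.Dual ℂ (Lam n m) × List (Spacetime n m)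

/-- The jet coordinate labelled by `j` of the field `φ`, a function on `U`. -/
def jet {U : Opens (Spacetime n m)} (j : JetIndex n m) (φ : Fields n m U) : Smooth U :=
  j.2.2.foldr (fun v f => dirDeriv v f) (coeff j.2.1 (if j.1 then φ.1 else φ.2))

/-- Local functionals, reduced (no constant term): in each symmetric degree `k + 1` they are
finite sums of integrals `∫ f · ∂_{j₀} φ₀ ⋯ ∂_{j_k} φ_k` of products of derivatives of the fields
with smooth coefficients. -/
def Oloc (n m : ℕ) : Submodule ℂ (Functional n m) where
  carrier := {F | F 1 = 0 ∧ ∀ k : ℕ, (fun φ : Fin (k + 1) → FieldsC n m => F (GSym.mon φ)) ∈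
    Submodule.span ℂ {T : (Fin (k + 1) → FieldsC n m) → ℂ |
      ∃ (f : Smooth (⊤ : Opens (Spacetime n m))) (j : Fin (k + 1) → JetIndex n m),
        ∀ φ, T φ = ∫ x : Spacetime n m,
          f.1 ⟨x, trivial⟩ * ∏ i, (jet (j i) (inclC (φ i))).1 ⟨x, trivial⟩}}
  add_mem' ha hb := ⟨by rw [LinearMap.add_apply, ha.1, hb.1, add_zero],
    fun k => Submodule.add_mem _ (ha.2 k) (hb.2 k)⟩
  zero_mem' := ⟨rfl, fun k => Submodule.zero_mem _⟩
  smul_mem' c _ ha := ⟨by rw [LinearMap.smul_apply, ha.1, smul_zero],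
    fun k => Submodule.smul_mem _ c (ha.2 k)⟩

/-! ## The BV bracket -/

/-- The density of the `(-1)`-shifted symplectic pairing,
`ω((A₁, B₁), (A₂, B₂)) = ∫ (-1)^{|A₁|} B₂ ∧ A₁ - (-1)^{|A₂|} B₁ ∧ A₂` (form degrees). -/
def omegaDensity {U : Opens (Spacetime n m)} :
    Fields n m U →ₗ[ℂ] Fields n m U →ₗ[ℂ] Forms n m U :=
  (wedge.compl₁₂ (LinearMap.snd ℂ (Forms n m U) (Forms n m U))
      (par ∘ₗ LinearMap.fst ℂ (Forms n m U) (Forms n m U))).flip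
    - wedge.compl₁₂ (LinearMap.snd ℂ (Forms n m U) (Forms n m U))
      (par ∘ₗ LinearMap.fst ℂ (Forms n m U) (Forms n m U))

/-- Local (evolutionary) vector fields on the space of fields: graded-symmetric multilinear maps
from the fields to the fields, compatible with restriction to open subsets. -/
structure LocalVF (n m : ℕ) where
  toFun : ∀ U : Opens (Spacetime n m), GSym (Fields n m U) →ₗ[ℂ] Fields n m U
  natural : ∀ (U V : Opens (Spacetime n m)) (h : V ≤ U) (w : GSym (Fields n m U)),
    resFields h (toFun U w) = toFun V (resSym h w)

/-- `X` is the Hamiltonian vector field of `F`: `ω(X(w), φ) = F(w φ)` for compactly supported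
`φ`, i.e. `ι_X ω = dF`. There is at most one such `X`, and exactly one if `F` is local. -/
def IsHamiltonian (F : Functional n m) (X : LocalVF n m) : Prop :=
  ∀ (w : GSym (FieldsC n m)) (φ : FieldsC n m),
    integral (omegaDensity (X.toFun ⊤ (inclSym w)) (inclC φ)) = F (w * GSym.ι φ)

/-- `H` is the BV bracket `{F, G}_{BV} = ω(X_F, X_G)`, taken modulo constants. -/
def IsBVBracket (F G H : Functional n m) : Prop :=
  ∃ X Y : LocalVF n m, IsHamiltonian F X ∧ IsHamiltonian G Y ∧ H 1 = 0 ∧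
    ∀ w : GSym (FieldsC n m), GSym.aug w = 0 →
      H w = integral (conv omegaDensity (X.toFun ⊤) (Y.toFun ⊤) (inclSym w))

/-! ## Classical observables -/

/-- The classical observables on `U`, as a graded vector space: `∏_k (E(U)^{⊗̂k})^∨_{S_k}`, the
functionals on `Sym E(U)` which are continuous in each symmetric degree for the topology of
uniform convergence of all derivatives on compact subsets of `U`. -/
def Obs {n m : ℕ} (U : Opens (Spacetime n m)) : Submodule ℂ (Module.Dual ℂ (GSym (Fields n m U))) where
  carrier := {F | ∀ k : ℕ, ∃ (K : Set U) (J : List (JetIndex n m)) (C : ℝ), IsCompact K ∧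
    ∀ (φ : Fin k → Fields n m U) (c : Fin k → ℝ), (∀ i, 0 ≤ c i) →
      (∀ i, ∀ j ∈ J, ∀ x ∈ K, ‖(jet j (φ i)).1 x‖ ≤ c i) → ‖F (GSym.mon φ)‖ ≤ C * ∏ i, c i}
  add_mem' := by
    intro F G hF hG k
    obtain ⟨K, J, C, hK, hF⟩ := hF k
    obtain ⟨K', J', C', hK', hG⟩ := hG k
    refine ⟨K ∪ K', J ++ J', C + C', hK.union hK', fun φ c hc h => ?_⟩
    rw [LinearMap.add_apply, add_mul]
    refine (norm_add_le _ _).trans (add_le_add ?_ ?_)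
    · exact hF φ c hc fun i j hj x hx => h i j (List.mem_append_left _ hj) x (Or.inl hx)
    · exact hG φ c hc fun i j hj x hx => h i j (List.mem_append_right _ hj) x (Or.inr hx)
  zero_mem' := fun k => ⟨∅, [], 0, isCompact_empty, fun φ c _ _ => by simp⟩
  smul_mem' := by
    intro a F hF k
    obtain ⟨K, J, C, hK, hF⟩ := hF k
    refine ⟨K, J, ‖a‖ * C, hK, fun φ c hc h => ?_⟩
    rw [LinearMap.smul_apply, norm_smul, mul_assoc]
    exact mul_le_mul_of_nonneg_left (hF φ c hc h) (norm_nonneg a)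

/-- Extension of functionals along `U ≤ V`, dual to restriction of fields. -/
def extObs {U V : Opens (Spacetime n m)} (h : U ≤ V) :
    Module.Dual ℂ (GSym (Fields n m U)) →ₗ[ℂ] Module.Dual ℂ (GSym (Fields n m V)) :=
  Module.Dual.transpose (R := ℂ) (resSym h).toLinearMap

/-- The product of functionals. -/
def mulObs {U : Opens (Spacetime n m)} (F G : Module.Dual ℂ (GSym (Fields n m U))) :
    Module.Dual ℂ (GSym (Fields n m U)) :=
  conv (LinearMap.mul ℂ ℂ) F G

/-- Families of linear endomorphisms of the observables on all open sets. -/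
abbrev ObsOp (n m : ℕ) : Type := ∀ U : Opens (Spacetime n m), Module.End ℂ (Obs U)

/-- `T` is a derivation of degree `j` of the factorization algebra of classical observables: it
has degree `j`, kills the unit, commutes with the structure maps `Obs(U) → Obs(V)`, and satisfies
the Leibniz rule for the structure maps `Obs(U₁) ⊗ Obs(U₂) → Obs(V)` with `U₁`, `U₂` disjoint. -/
structure IsDerivation (T : ObsOp n m) (j : ℤ) : Prop where
  degree : ∀ (U : Opens (Spacetime n m)) (O : Obs U) (d : ℤ),
    HasDegree (fieldsDeg U) O.1 d → HasDegree (fieldsDeg U) (T U O).1 (d + j)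
  unit : ∀ (U : Opens (Spacetime n m)) (O : Obs U), O.1 = GSym.aug → T U O = 0
  ext : ∀ (U V : Opens (Spacetime n m)) (h : U ≤ V) (O : Obs U) (O' : Obs V),
    O'.1 = extObs h O.1 → (T V O').1 = extObs h (T U O).1
  leibniz : ∀ (U₁ U₂ V : Opens (Spacetime n m)) (h₁ : U₁ ≤ V) (h₂ : U₂ ≤ V), Disjoint U₁ U₂ →
    ∀ (O₁ : Obs U₁) (O₂ : Obs U₂) (O : Obs V) (d : ℤ), HasDegree (fieldsDeg U₁) O₁.1 d →
      O.1 = mulObs (extObs h₁ O₁.1) (extObs h₂ O₂.1) →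
      (T V O).1 = mulObs (extObs h₁ (T U₁ O₁).1) (extObs h₂ O₂.1)
        + (-1 : ℂ) ^ (j * d) • mulObs (extObs h₁ O₁.1) (extObs h₂ (T U₂ O₂).1)

/-- The linear operator `w ↦ ∑ w' · (-1)^{|X||w''|} X(w'')` on `Sym E(U)` (with
`∑ w' ⊗ w''` the coproduct of `w`), which inserts the vector field `X` from the right. -/
def insertVF (X : LocalVF n m) (U : Opens (Spacetime n m)) :
    GSym (Fields n m U) →ₗ[ℂ] GSym (Fields n m U) :=
  TensorProduct.lift (LinearMap.mul ℂ (GSym (Fields n m U))) ∘ₗ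
    TensorProduct.map LinearMap.id
      (GSym.ι ∘ₗ (evenPart (X.toFun U) + oddPart (X.toFun U) ∘ₗ par)) ∘ₗ GSym.comul

/-- `T` is the operator `{F, -}_{BV}` on the classical observables, i.e. the derivative
along the Hamiltonian vector field of `F`. -/
def IsBVAction (F : Functional n m) (T : ObsOp n m) : Prop :=
  ∃ X : LocalVF n m, IsHamiltonian F X ∧
    ∀ (U : Opens (Spacetime n m)) (O : Obs U), (T U O).1 = -(O.1 ∘ₗ insertVF X U)

/-! ## Inner actions and de Rham actions -/

/-- `Φ` is a strict map of dg Lie algebras `(L_n)_{dR} → O_loc[-1]`, where `O_loc[-1]` has the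
differential `{S, -}_{BV}` and the bracket `{-, -}_{BV}`; in particular it is an inner action
of `(L_n)_{dR}` on Poisson BF theory. -/
structure IsInnerAction (Φ : LdR n →ₗ[ℂ] Functional n m) : Prop where
  isLocal : ∀ x, Φ x ∈ Oloc n m
  degree : ∀ j, ∀ x ∈ dRDeg n j, HasDegree (fieldsCDeg n m) (Φ x) (j - 1)
  diff : ∀ x, IsBVBracket (actionS n m) (Φ x) (Φ (dRDiff x))
  bracket : ∀ x y, IsBVBracket (Φ x) (Φ y) (Φ (dRBracket x y))

/-- `ρ` is a map of dg Lie algebras `(L_n)_{dR} → Der(Obs)`, where `Obs` has the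
differential `δ`, and `Der(Obs)` has the differential `[δ, -]` and the commutator bracket. -/
structure IsDeRhamAction (δ : ObsOp n m) (ρ : LdR n →ₗ[ℂ] ObsOp n m) : Prop where
  derivation : ∀ j, ∀ x ∈ dRDeg n j, IsDerivation (ρ x) j
  diff : ∀ j, ∀ x ∈ dRDeg n j,
    ρ (dRDiff x) = δ * ρ x - (-1 : ℂ) ^ j • (ρ x * δ)
  bracket : ∀ i j, ∀ x ∈ dRDeg n i, ∀ y ∈ dRDeg n j,
    ρ (dRBracket x y) = ρ x * ρ y - (-1 : ℂ) ^ (i * j) • (ρ y * ρ x)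

end Theory

end

end PoissonBF

/-! Every functional in play has the form ∫ B ∧ T. For x = α + εβ one takes T_x = {p^*α, A} -
p^*(par β), which is affine in A and gives P_α and ±Q_β; for the action, T_S = dA + ½{A, A}. The
Hamiltonian vector field of ∫ B ∧ T has T as its A-component. Its B-component arises by moving the
derivative of T off the test field, through Stokes' theorem and integration by parts for the Poisson
bracket (`intExt_dForm`, `intExt_poisson`). Up to signs this gives, with a = p^*α and b = p^*(par
β), the field X_x = ({a, A} - b, {a, B}) (`xVF`) and X_S = (dA + ½{A, A}, dB + {A, B}) (`sVF`). Both
make sense over every open set and commute with restriction.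

The theorem then rests on two identities of vector fields, [X_x, X_y] = X_[x,y] (`xVF_bracket`) and
[X_S, X_x] = X_dx (`sVF_bracket`). In the first, the linear parts match by the Jacobi identity and
the constant parts by graded antisymmetry. In the second, the Leibniz rule for d turns {a, -} into
{da, -}; the terms quadratic in the fields cancel by Jacobi; and the shift by b differentiates ½{A,
A} to {b, A} and dA to db. These last two contributions are the summands β and -ε dβ of the cone
differential. The only inputs about forms are that constant-coefficient operators are commuting
derivations and that pullback respects d and the bracket.

For the local functionals, ω(X_F, X_G) is written in components (`omega_conv`), and every bracket or
differential acting on B is integrated by parts onto T. What remains is ∫ B ∧ T_[x,y] or ∫ B ∧ T_dx,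
by `tX_bracket` and `tX_diff`. The degree of Φ(x) follows because the integral sees only top forms,
and locality because wedge and bracket are bidifferential operators.

For the observables, a vector field X extends to the coderivation `rins X` of the symmetric
coalgebra, and {F, -} is minus its transpose. Commutators of coderivations are coderivations of
brackets (`rins_comm`), so the same two identities give compatibility with differentials and
brackets. The coderivation property gives the Leibniz rule (`conv_rins`), naturality gives
compatibility with the structure maps, and estimates in each symmetric degree keep the operators
inside the continuous functionals (`comp_rins_mem_Obs`).

All Koszul signs are handled through parity involutions. Contraction with a homogeneous generator is
a graded derivation of convolution (`conv_ι_mul`); by induction on word length, identities between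
multilinear functionals thereby reduce to their values on 1. -/

namespace PoissonBF

noncomputable section

open SuperSpace

/-! ## Koszul signs -/

/-- The sign `(-1)^c`. -/
def sg (c : Bool) : ℂ := if c then -1 else 1

@[simp] theorem sg_true : sg true = -1 := rfl
@[simp] theorem sg_false : sg false = 1 := rfl

theorem sg_mul_self (c : Bool) : sg c * sg c = 1 := by cases c <;> simp

section Parity

variable {V W X Y Z : Type} [AddCommGroup V] [Module ℂ V] [SuperSpace V]
  [AddCommGroup W] [Module ℂ W] [SuperSpace W] [AddCommGroup X] [Module ℂ X]
  [AddCommGroup Y] [Module ℂ Y] [SuperSpace Y] [AddCommGroup Z] [Module ℂ Z]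

/-- The power `par^c` of the parity involution. -/
def parPow (c : Bool) : V →ₗ[ℂ] V := if c then par else LinearMap.id

@[simp] theorem parPow_true : (parPow true : V →ₗ[ℂ] V) = par := rfl
@[simp] theorem parPow_false : (parPow false : V →ₗ[ℂ] V) = LinearMap.id := rfl

/-- `v` is homogeneous of parity `c`. -/
def Par (c : Bool) (v : V) : Prop := par v = sg c • v

/-- `f` is a homogeneous linear map of parity `c`. -/
def ParMap (c : Bool) (f : V →ₗ[ℂ] W) : Prop := ∀ v, par (f v) = sg c • f (par v)

theorem par_ev (v : V) : Par false (GSym.ev v) := by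
  simp [Par, GSym.ev, par_par, add_comm]

theorem par_od (v : V) : Par true (GSym.od v) := by
  simp only [Par, GSym.od, sg_true, LinearMap.smul_apply, LinearMap.sub_apply, LinearMap.id_apply,
    map_smul, map_sub, par_par]
  module

theorem ev_add_od (v : V) : GSym.ev v + GSym.od v = v := by
  simp only [GSym.ev, GSym.od, LinearMap.smul_apply, LinearMap.add_apply, LinearMap.sub_apply,
    LinearMap.id_apply]
  module

theorem Par.even {v : V} (h : Par false v) : par v = v := by simpa [Par] using h

theorem Par.odd {v : V} (h : Par true v) : par v = -v := by simpa [Par] using h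

theorem Par.parPow {c : Bool} {v : V} (h : Par c v) (d : Bool) :
    PoissonBF.parPow d v = sg (d && c) • v := by
  cases d
  · simp
  · simpa [Par] using h

theorem Par.map {c i : Bool} {f : V →ₗ[ℂ] W} (hf : ParMap i f) {v : V} (h : Par c v) :
    Par (xor i c) (f v) := by
  rw [Par, hf, h, map_smul, smul_smul]
  cases c <;> cases i <;> simp

theorem ParMap.parPow {c : Bool} {f : V →ₗ[ℂ] W} (hf : ParMap c f) (d : Bool) (v : V) :
    PoissonBF.parPow d (f v) = sg (c && d) • f (PoissonBF.parPow d v) := by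
  cases d
  · simp
  · simpa using hf v

theorem ParMap.comp {c d : Bool} {g : W →ₗ[ℂ] Y} {f : V →ₗ[ℂ] W} (hg : ParMap d g)
    (hf : ParMap c f) : ParMap (xor d c) (g ∘ₗ f) := fun v => by
  rw [LinearMap.comp_apply, hg, hf, map_smul, smul_smul]
  cases c <;> cases d <;> simp

theorem ParMap.add {c : Bool} {f g : V →ₗ[ℂ] W} (hf : ParMap c f) (hg : ParMap c g) :
    ParMap c (f + g) := fun v => by
  simp [hf v, hg v]

theorem ParMap.smul {c : Bool} {f : V →ₗ[ℂ] W} (hf : ParMap c f) (a : ℂ) :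
    ParMap c (a • f) := fun v => by
  simp [hf v, smul_comm a]

theorem parMap_parPow (c : Bool) : ParMap false (parPow c : V →ₗ[ℂ] V) := fun v => by
  cases c <;> simp

theorem parPow_parPow (c d : Bool) (v : V) : parPow c (parPow d v) = parPow (xor c d) v := by
  cases c <;> cases d <;> simp [par_par]

theorem parMap_evenPart (g : V →ₗ[ℂ] W) : ParMap false (evenPart g) := fun v => by
  simp [evenPart, par_par, add_comm]

theorem parMap_oddPart (g : V →ₗ[ℂ] W) : ParMap true (oddPart g) := fun v => by
  simp only [oddPart, sg_true, LinearMap.smul_apply, LinearMap.sub_apply, LinearMap.comp_apply,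
    map_smul, map_sub, par_par]
  module

theorem evenPart_add_oddPart (g : V →ₗ[ℂ] W) : evenPart g + oddPart g = g := by
  simp only [evenPart, oddPart]
  module

theorem ParMap.evenPart {c : Bool} {g : V →ₗ[ℂ] W} (h : ParMap c g) :
    PoissonBF.evenPart g = if c then 0 else g := by
  ext v
  cases c
  · simp only [PoissonBF.evenPart, LinearMap.smul_apply, LinearMap.add_apply,
      LinearMap.comp_apply, h (par v), par_par, sg_false, Bool.false_eq_true, if_false]
    module
  · simp [PoissonBF.evenPart, h (par v), par_par]

theorem ParMap.oddPart {c : Bool} {g : V →ₗ[ℂ] W} (h : ParMap c g) :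
    PoissonBF.oddPart g = if c then g else 0 := by
  ext v
  cases c
  · simp [PoissonBF.oddPart, h (par v), par_par]
  · simp only [PoissonBF.oddPart, LinearMap.smul_apply, LinearMap.sub_apply,
      LinearMap.comp_apply, h (par v), par_par, sg_true, if_true]
    module

/-- For homogeneous `g` one of the two summands of `koszulMap` vanishes, and the Koszul sign becomes
a power of the parity involution on the first factor. The element `v` itself need not be
homogeneous. -/
theorem koszulMap_tmul {c : Bool} (f : V →ₗ[ℂ] X) {g : W →ₗ[ℂ] Y} (h : ParMap c g) (v : V)
    (w : W) : koszulMap f g (v ⊗ₜ w) = f (parPow c v) ⊗ₜ g w := by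
  rw [koszulMap, h.evenPart, h.oddPart]
  cases c <;> simp

theorem koszulMap_add_left (f f' : V →ₗ[ℂ] X) (g : W →ₗ[ℂ] Y) :
    koszulMap (f + f') g = koszulMap f g + koszulMap f' g := by
  simp only [koszulMap, LinearMap.add_comp, TensorProduct.map_add_left]
  abel

theorem koszulMap_smul_left (a : ℂ) (f : V →ₗ[ℂ] X) (g : W →ₗ[ℂ] Y) :
    koszulMap (a • f) g = a • koszulMap f g := by
  simp only [koszulMap, LinearMap.smul_comp, TensorProduct.map_smul_left, smul_add]

theorem evenPart_add (g g' : V →ₗ[ℂ] W) : evenPart (g + g') = evenPart g + evenPart g' := by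
  simp only [evenPart, LinearMap.add_comp, LinearMap.comp_add]
  module

theorem oddPart_add (g g' : V →ₗ[ℂ] W) : oddPart (g + g') = oddPart g + oddPart g' := by
  simp only [oddPart, LinearMap.add_comp, LinearMap.comp_add]
  module

theorem evenPart_smul (a : ℂ) (g : V →ₗ[ℂ] W) : evenPart (a • g) = a • evenPart g := by
  simp only [evenPart, LinearMap.smul_comp, LinearMap.comp_smul]
  module

theorem oddPart_smul (a : ℂ) (g : V →ₗ[ℂ] W) : oddPart (a • g) = a • oddPart g := by
  simp only [oddPart, LinearMap.smul_comp, LinearMap.comp_smul]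
  module

theorem koszulMap_add_right (f : V →ₗ[ℂ] X) (g g' : W →ₗ[ℂ] Y) :
    koszulMap f (g + g') = koszulMap f g + koszulMap f g' := by
  simp only [koszulMap, evenPart_add, oddPart_add, TensorProduct.map_add_right]
  abel

theorem koszulMap_smul_right (a : ℂ) (f : V →ₗ[ℂ] X) (g : W →ₗ[ℂ] Y) :
    koszulMap f (a • g) = a • koszulMap f g := by
  simp only [koszulMap, evenPart_smul, oddPart_smul, TensorProduct.map_smul_right, smul_add]

theorem conv_add_left (β : X →ₗ[ℂ] Y →ₗ[ℂ] Z) (f f' : GSym V →ₗ[ℂ] X) (g : GSym V →ₗ[ℂ] Y) :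
    conv β (f + f') g = conv β f g + conv β f' g := by
  simp only [conv, koszulMap_add_left, LinearMap.add_comp, LinearMap.comp_add]

theorem conv_add_right (β : X →ₗ[ℂ] Y →ₗ[ℂ] Z) (f : GSym V →ₗ[ℂ] X) (g g' : GSym V →ₗ[ℂ] Y) :
    conv β f (g + g') = conv β f g + conv β f g' := by
  simp only [conv, koszulMap_add_right, LinearMap.add_comp, LinearMap.comp_add]

theorem conv_smul_left (a : ℂ) (β : X →ₗ[ℂ] Y →ₗ[ℂ] Z) (f : GSym V →ₗ[ℂ] X)
    (g : GSym V →ₗ[ℂ] Y) : conv β (a • f) g = a • conv β f g := by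
  simp only [conv, koszulMap_smul_left, LinearMap.smul_comp, LinearMap.comp_smul]

theorem conv_smul_right (a : ℂ) (β : X →ₗ[ℂ] Y →ₗ[ℂ] Z) (f : GSym V →ₗ[ℂ] X)
    (g : GSym V →ₗ[ℂ] Y) : conv β f (a • g) = a • conv β f g := by
  simp only [conv, koszulMap_smul_right, LinearMap.smul_comp, LinearMap.comp_smul]

theorem conv_zero_left (β : X →ₗ[ℂ] Y →ₗ[ℂ] Z) (g : GSym V →ₗ[ℂ] Y) : conv β 0 g = 0 := by
  simpa using conv_smul_left 0 β 0 g

theorem conv_zero_right (β : X →ₗ[ℂ] Y →ₗ[ℂ] Z) (f : GSym V →ₗ[ℂ] X) : conv β f 0 = 0 := by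
  simpa using conv_smul_right 0 β f 0

theorem conv_add_form (β β' : X →ₗ[ℂ] Y →ₗ[ℂ] Z) (f : GSym V →ₗ[ℂ] X) (g : GSym V →ₗ[ℂ] Y) :
    conv (β + β') f g = conv β f g + conv β' f g := by
  simp only [conv, ← LinearMap.add_comp]
  congr 1
  ext; simp

theorem conv_smul_form (a : ℂ) (β : X →ₗ[ℂ] Y →ₗ[ℂ] Z) (f : GSym V →ₗ[ℂ] X)
    (g : GSym V →ₗ[ℂ] Y) : conv (a • β) f g = a • conv β f g := by
  simp only [conv, ← LinearMap.smul_comp]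
  congr 1
  ext; simp

theorem comp_conv {Z' : Type} [AddCommGroup Z'] [Module ℂ Z'] (M : Z →ₗ[ℂ] Z')
    (β : X →ₗ[ℂ] Y →ₗ[ℂ] Z) (f : GSym V →ₗ[ℂ] X) (g : GSym V →ₗ[ℂ] Y) :
    M ∘ₗ conv β f g = conv (β.compr₂ M) f g := by
  simp only [conv, ← LinearMap.comp_assoc]
  congr 2
  ext; simp

/-- With the sign absorbed into `parPow`, a convolution is a plain bilinear map applied to the
coproduct, so it can be studied on pure tensors. -/
theorem conv_apply {c : Bool} (β : X →ₗ[ℂ] Y →ₗ[ℂ] Z) (f : GSym V →ₗ[ℂ] X)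
    {g : GSym V →ₗ[ℂ] Y} (h : ParMap c g) (w : GSym V) :
    conv β f g w = TensorProduct.lift (β.compl₁₂ (f ∘ₗ parPow c) g) (GSym.comul w) := by
  have : TensorProduct.lift β ∘ₗ koszulMap f g
      = TensorProduct.lift (β.compl₁₂ (f ∘ₗ parPow c) g) := by
    apply TensorProduct.ext'
    intro x y
    simp [koszulMap_tmul f h]
  rw [← this]; rfl

end Parity

namespace GSym

variable {V W X Y Z : Type} [AddCommGroup V] [Module ℂ V] [SuperSpace V]
  [AddCommGroup W] [Module ℂ W] [SuperSpace W] [AddCommGroup X] [Module ℂ X]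
  [AddCommGroup Y] [Module ℂ Y] [SuperSpace Y] [AddCommGroup Z] [Module ℂ Z]

/-! ## The graded-symmetric algebra -/

theorem mk_surjective : Function.Surjective (mk : TensorAlgebra ℂ V →ₐ[ℂ] GSym V) :=
  RingQuot.mkAlgHom_surjective ℂ (SymRel V)

/-- Left multiplication by generators suffices because the property "`P w` implies `P (mk t * w)`
for all `w`" is multiplicative in `t`. -/
theorem induction {P : GSym V → Prop} (one : P 1) (mul : ∀ v w, P w → P (ι v * w))
    (add : ∀ w w', P w → P w' → P (w + w')) (smul : ∀ (a : ℂ) w, P w → P (a • w))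
    (w : GSym V) : P w := by
  have key : ∀ t : TensorAlgebra ℂ V, ∀ w, P w → P (mk t * w) := by
    intro t
    induction t using TensorAlgebra.induction with
    | algebraMap r =>
      intro w hw
      rw [AlgHom.commutes, ← Algebra.smul_def]
      exact smul r w hw
    | ι v => exact fun w hw => mul v w hw
    | mul a b ha hb =>
      intro w hw
      rw [map_mul, mul_assoc]
      exact ha _ (hb _ hw)
    | add a b ha hb =>
      intro w hw
      rw [map_add, add_mul]
      exact add _ _ (ha w hw) (hb w hw)
  obtain ⟨t, rfl⟩ := mk_surjective w
  simpa using key t 1 one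

theorem hom_induction {P : GSym V → Prop} (one : P 1)
    (mul : ∀ c v w, Par c v → P w → P (ι v * w))
    (add : ∀ w w', P w → P w' → P (w + w')) (smul : ∀ (a : ℂ) w, P w → P (a • w))
    (w : GSym V) : P w := by
  refine induction one (fun v w hw => ?_) add smul w
  rw [← ev_add_od v, map_add, add_mul]
  exact add _ _ (mul _ _ _ (par_ev v) hw) (mul _ _ _ (par_od v) hw)

/-- Allows the generators to be taken from a spanning set, such as the union of the pieces of a
ℤ-grading. -/
theorem span_induction {S : Set V} (hS : Submodule.span ℂ S = ⊤) {P : GSym V → Prop} (one : P 1)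
    (mul : ∀ v ∈ S, ∀ w, P w → P (ι v * w))
    (add : ∀ w w', P w → P w' → P (w + w')) (smul : ∀ (a : ℂ) w, P w → P (a • w))
    (w : GSym V) : P w := by
  refine induction one (fun v w hw => ?_) add smul w
  have hv : v ∈ Submodule.span ℂ S := hS ▸ Submodule.mem_top
  induction hv using Submodule.span_induction with
  | mem v hv => exact mul v hv w hw
  | zero => simpa using smul 0 w hw
  | add a b _ _ ha hb => rw [map_add, add_mul]; exact add _ _ ha hb
  | smul a v _ hv => rw [map_smul, smul_mul_assoc]; exact smul a _ hv

theorem par_one : par (1 : GSym V) = 1 := map_one parHom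

theorem parPow_one (c : Bool) : parPow c (1 : GSym V) = 1 := by
  cases c <;> simp [par_one]

theorem parPow_mul (c : Bool) (x y : GSym V) :
    parPow c (x * y) = parPow c x * parPow c y := by
  cases c <;> simp [par_mul]

theorem parPow_ι (c : Bool) (v : V) : parPow c (ι v) = ι (parPow c v) := by
  cases c <;> simp [par_ι]

/-- Koszul commutation of a homogeneous generator with an arbitrary element. -/
theorem mul_ι {c : Bool} {v : V} (h : Par c v) (w : GSym V) :
    w * ι v = ι v * parPow c w := by
  induction w using hom_induction with
  | one => simp [parPow_one]
  | mul d u w hu hw =>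
    rw [mul_assoc, hw, ← mul_assoc, parPow_mul, parPow_ι, hu.parPow, ← mul_assoc]
    cases c
    · rw [ι_comm_even _ _ h.even]; simp
    · cases d
      · rw [ι_comm_even _ _ hu.even]; simp
      · rw [ι_comm_odd _ _ hu.odd h.odd]; simp
  | add w w' hw hw' => rw [add_mul, hw, hw', map_add, mul_add]
  | smul a w hw => rw [smul_mul_assoc, hw, map_smul, mul_smul_comm]

theorem ι_mul_ι {c d : Bool} {v u : V} (hv : Par c v) (hu : Par d u) :
    ι u * ι v = sg (c && d) • (ι v * ι u) := by
  rw [mul_ι hv, parPow_ι, hu.parPow, map_smul, mul_smul_comm]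

theorem ι_mul_ι_mul {c d : Bool} {v u : V} (hv : Par c v) (hu : Par d u) (w : GSym V) :
    ι u * (ι v * w) = sg (c && d) • (ι v * (ι u * w)) := by
  rw [← mul_assoc, ι_mul_ι hv hu, smul_mul_assoc, mul_assoc]

@[simp] theorem low_one : low (1 : GSym V) = (1, 0) := by simp [low]

@[simp] theorem low_ι_mul (v : V) (w : GSym V) : low (ι v * w) = (0, (low w).1 • v) := by
  simp [low, stepLow]

@[simp] theorem aug_one : aug (1 : GSym V) = 1 := by simp [aug]
@[simp] theorem lin_one : lin (1 : GSym V) = 0 := by simp [lin]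
@[simp] theorem aug_ι_mul (v : V) (w : GSym V) : aug (ι v * w) = 0 := by simp [aug]
@[simp] theorem lin_ι_mul (v : V) (w : GSym V) : lin (ι v * w) = aug w • v := by simp [lin, aug]
@[simp] theorem aug_ι (v : V) : aug (ι v) = 0 := by simpa using aug_ι_mul v 1
@[simp] theorem lin_ι (v : V) : lin (ι v) = v := by simpa using lin_ι_mul v 1

@[simp] theorem aug_mul_ι (v : V) (w : GSym V) : aug (w * ι v) = 0 := by
  induction w using induction with
  | one => simp
  | mul u w hw => rw [mul_assoc, aug_ι_mul]
  | add w w' hw hw' => rw [add_mul, map_add, hw, hw', add_zero]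
  | smul a w hw => rw [smul_mul_assoc, map_smul, hw, smul_zero]

@[simp] theorem aug_par (w : GSym V) : aug (par w) = aug w := by
  induction w using induction with
  | one => rw [par_one]
  | mul u w hw => rw [par_mul, par_ι, aug_ι_mul, aug_ι_mul]
  | add w w' hw hw' => rw [map_add, map_add, hw, hw', map_add]
  | smul a w hw => rw [map_smul, map_smul, hw, map_smul]

theorem parMap_lin : ParMap false (lin : GSym V →ₗ[ℂ] V) := by
  intro w
  rw [sg_false, one_smul]
  induction w using induction with
  | one => simp [par_one]
  | mul u w hw => rw [par_mul, par_ι, lin_ι_mul, lin_ι_mul, map_smul, aug_par]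
  | add w w' hw hw' => simp only [map_add, hw, hw']
  | smul a w hw => simp only [map_smul, hw]

theorem comul_one : comul (1 : GSym V) = 1 ⊗ₜ 1 := by simp [comul]

theorem comul_ι_mul (v : V) (w : GSym V) : comul (ι v * w) = stepComul v (comul w) := by
  simp [comul]

theorem stepComul_tmul {c : Bool} {v : V} (h : Par c v) (x y : GSym V) :
    stepComul v (x ⊗ₜ y) = (ι v * x) ⊗ₜ y + parPow c x ⊗ₜ (ι v * y) := by
  cases c
  · simp [stepComul, ev_of_even h.even, od_of_even h.even]
  · simp [stepComul, ev_of_odd h.odd, od_of_odd h.odd]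

theorem comul_map (f : V →ₗ[ℂ] W) (hf : ∀ v, f (par v) = par (f v)) (w : GSym V) :
    comul (map f hf w) = TensorProduct.map (map f hf).toLinearMap (map f hf).toLinearMap
      (comul w) := by
  have hpar : ∀ x, map f hf (par x) = par (map f hf x) := by
    intro x
    have : (map f hf).comp parHom = parHom.comp (map f hf) := hom_ext fun v => by simp [hf]
    exact DFunLike.congr_fun this x
  induction w using hom_induction with
  | one => simp [comul_one]
  | mul c v w hv hw =>
    have hfv : Par c (f v) := by rw [Par, ← hf, hv, map_smul]
    rw [map_mul, map_ι, comul_ι_mul, comul_ι_mul, hw]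
    induction comul w using TensorProduct.induction_on with
    | zero => simp
    | tmul x y =>
      rw [TensorProduct.map_tmul, stepComul_tmul hfv, stepComul_tmul hv]
      cases c <;> simp [hpar]
    | add a b ha hb => simp only [map_add, ha, hb]
  | add w w' hw hw' => simp only [map_add, hw, hw']
  | smul a w hw => simp only [map_smul, hw]

theorem comul_parPow (c : Bool) (w : GSym V) :
    comul (parPow c w) = TensorProduct.map (parPow c) (parPow c) (comul w) := by
  cases c
  · simp
  · exact comul_map par (fun _ => rfl) w

/-! ### Contraction of functionals with a generator -/

/-- The functional `w ↦ f (v w)`. -/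
def cut (v : V) (f : GSym V →ₗ[ℂ] X) : GSym V →ₗ[ℂ] X := f ∘ₗ LinearMap.mulLeft ℂ (ι v)

@[simp] theorem cut_apply (v : V) (f : GSym V →ₗ[ℂ] X) (w : GSym V) :
    cut v f w = f (ι v * w) := rfl

theorem ParMap.cut {c i : Bool} {v : V} {f : GSym V →ₗ[ℂ] Y} (hf : ParMap i f) (hv : Par c v) :
    ParMap (xor i c) (cut v f) := fun w => by
  rw [cut_apply, hf, par_mul, par_ι, hv, map_smul, smul_mul_assoc, map_smul, smul_smul, cut_apply]
  cases c <;> cases i <;> simp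

theorem conv_one {γ : Bool} (β : X →ₗ[ℂ] Y →ₗ[ℂ] Z) (f : GSym V →ₗ[ℂ] X) {g : GSym V →ₗ[ℂ] Y}
    (hg : ParMap γ g) : conv β f g 1 = β (f 1) (g 1) := by
  rw [conv_apply β f hg, comul_one]
  simp [parPow_one]

/-- Contraction with a homogeneous generator is a graded derivation of convolution. The sign in the
first term comes from the parity operator that `g` puts on the argument of `f`. In the second term
the sign of moving `v` past the first factor is absorbed, because `cut v g` has parity `xor γ c`. -/
theorem conv_ι_mul {γ c : Bool} (β : X →ₗ[ℂ] Y →ₗ[ℂ] Z) (f : GSym V →ₗ[ℂ] X)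
    {g : GSym V →ₗ[ℂ] Y} (hg : ParMap γ g) {v : V} (hv : Par c v) (w : GSym V) :
    conv β f g (ι v * w) = sg (γ && c) • conv β (cut v f) g w + conv β f (cut v g) w := by
  rw [conv_apply β f hg, conv_apply β _ hg, conv_apply β f (ParMap.cut hg hv), comul_ι_mul]
  induction comul w using TensorProduct.induction_on with
  | zero => simp
  | tmul x y =>
    rw [stepComul_tmul hv]
    simp [parPow_mul, parPow_ι, hv.parPow, parPow_parPow]
  | add a b ha hb => simp only [map_add, ha, hb, smul_add]; abel

/-- The constant functional with value `x`. -/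
def const (x : X) : GSym V →ₗ[ℂ] X := LinearMap.toSpanSingleton ℂ X x ∘ₗ aug

@[simp] theorem const_apply (x : X) (w : GSym V) : const x w = aug w • x := rfl

theorem cut_const (v : V) (x : X) : cut v (const x) = 0 := by ext w; simp

theorem parMap_const {c : Bool} {y : Y} (hy : Par c y) :
    ParMap c (const y : GSym V →ₗ[ℂ] Y) := fun w => by
  rw [const_apply, map_smul, hy, const_apply, aug_par, smul_comm]

theorem cut_lin {v : V} (f : V →ₗ[ℂ] X) : cut v (f ∘ₗ lin) = const (f v) := by
  ext w; simp

theorem conv_const_left {γ : Bool} (β : X →ₗ[ℂ] Y →ₗ[ℂ] Z) (x : X) {g : GSym V →ₗ[ℂ] Y}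
    (hg : ParMap γ g) (w : GSym V) : conv β (const x) g w = β x (g w) := by
  induction w using hom_induction generalizing g γ with
  | one => simp [conv_one _ _ hg]
  | mul c v w hv hw =>
    rw [conv_ι_mul β _ hg hv, cut_const, conv_zero_left, hw (ParMap.cut hg hv)]
    simp
  | add w w' hw hw' => simp only [map_add, hw hg, hw' hg]
  | smul a w hw => simp only [map_smul, hw hg]

theorem conv_const_right {c : Bool} (β : X →ₗ[ℂ] Y →ₗ[ℂ] Z) (f : GSym V →ₗ[ℂ] X) {y : Y}
    (hy : Par c y) (w : GSym V) : conv β f (const y) w = β (f (parPow c w)) y := by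
  induction w using hom_induction generalizing f with
  | one => simp [conv_one _ _ (parMap_const hy), parPow_one]
  | mul d v w hv hw =>
    rw [conv_ι_mul β _ (parMap_const hy) hv, cut_const, conv_zero_right, hw,
      parPow_mul, parPow_ι, hv.parPow]
    simp
  | add w w' hw hw' => simp only [map_add, hw, hw', LinearMap.add_apply]
  | smul a w hw => simp only [map_smul, hw, LinearMap.smul_apply]

theorem conv_comp_left {X' : Type} [AddCommGroup X'] [Module ℂ X'] (β : X →ₗ[ℂ] Y →ₗ[ℂ] Z)
    (L : X' →ₗ[ℂ] X) (f : GSym V →ₗ[ℂ] X') (g : GSym V →ₗ[ℂ] Y) :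
    conv β (L ∘ₗ f) g = conv (β ∘ₗ L) f g := by
  simp only [conv, ← LinearMap.comp_assoc]
  congr 1
  apply TensorProduct.ext'
  intro x y
  simp [koszulMap]

/-- Pulling `L` out of the second slot moves it past `f`: the operator `parPow k` passes from the
argument of `f` to its value, at the cost of the sign `sg (k && a)`. -/
theorem conv_comp_right {k a γ : Bool} [SuperSpace X] {Y' : Type} [AddCommGroup Y'] [Module ℂ Y']
    [SuperSpace Y'] (β : X →ₗ[ℂ] Y →ₗ[ℂ] Z) {f : GSym V →ₗ[ℂ] X} (hf : ParMap a f)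
    {L : Y' →ₗ[ℂ] Y} (hL : ParMap k L) {g : GSym V →ₗ[ℂ] Y'} (hg : ParMap γ g) :
    conv β f (L ∘ₗ g) = sg (k && a) • conv (β.compl₁₂ (parPow k) L) f g := by
  ext w
  rw [LinearMap.smul_apply, conv_apply _ _ hg, conv_apply _ _ (hL.comp hg)]
  induction comul w using TensorProduct.induction_on with
  | zero => simp
  | tmul x y =>
    simp only [TensorProduct.lift.tmul, LinearMap.compl₁₂_apply, LinearMap.comp_apply,
      hf.parPow, parPow_parPow, map_smul, LinearMap.smul_apply, smul_smul]
    cases k <;> cases a <;> simp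
  | add a b ha hb => simp only [map_add, ha, hb, smul_add]

theorem conv_map {γ : Bool} (β : X →ₗ[ℂ] Y →ₗ[ℂ] Z) (h : V →ₗ[ℂ] W)
    (hh : ∀ v, h (par v) = par (h v)) (f : GSym W →ₗ[ℂ] X) {g : GSym W →ₗ[ℂ] Y}
    (hg : ParMap γ g) (w : GSym V) :
    conv β f g (map h hh w)
      = conv β (f ∘ₗ (map h hh).toLinearMap) (g ∘ₗ (map h hh).toLinearMap) w := by
  have hpar : ∀ x, map h hh (par x) = par (map h hh x) := by
    intro x
    have : (map h hh).comp parHom = parHom.comp (map h hh) := hom_ext fun v => by simp [hh]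
    exact DFunLike.congr_fun this x
  have hg' : ParMap γ (g ∘ₗ (map h hh).toLinearMap) := fun x => by
    simp [hg _, hpar]
  rw [conv_apply _ _ hg, conv_apply _ _ hg', comul_map]
  induction comul w using TensorProduct.induction_on with
  | zero => simp
  | tmul x y => cases γ <;> simp [hpar]
  | add a b ha hb => simp only [map_add, ha, hb]

theorem parMap_conv [SuperSpace X] [SuperSpace Z] {a b : Bool} {β : X →ₗ[ℂ] Y →ₗ[ℂ] Z}
    (hβ : ∀ x y, par (β x y) = β (par x) (par y)) {f : GSym V →ₗ[ℂ] X} (hf : ParMap a f)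
    {g : GSym V →ₗ[ℂ] Y} (hg : ParMap b g) : ParMap (xor a b) (conv β f g) := by
  intro w
  have h := comul_parPow true w
  rw [parPow_true] at h
  rw [conv_apply _ _ hg, conv_apply _ _ hg, h]
  induction comul w using TensorProduct.induction_on with
  | zero => simp
  | tmul x y =>
    simp only [TensorProduct.lift.tmul, LinearMap.compl₁₂_apply, LinearMap.comp_apply,
      TensorProduct.map_tmul, hβ, hf _, hg y, map_smul, LinearMap.smul_apply, smul_smul]
    cases a <;> cases b <;> simp
  | add a b ha hb => simp only [map_add, ha, hb, smul_add]

/-! ### The coderivation extending a functional -/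

/-- The operator `w ↦ ∑ f(w') w''`. -/
def lins (f : GSym V →ₗ[ℂ] V) : Module.End ℂ (GSym V) :=
  TensorProduct.lift (LinearMap.mul ℂ (GSym V)) ∘ₗ
    TensorProduct.map (ι ∘ₗ f) LinearMap.id ∘ₗ comul

/-- The operator `w ↦ ∑ w' · (-1)^{|f||w''|} f(w'')`. -/
def rins (f : GSym V →ₗ[ℂ] V) : Module.End ℂ (GSym V) :=
  TensorProduct.lift (LinearMap.mul ℂ (GSym V)) ∘ₗ
    TensorProduct.map LinearMap.id (ι ∘ₗ (evenPart f + oddPart f ∘ₗ par)) ∘ₗ comul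

theorem lins_add (f g : GSym V →ₗ[ℂ] V) : lins (f + g) = lins f + lins g := by
  simp only [lins, LinearMap.comp_add, TensorProduct.map_add_left, LinearMap.add_comp]

theorem lins_smul (a : ℂ) (f : GSym V →ₗ[ℂ] V) : lins (a • f) = a • lins f := by
  simp only [lins, LinearMap.comp_smul, TensorProduct.map_smul_left, LinearMap.smul_comp]

theorem rins_add (f g : GSym V →ₗ[ℂ] V) : rins (f + g) = rins f + rins g := by
  have : ι ∘ₗ (evenPart (f + g) + oddPart (f + g) ∘ₗ par)
      = ι ∘ₗ (evenPart f + oddPart f ∘ₗ par) + ι ∘ₗ (evenPart g + oddPart g ∘ₗ par) := by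
    rw [evenPart_add, oddPart_add, ← LinearMap.comp_add, LinearMap.add_comp]
    congr 1; abel
  simp only [rins, this, LinearMap.comp_add, TensorProduct.map_add_right, LinearMap.add_comp]

theorem rins_smul (a : ℂ) (f : GSym V →ₗ[ℂ] V) : rins (a • f) = a • rins f := by
  have : ι ∘ₗ (evenPart (a • f) + oddPart (a • f) ∘ₗ par)
      = a • (ι ∘ₗ (evenPart f + oddPart f ∘ₗ par)) := by
    rw [evenPart_smul, oddPart_smul, LinearMap.smul_comp, ← smul_add, LinearMap.comp_smul]
  simp only [rins, this, LinearMap.comp_smul, TensorProduct.map_smul_right, LinearMap.smul_comp]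

@[simp] theorem lins_zero : lins (0 : GSym V →ₗ[ℂ] V) = 0 := by simpa using lins_smul 0 (0 : GSym V →ₗ[ℂ] V)

theorem lins_one (f : GSym V →ₗ[ℂ] V) : lins f 1 = ι (f 1) := by
  simp [lins, comul_one]

/-- In `lins f (v w)` the letter `v` is either swallowed by `f`, without sign since both stand on
the left, or is left over and moved in front of the value of `f`, which costs the Koszul sign of `f`
and `v`. -/
theorem lins_ι_mul {i : Bool} {f : GSym V →ₗ[ℂ] V} (hf : ParMap i f) (v : V) (w : GSym V) :
    lins f (ι v * w) = lins (cut v f) w + ι (parPow i v) * lins f w := by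
  have key : ∀ c v, Par c v →
      lins f (ι v * w) = lins (cut v f) w + ι (parPow i v) * lins f w := by
    intro c v hv
    simp only [lins, LinearMap.comp_apply, comul_ι_mul]
    induction comul w using TensorProduct.induction_on with
    | zero => simp
    | tmul x y =>
      rw [stepComul_tmul hv]
      have h1 : ι (f (parPow c x)) * ι v = sg (i && c) • (ι v * ι (f x)) := by
        rw [mul_ι hv, parPow_ι, hf.parPow, parPow_parPow]
        simp
      simp only [map_add, TensorProduct.map_tmul, TensorProduct.lift.tmul, LinearMap.comp_apply,
        LinearMap.id_apply, LinearMap.mul_apply', cut_apply, ← mul_assoc, h1, hv.parPow,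
        smul_mul_assoc, map_smul]
    | add a b ha hb => simp only [map_add, ha, hb, mul_add]; abel
  -- Both sides are additive in `v`, so the homogeneous case extends to all generators.
  have hc : ∀ u v : V, cut (u + v) f = cut u f + cut v f := fun u v => by
    ext; simp [add_mul]
  conv_lhs => rw [← ev_add_od v]
  conv_rhs => rw [← ev_add_od v]
  rw [map_add, add_mul, map_add, key _ _ (par_ev v), key _ _ (par_od v), hc, lins_add,
    map_add, map_add, add_mul, LinearMap.add_apply]
  abel

theorem lins_const (u : V) (w : GSym V) : lins (const u) w = ι u * w := by
  have key : ∀ c u, Par c u → lins (const u) w = ι u * w := by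
    intro c u hu
    induction w using hom_induction with
    | one => simp [lins_one]
    | mul d v w hv hw =>
      rw [lins_ι_mul (parMap_const hu), cut_const, hw, hv.parPow, ι_mul_ι_mul hv hu]
      simp [Bool.and_comm]
    | add w w' hw hw' => simp only [map_add, hw, hw', mul_add]
    | smul a w hw => simp only [map_smul, hw, mul_smul_comm]
  have h : (const u : GSym V →ₗ[ℂ] V) = const (ev u) + const (od u) := by
    ext w
    rw [LinearMap.add_apply, const_apply, const_apply, const_apply, ← smul_add, ev_add_od]
  rw [h, lins_add, LinearMap.add_apply, key _ _ (par_ev u), key _ _ (par_od u), ← add_mul,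
    ← map_add, ev_add_od]

theorem parMap_lins {i : Bool} {f : GSym V →ₗ[ℂ] V} (hf : ParMap i f) : ParMap i (lins f) := by
  intro w
  have h := comul_parPow true w
  rw [parPow_true] at h
  simp only [lins, LinearMap.comp_apply, h]
  induction comul w using TensorProduct.induction_on with
  | zero => simp
  | tmul x y => simp [par_mul, par_ι, hf x]
  | add a b ha hb => simp only [map_add, ha, hb, smul_add]

/-- By graded commutativity, inserting on the right or on the left differs only by the sign of `f`
passing the whole word. The observables are defined through `rins`, while the recursions are cleaner
for `lins`; this lemma translates between them. -/
theorem rins_eq_lins {i : Bool} {f : GSym V →ₗ[ℂ] V} (hf : ParMap i f) (w : GSym V) :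
    rins f w = lins f (parPow i w) := by
  have h0 : ∀ {i : Bool} {f : GSym V →ₗ[ℂ] V}, ParMap i f →
      rins f = TensorProduct.lift (LinearMap.mul ℂ (GSym V)) ∘ₗ
        TensorProduct.map LinearMap.id (ι ∘ₗ f ∘ₗ parPow i) ∘ₗ comul := by
    intro i f hf
    rw [rins, hf.evenPart, hf.oddPart]
    cases i <;> simp
  induction w using hom_induction generalizing f i with
  | one => rw [h0 hf]; simp [comul_one, lins_one, parPow_one]
  | mul c v w hv hw =>
    -- When `f` swallows `v`, the coproduct leaves a parity operator on the remaining left factor.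
    -- Moving it outside the whole product produces the second sign.
    have h2 : rins f (ι v * w) = ι v * rins f w
        + (sg (i && c) * sg (xor i c && c)) • parPow c (rins (cut v f) w) := by
      rw [h0 hf, h0 (ParMap.cut hf hv)]
      simp only [LinearMap.comp_apply, comul_ι_mul]
      induction comul w using TensorProduct.induction_on with
      | zero => simp
      | tmul x y =>
        rw [stepComul_tmul hv]
        have h3 := (ParMap.cut hf hv).parPow c (parPow (xor i c) y)
        rw [parPow_parPow, Bool.xor_comm i c, ← Bool.xor_assoc, Bool.xor_self, Bool.false_xor]
          at h3
        rw [cut_apply, cut_apply] at h3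
        simp only [map_add, TensorProduct.map_tmul, TensorProduct.lift.tmul, LinearMap.comp_apply,
          LinearMap.id_apply, LinearMap.mul_apply', parPow_mul, parPow_ι, hv.parPow, map_smul,
          smul_mul_assoc, Bool.xor_comm i c, h3, cut_apply, mul_smul_comm, smul_smul, mul_assoc,
          sg_mul_self, mul_one]
      | add a b ha hb => simp only [map_add, ha, hb, mul_add, smul_add]; abel
    rw [h2, hw hf, hw (ParMap.cut hf hv), (parMap_lins (ParMap.cut hf hv)).parPow, parPow_parPow,
      parPow_mul, parPow_ι, hv.parPow, map_smul, smul_mul_assoc, map_smul, lins_ι_mul hf,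
      hv.parPow, ← Bool.xor_assoc, Bool.xor_comm c i, Bool.xor_assoc, Bool.xor_self,
      Bool.xor_false, map_smul, smul_mul_assoc, smul_add, smul_smul, smul_smul, sg_mul_self,
      mul_assoc, sg_mul_self, mul_one, one_smul, add_comm]
  | add w w' hw hw' => simp only [map_add, hw hf, hw' hf]
  | smul a w hw => simp only [map_smul, hw hf]

theorem aug_lins (f : GSym V →ₗ[ℂ] V) (w : GSym V) : aug (lins f w) = 0 := by
  simp only [lins, LinearMap.comp_apply]
  induction comul w using TensorProduct.induction_on with
  | zero => simp
  | tmul x y => simp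
  | add a b ha hb => simp only [map_add, ha, hb, add_zero]

theorem aug_rins (f : GSym V →ₗ[ℂ] V) (w : GSym V) : aug (rins f w) = 0 := by
  simp only [rins, LinearMap.comp_apply]
  induction comul w using TensorProduct.induction_on with
  | zero => simp
  | tmul x y => simp only [TensorProduct.map_tmul, LinearMap.comp_apply, TensorProduct.lift.tmul,
      LinearMap.mul_apply', LinearMap.id_apply, aug_mul_ι]
  | add a b ha hb => simp only [map_add, ha, hb, add_zero]

/-- A coderivation is determined by its corestriction to the cogenerators, and that of `lins f` is
`f`. -/
theorem lin_lins {i : Bool} {f : GSym V →ₗ[ℂ] V} (hf : ParMap i f) (w : GSym V) :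
    lin (lins f w) = f w := by
  induction w using hom_induction generalizing f i with
  | one => simp [lins_one]
  | mul c v w hv hw =>
    rw [lins_ι_mul hf, map_add, hw (ParMap.cut hf hv), lin_ι_mul, aug_lins, zero_smul, add_zero,
      cut_apply]
  | add w w' hw hw' => simp only [map_add, hw hf, hw' hf]
  | smul a w hw => simp only [map_smul, hw hf]

theorem cut_comp_lins {i c : Bool} {D : GSym V →ₗ[ℂ] V} (hD : ParMap i D) {v : V} (hv : Par c v)
    (f : GSym V →ₗ[ℂ] X) :
    cut v (f ∘ₗ lins D) = f ∘ₗ lins (cut v D) + sg (i && c) • (cut v f ∘ₗ lins D) := by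
  ext w
  simp [lins_ι_mul hD, hv.parPow]

theorem conv_ι {γ c : Bool} (β : X →ₗ[ℂ] Y →ₗ[ℂ] Z) (f : GSym V →ₗ[ℂ] X)
    {g : GSym V →ₗ[ℂ] Y} (hg : ParMap γ g) {v : V} (hv : Par c v) :
    conv β f g (ι v) = sg (γ && c) • β (f (ι v)) (g 1) + β (f 1) (g (ι v)) := by
  rw [← mul_one (ι v), conv_ι_mul β f hg hv, conv_one _ _ hg, conv_one _ _ (ParMap.cut hg hv)]
  simp

/-- Since `lins D` is a graded coderivation, precomposition with it is a graded derivation of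
convolution. The induction on words generalises over `f`, `g`, `D` and their parities, because
contraction with a letter changes each of them. -/
theorem conv_lins {γ i : Bool} (β : X →ₗ[ℂ] Y →ₗ[ℂ] Z) (f : GSym V →ₗ[ℂ] X)
    {g : GSym V →ₗ[ℂ] Y} (hg : ParMap γ g) {D : GSym V →ₗ[ℂ] V} (hD : ParMap i D) (w : GSym V) :
    conv β f g (lins D w)
      = sg (γ && i) • conv β (f ∘ₗ lins D) g w + conv β f (g ∘ₗ lins D) w := by
  induction w using hom_induction generalizing f g γ D i with
  | one =>
    have hp : Par i (D 1) := by rw [Par, hD, par_one]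
    rw [lins_one, conv_ι β f hg hp, conv_one _ _ hg, conv_one _ _ (hg.comp (parMap_lins hD))]
    simp [lins_one]
  | mul c v w hv hw =>
    rw [lins_ι_mul hD, map_add, hw f hg (ParMap.cut hD hv), hv.parPow, map_smul, smul_mul_assoc,
      map_smul, conv_ι_mul β f hg hv, hw _ hg hD, hw _ (ParMap.cut hg hv) hD,
      conv_ι_mul β _ hg hv, conv_ι_mul β _ (hg.comp (parMap_lins hD)) hv, cut_comp_lins hD hv,
      cut_comp_lins hD hv, conv_add_left, conv_add_right, conv_smul_left, conv_smul_right]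
    simp only [LinearMap.add_apply, LinearMap.smul_apply]
    cases c <;> cases γ <;> cases i <;> simp <;> abel
  | add w w' hw hw' => simp only [map_add, hw f hg hD, hw' f hg hD, smul_add]; abel
  | smul a w hw => simp only [map_smul, hw f hg hD, smul_add, smul_comm a]

/-- The graded commutator of two coderivations is again a coderivation, hence the one extending the
bracket of the two vector fields. It is proved by contracting letters, so coassociativity of the
coproduct is not needed. -/
theorem lins_comm {i j : Bool} {D E : GSym V →ₗ[ℂ] V} (hD : ParMap i D) (hE : ParMap j E)
    (w : GSym V) :
    lins (D ∘ₗ lins E - sg (i && j) • E ∘ₗ lins D) w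
      = lins D (lins E w) - sg (i && j) • lins E (lins D w) := by
  have sub : ∀ (f g : GSym V →ₗ[ℂ] V) (a : ℂ) (w : GSym V),
      lins (f - a • g) w = lins f w - a • lins g w := fun f g a w => by
    rw [sub_eq_add_neg, ← neg_smul, lins_add, lins_smul, LinearMap.add_apply,
      LinearMap.smul_apply, neg_smul, sub_eq_add_neg]
  rw [sub]
  induction w using hom_induction generalizing D E i j with
  | one =>
    have hp : Par i (D 1) := by rw [Par, hD, par_one]
    have hq : Par j (E 1) := by rw [Par, hE, par_one]
    have e1 := lins_ι_mul hD (E 1) 1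
    have e2 := lins_ι_mul hE (D 1) 1
    rw [mul_one, lins_one, hq.parPow] at e1
    rw [mul_one, lins_one, hp.parPow] at e2
    have e3 := ι_mul_ι hp hq
    simp only [lins_one, LinearMap.comp_apply, e1, e2, map_smul, smul_mul_assoc, e3, cut_apply,
      mul_one]
    cases i <;> cases j <;> simp
  | mul c v w hv hw =>
    have h1 := hw hD (ParMap.cut hE hv)
    have h2 := hw (ParMap.cut hD hv) hE
    have h0 := hw hD hE
    have hDE : ParMap (xor i j) (D ∘ₗ lins E) := hD.comp (parMap_lins hE)
    have hED : ParMap (xor j i) (E ∘ₗ lins D) := hE.comp (parMap_lins hD)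
    rw [lins_ι_mul hDE, lins_ι_mul hED, lins_ι_mul hD, lins_ι_mul hE, map_add, map_add,
      cut_comp_lins hE hv, cut_comp_lins hD hv, lins_add, lins_add, lins_smul, lins_smul]
    simp only [hv.parPow, map_smul, smul_mul_assoc, lins_ι_mul hD, lins_ι_mul hE,
      LinearMap.add_apply, LinearMap.smul_apply]
    rw [sub_eq_iff_eq_add] at h0 h1 h2
    rw [h0, h1, h2]
    simp only [mul_add, mul_sub, mul_smul_comm]
    cases c <;> cases j <;> cases i <;> simp <;> abel
  | add w w' hw hw' =>
    have h1 := hw hD hE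
    have h2 := hw' hD hE
    simp only [map_add, smul_add] at h1 h2 ⊢
    rw [add_sub_add_comm, h1, h2, add_sub_add_comm]
  | smul a w hw =>
    have h1 := hw hD hE
    simp only [map_smul, smul_comm _ a] at h1 ⊢
    rw [← smul_sub, h1, smul_sub]

/-- Replacing `lins` by `rins` inserts parity operators; commuting them past the inner coderivation
multiplies the commutator by `sg (i && j)`. In this form, minus the transpose of `rins` respects
brackets. -/
theorem rins_comm {i j : Bool} {D E : GSym V →ₗ[ℂ] V} (hD : ParMap i D) (hE : ParMap j E) :
    rins (D ∘ₗ lins E - sg (i && j) • E ∘ₗ lins D)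
      = sg (i && j) • (rins D * rins E) - rins E * rins D := by
  have hDE : ParMap (xor i j) (D ∘ₗ lins E) := hD.comp (parMap_lins hE)
  have hED : ParMap (xor i j) (E ∘ₗ lins D) := Bool.xor_comm i j ▸ hE.comp (parMap_lins hD)
  have hZ : ParMap (xor i j) (D ∘ₗ lins E - sg (i && j) • E ∘ₗ lins D) := by
    rw [sub_eq_add_neg, ← neg_smul]
    exact hDE.add (hED.smul _)
  ext w
  rw [rins_eq_lins hZ, lins_comm hD hE, LinearMap.sub_apply, LinearMap.smul_apply,
    Module.End.mul_apply, Module.End.mul_apply, rins_eq_lins hD, rins_eq_lins hE, rins_eq_lins hE,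
    rins_eq_lins hD, (parMap_lins hD).parPow, (parMap_lins hE).parPow, parPow_parPow,
    parPow_parPow, Bool.xor_comm j i]
  cases i <;> cases j <;> simp

theorem conv_parPow {γ : Bool} (c : Bool) (β : X →ₗ[ℂ] Y →ₗ[ℂ] Z) (f : GSym V →ₗ[ℂ] X)
    {g : GSym V →ₗ[ℂ] Y} (hg : ParMap γ g) (w : GSym V) :
    conv β f g (parPow c w) = conv β (f ∘ₗ parPow c) (g ∘ₗ parPow c) w := by
  cases c
  · simp
  · exact conv_map β par (fun _ => rfl) f hg w

/-- Leibniz rule for products of observables. Only the first factor has to be homogeneous, as its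
parity enters the sign; the second is split into its even and odd parts. -/
theorem conv_rins {φ i : Bool} {F : Module.Dual ℂ (GSym V)} (hF : ParMap φ F)
    (G : Module.Dual ℂ (GSym V)) {D : GSym V →ₗ[ℂ] V} (hD : ParMap i D) :
    conv (LinearMap.mul ℂ ℂ) F G ∘ₗ rins D
      = conv (LinearMap.mul ℂ ℂ) (F ∘ₗ rins D) G
        + sg (i && φ) • conv (LinearMap.mul ℂ ℂ) F (G ∘ₗ rins D) := by
  -- The target ℂ is purely even, so on a homogeneous functional precomposition with `par` is
  -- multiplication by a sign.
  have hscal : ∀ {γ : Bool} {G : Module.Dual ℂ (GSym V)}, ParMap γ G → ∀ c,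
      G ∘ₗ parPow c = sg (γ && c) • G := by
    intro γ G hG c
    ext w
    have := hG.parPow c w
    rw [LinearMap.comp_apply, LinearMap.smul_apply]
    cases c
    · simp
    · have h2 := hG w
      change G w = _ at h2
      rw [Bool.and_true, parPow_true, h2, smul_smul, sg_mul_self, one_smul]
  have key : ∀ (γ : Bool) (G : Module.Dual ℂ (GSym V)), ParMap γ G →
      conv (LinearMap.mul ℂ ℂ) F G ∘ₗ rins D
      = conv (LinearMap.mul ℂ ℂ) (F ∘ₗ rins D) G
        + sg (i && φ) • conv (LinearMap.mul ℂ ℂ) F (G ∘ₗ rins D) := by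
    intro γ G hG
    have hr : ∀ H : Module.Dual ℂ (GSym V), H ∘ₗ rins D = (H ∘ₗ lins D) ∘ₗ parPow i := by
      intro H; ext w; simp [rins_eq_lins hD]
    ext w
    rw [LinearMap.comp_apply, rins_eq_lins hD, conv_lins _ _ hG hD, conv_parPow i _ _ hG,
      conv_parPow i _ _ (hG.comp (parMap_lins hD)), ← hr, ← hr, hscal hG, hscal hF,
      conv_smul_left, conv_smul_right]
    simp only [LinearMap.smul_apply, LinearMap.add_apply, smul_smul, sg_mul_self, one_smul,
      Bool.and_comm φ]
  rw [← evenPart_add_oddPart G, conv_add_right, LinearMap.add_comp, key _ _ (parMap_evenPart G),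
    key _ _ (parMap_oddPart G), LinearMap.add_comp, conv_add_right, conv_add_right, smul_add]
  abel

theorem rins_map {h : V →ₗ[ℂ] W} (hh : ∀ v, h (par v) = par (h v)) {D : GSym V →ₗ[ℂ] V}
    {E : GSym W →ₗ[ℂ] W} (hDE : ∀ w, h (D w) = E (map h hh w)) (w : GSym V) :
    map h hh (rins D w) = rins E (map h hh w) := by
  have hpar : ∀ x, map h hh (par x) = par (map h hh x) := by
    intro x
    have : (map h hh).comp parHom = parHom.comp (map h hh) := hom_ext fun v => by simp [hh]
    exact DFunLike.congr_fun this x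
  simp only [rins, LinearMap.comp_apply, comul_map]
  induction comul w using TensorProduct.induction_on with
  | zero => simp
  | tmul x y => simp [evenPart, oddPart, hh, hDE, hpar]
  | add a b ha hb => simp only [map_add, ha, hb]

/-! ### Evaluation on words -/

/-- `f` vanishes on products of at least `p` generators. -/
def Kills : ℕ → (GSym V →ₗ[ℂ] X) → Prop
  | 0, f => f = 0
  | p + 1, f => ∀ c v, Par c v → Kills p (cut v f)

theorem kills_zero (p : ℕ) : Kills p (0 : GSym V →ₗ[ℂ] X) := by
  induction p with
  | zero => rfl
  | succ p ih => exact fun c v _ => ih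

theorem Kills.add {p : ℕ} {f g : GSym V →ₗ[ℂ] X} (hf : Kills p f) (hg : Kills p g) :
    Kills p (f + g) := by
  induction p generalizing f g with
  | zero => simp only [Kills] at *; rw [hf, hg, add_zero]
  | succ p ih => exact fun c v hv => ih (hf c v hv) (hg c v hv)

theorem Kills.comp {Z : Type} [AddCommGroup Z] [Module ℂ Z] {p : ℕ} {f : GSym V →ₗ[ℂ] X}
    (hf : Kills p f) (M : X →ₗ[ℂ] Z) : Kills p (M ∘ₗ f) := by
  induction p generalizing f with
  | zero => simp only [Kills] at *; rw [hf, LinearMap.comp_zero]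
  | succ p ih => exact fun c v hv => ih (hf c v hv)

theorem Kills.smul {p : ℕ} {f : GSym V →ₗ[ℂ] X} (hf : Kills p f) (a : ℂ) : Kills p (a • f) :=
  hf.comp (a • LinearMap.id)

theorem Kills.succ {p : ℕ} {f : GSym V →ₗ[ℂ] X} (hf : Kills p f) : Kills (p + 1) f := by
  induction p generalizing f with
  | zero => rw [show f = 0 from hf]; exact kills_zero 1
  | succ p ih => exact fun c v hv => ih (hf c v hv)

theorem kills_const (x : X) : Kills 1 (const x : GSym V →ₗ[ℂ] X) :=
  fun _ v _ => cut_const v x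

theorem kills_lin (f : V →ₗ[ℂ] X) : Kills 2 (f ∘ₗ lin : GSym V →ₗ[ℂ] X) := fun c v hv => by
  rw [cut_lin]; exact kills_const _

/-- The coproduct distributes the letters of a word over the two factors. If `f` sees at most `p`
letters and `g` at most `q`, their convolution sees at most `p + q`. -/
theorem kills_conv (β : X →ₗ[ℂ] Y →ₗ[ℂ] Z) (p q : ℕ) {γ : Bool} {f : GSym V →ₗ[ℂ] X}
    {g : GSym V →ₗ[ℂ] Y} (hf : Kills (p + 1) f) (hg : Kills (q + 1) g) (hγ : ParMap γ g) :
    Kills (p + q + 1) (conv β f g) := by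
  induction hn : p + q generalizing p q f g γ with
  | zero =>
    obtain ⟨rfl, rfl⟩ : p = 0 ∧ q = 0 := by omega
    intro c v hv
    change cut v (conv β f g) = 0
    ext w
    rw [cut_apply, conv_ι_mul β f hγ hv, show cut v f = 0 from hf c v hv,
      show cut v g = 0 from hg c v hv, conv_zero_left, conv_zero_right]
    simp
  | succ n ih =>
    intro c v hv
    have e : cut v (conv β f g) = sg (γ && c) • conv β (cut v f) g + conv β f (cut v g) := by
      ext w; exact conv_ι_mul β f hγ hv w
    rw [e]
    refine Kills.add (Kills.smul ?_ _) ?_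
    · cases p with
      | zero => rw [show cut v f = 0 from hf c v hv, conv_zero_left]; exact kills_zero _
      | succ p => exact ih p q (hf c v hv) hg hγ (by omega)
    · cases q with
      | zero => rw [show cut v g = 0 from hg c v hv, conv_zero_right]; exact kills_zero _
      | succ q => exact ih p q hf (hg c v hv) (ParMap.cut hγ hv) (by omega)

theorem conv_ι_ι {γ a b : Bool} (β : X →ₗ[ℂ] Y →ₗ[ℂ] Z) (f : GSym V →ₗ[ℂ] X)
    {g : GSym V →ₗ[ℂ] Y} (hg : ParMap γ g) {u v : V} (hu : Par a u) (hv : Par b v) :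
    conv β f g (ι u * ι v)
      = sg (γ && xor a b) • β (f (ι u * ι v)) (g 1) + sg (γ && a) • β (f (ι u)) (g (ι v))
        + sg (xor γ a && b) • β (f (ι v)) (g (ι u)) + β (f 1) (g (ι u * ι v)) := by
  rw [conv_ι_mul β f hg hu, conv_ι _ _ hg hv, conv_ι _ _ (ParMap.cut hg hu) hv]
  simp only [cut_apply, mul_one]
  cases a <;> cases b <;> cases γ <;> simp <;> abel

end GSym

/-! ## Partial derivatives -/

section Derivatives

variable {n m : ℕ} {U V : Opens (Spacetime n m)}

theorem dirDeriv_apply (v : Spacetime n m) (f : Smooth U) (x : U) :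
    (dirDeriv v f).1 x = fderiv ℝ (extendZero f.1) x v := rfl

theorem extendZero_mul (f g : Smooth U) :
    extendZero (f * g).1 = extendZero f.1 * extendZero g.1 := by
  funext x
  by_cases hx : x ∈ U
  · simp [extendZero_apply _ (⟨x, hx⟩ : U)]
  · have h : ¬ ∃ a : U, (a : Spacetime n m) = x := fun ⟨a, ha⟩ => hx (ha ▸ a.2)
    simp [extendZero, Function.extend_apply' _ _ _ h]

theorem dirDeriv_mul (v : Spacetime n m) (f g : Smooth U) :
    dirDeriv v (f * g) = dirDeriv v f * g + f * dirDeriv v g := by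
  ext x
  change fderiv ℝ (extendZero (f * g).1) x v
    = fderiv ℝ (extendZero f.1) x v * g.1 x + f.1 x * fderiv ℝ (extendZero g.1) x v
  rw [extendZero_mul, fderiv_mul (differentiableAt_smooth f x) (differentiableAt_smooth g x)]
  simp [extendZero_apply]
  ring

/-- Symmetry of the second derivative. Since `w` is a constant vector, differentiating `fderiv f ·
w` leaves only the second derivative of `f`. -/
theorem dirDeriv_comm (v w : Spacetime n m) (f : Smooth U) :
    dirDeriv v (dirDeriv w f) = dirDeriv w (dirDeriv v f) := by
  have h : ∀ (v w : Spacetime n m) (x : U), (dirDeriv v (dirDeriv w f)).1 x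
      = fderiv ℝ (fderiv ℝ (extendZero f.1)) x v w := by
    intro v w x
    have e : extendZero (dirDeriv w f).1 =ᶠ[nhds (x : Spacetime n m)]
        fun y => fderiv ℝ (extendZero f.1) y w := by
      filter_upwards [U.isOpen.mem_nhds x.2] with y hy
      exact extendZero_apply (dirDeriv w f).1 (⟨y, hy⟩ : U)
    rw [dirDeriv_apply, e.fderiv_eq]
    have hd : DifferentiableAt ℝ (fderiv ℝ (extendZero f.1)) x :=
      ((f.2.fderiv_of_isOpen U.isOpen (m := ∞) (by simp)).contDiffAt
        (U.isOpen.mem_nhds x.2)).differentiableAt (by simp)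
    rw [fderiv_clm_apply hd (differentiableAt_const w)]
    simp
  ext x
  rw [h, h]
  exact (((f.2.contDiffAt (U.isOpen.mem_nhds x.2)).isSymmSndFDerivAt
    (by
      rw [minSmoothness_of_isRCLikeNormedField]
      exact WithTop.coe_le_coe.2 (le_top : (2 : ℕ∞) ≤ ⊤))) w v).symm

theorem resFun_dirDeriv (h : V ≤ U) (v : Spacetime n m) (f : Smooth U) :
    resFun h (dirDeriv v f) = dirDeriv v (resFun h f) := by
  ext x
  have e : extendZero (resFun h f).1 =ᶠ[nhds (x : Spacetime n m)] extendZero f.1 := by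
    filter_upwards [V.isOpen.mem_nhds x.2] with y hy
    rw [extendZero_apply _ (⟨y, hy⟩ : V), extendZero_apply _ (⟨y, h hy⟩ : U)]
    rfl
  rw [dirDeriv_apply, e.fderiv_eq]
  rfl

/-- The constant-coefficient vector fields. -/
def vecs (U : Opens (Spacetime n m)) : Submodule ℂ (Smooth U →ₗ[ℂ] Smooth U) :=
  Submodule.span ℂ (Set.range dirDeriv)

theorem dirDeriv_mem (v : Spacetime n m) : dirDeriv (U := U) v ∈ vecs U :=
  Submodule.subset_span ⟨v, rfl⟩

/-- Only membership in the complex span of the directional derivatives matters for the coordinate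
derivatives: the Leibniz rule, commutation, vanishing of integrals and locality are proved once for
the whole span. -/
theorem dZ_mem (i : Fin n) : dZ (U := U) i ∈ vecs U := by
  have e : dZ (U := U) i = (1 / 2 : ℂ) • (dirDeriv (U := U) (vecZ 1 i)
      + (-Complex.I) • dirDeriv (U := U) (vecZ Complex.I i)) := by
    ext1 f
    simp [dZ, sub_eq_add_neg]
  rw [e]
  exact (vecs U).smul_mem _ ((vecs U).add_mem (dirDeriv_mem (U := U) _)
    ((vecs U).smul_mem _ (dirDeriv_mem (U := U) _)))

theorem dW_mem (i : Fin n) : dW (U := U) i ∈ vecs U := by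
  have e : dW (U := U) i = (1 / 2 : ℂ) • (dirDeriv (U := U) (vecW 1 i)
      + (-Complex.I) • dirDeriv (U := U) (vecW Complex.I i)) := by
    ext1 f
    simp [dW, sub_eq_add_neg]
  rw [e]
  exact (vecs U).smul_mem _ ((vecs U).add_mem (dirDeriv_mem (U := U) _)
    ((vecs U).smul_mem _ (dirDeriv_mem (U := U) _)))

theorem dZbar_mem (i : Fin n) : dZbar (U := U) i ∈ vecs U :=
  (vecs U).smul_mem _ ((vecs U).add_mem (dirDeriv_mem (U := U) _)
    ((vecs U).smul_mem _ (dirDeriv_mem (U := U) _)))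

theorem dWbar_mem (i : Fin n) : dWbar (U := U) i ∈ vecs U :=
  (vecs U).smul_mem _ ((vecs U).add_mem (dirDeriv_mem (U := U) _)
    ((vecs U).smul_mem _ (dirDeriv_mem (U := U) _)))

theorem vecs_mul {D : Smooth U →ₗ[ℂ] Smooth U} (hD : D ∈ vecs U) (f g : Smooth U) :
    D (f * g) = D f * g + f * D g := by
  induction hD using Submodule.span_induction with
  | mem D hD => obtain ⟨v, rfl⟩ := hD; exact dirDeriv_mul v f g
  | zero => simp
  | add D E _ _ hD hE => simp only [LinearMap.add_apply, hD, hE]; ring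
  | smul a D _ hD =>
    simp only [LinearMap.smul_apply, hD, smul_add, smul_mul_assoc, mul_smul_comm]

theorem vecs_comm {D E : Smooth U →ₗ[ℂ] Smooth U} (hD : D ∈ vecs U) (hE : E ∈ vecs U)
    (f : Smooth U) : D (E f) = E (D f) := by
  induction hD using Submodule.span_induction with
  | mem D hD =>
    obtain ⟨v, rfl⟩ := hD
    induction hE using Submodule.span_induction with
    | mem E hE => obtain ⟨w, rfl⟩ := hE; exact dirDeriv_comm v w f
    | zero => simp
    | add D E _ _ hD hE => simp only [LinearMap.add_apply, map_add, hD, hE]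
    | smul a D _ hD => simp only [LinearMap.smul_apply, map_smul, hD]
  | zero => simp
  | add D E _ _ hD hE => simp only [LinearMap.add_apply, map_add, hD, hE]
  | smul a D _ hD => simp only [LinearMap.smul_apply, map_smul, hD]

/-- The Poisson bracket of functions. -/
def pb (f g : Smooth U) : Smooth U := ∑ i, (dZ i f * dW i g - dW i f * dZ i g)

theorem pb_swap (f g : Smooth U) : pb f g = -pb g f := by
  rw [pb, pb, ← Finset.sum_neg_distrib]
  exact Finset.sum_congr rfl fun i _ => by ring

/-- `D` has constant coefficients, so it commutes with the derivatives which define the bracket. -/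
theorem vecs_pb {D : Smooth U →ₗ[ℂ] Smooth U} (hD : D ∈ vecs U) (f g : Smooth U) :
    D (pb f g) = pb (D f) g + pb f (D g) := by
  simp only [pb, map_sum, ← Finset.sum_add_distrib]
  refine Finset.sum_congr rfl fun i _ => ?_
  rw [map_sub, vecs_mul hD, vecs_mul hD, vecs_comm hD (dZ_mem i), vecs_comm hD (dZ_mem i),
    vecs_comm hD (dW_mem i), vecs_comm hD (dW_mem i)]
  ring

theorem pb_jacobi (f g h : Smooth U) : pb f (pb g h) = pb (pb f g) h + pb g (pb f h) := by
  have e1 : ∀ f g h : Smooth U, pb f (pb g h) = ∑ i, ∑ j,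
      (dZ i f * dW i (dZ j g * dW j h - dW j g * dZ j h)
        - dW i f * dZ i (dZ j g * dW j h - dW j g * dZ j h)) := by
    intro f g h
    rw [pb]
    refine Finset.sum_congr rfl fun i _ => ?_
    rw [pb, map_sum, map_sum, Finset.mul_sum, Finset.mul_sum, ← Finset.sum_sub_distrib]
  -- Written this way, all three terms of the Jacobi identity have the shape `pb a (pb b c)` and are
  -- given by the same double sum `T`.
  have e2 : pb (pb f g) h = -pb h (pb f g) := pb_swap _ _
  set T : Fin n → Fin n → Smooth U → Smooth U → Smooth U → Smooth U := fun i j f g h =>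
    (dZ i f * dW i (dZ j g * dW j h - dW j g * dZ j h)
        - dW i f * dZ i (dZ j g * dW j h - dW j g * dZ j h)) with hT
  have hsymm : ∀ i j, (T i j f g h + T i j h f g - T i j g f h)
      + (T j i f g h + T j i h f g - T j i g f h) = 0 := by
    intro i j
    have c1 := fun f : Smooth U => vecs_comm (dZ_mem i) (dZ_mem j) f
    have c2 := fun f : Smooth U => vecs_comm (dW_mem i) (dW_mem j) f
    have c3 := fun f : Smooth U => vecs_comm (dW_mem i) (dZ_mem j) f
    have c4 := fun f : Smooth U => vecs_comm (dZ_mem i) (dW_mem j) f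
    simp only [hT, map_sub, vecs_mul (dZ_mem _), vecs_mul (dW_mem _), c1, c2, c3, c4]
    ring
  -- The terms for (i, j) and (j, i) cancel against each other after commuting derivatives.
  -- Exchanging the summations therefore shows that twice the sum is zero.
  have hsum : ∑ i, ∑ j, (T i j f g h + T i j h f g - T i j g f h) = 0 := by
    have h2 : ∑ i, ∑ j, (T i j f g h + T i j h f g - T i j g f h)
        + ∑ i, ∑ j, (T i j f g h + T i j h f g - T i j g f h) = 0 := by
      nth_rewrite 2 [Finset.sum_comm]
      rw [← Finset.sum_add_distrib]
      refine Finset.sum_eq_zero fun i _ => ?_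
      rw [← Finset.sum_add_distrib]
      exact Finset.sum_eq_zero fun j _ => hsymm i j
    rw [← two_smul ℂ] at h2
    exact (smul_eq_zero.1 h2).resolve_left two_ne_zero
  have e3 : ∀ f g h : Smooth U, pb f (pb g h) = ∑ i, ∑ j, T i j f g h := e1
  rw [e2, e3 f g h, e3 h f g, e3 g f h]
  simp only [Finset.sum_add_distrib, Finset.sum_sub_distrib] at hsum
  linear_combination hsum

theorem resFun_vec (h : V ≤ U) (i : Fin n) (f : Smooth U) :
    resFun h (dZ i f) = dZ i (resFun h f) ∧ resFun h (dW i f) = dW i (resFun h f) ∧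
    resFun h (dZbar i f) = dZbar i (resFun h f) ∧ resFun h (dWbar i f) = dWbar i (resFun h f) := by
  simp [dZ, dW, dZbar, dWbar, resFun_dirDeriv]

theorem resFun_pb (h : V ≤ U) (f g : Smooth U) : resFun h (pb f g) = pb (resFun h f) (resFun h g) := by
  simp [pb, (resFun_vec h _ _).1, (resFun_vec h _ _).2.1]

end Derivatives

/-! ## The exterior algebra -/

section Lam

variable {n m : ℕ}

instance : SuperSpace (Lam n m) where
  par := (ExteriorAlgebra.map (-LinearMap.id)).toLinearMap
  par_par v := by
    have h : (ExteriorAlgebra.map (-LinearMap.id : (Fin (n + n + m) → ℂ) →ₗ[ℂ] _)).comp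
        (ExteriorAlgebra.map (-LinearMap.id)) = AlgHom.id ℂ (Lam n m) := by
      rw [ExteriorAlgebra.map_comp_map]
      simp
    exact DFunLike.congr_fun h v

theorem par_lam_mul (k l : Lam n m) : par (k * l) = par k * par l :=
  map_mul (ExteriorAlgebra.map (-LinearMap.id : (Fin (n + n + m) → ℂ) →ₗ[ℂ] _)) k l

theorem par_lam_one : par (1 : Lam n m) = 1 :=
  map_one (ExteriorAlgebra.map (-LinearMap.id : (Fin (n + n + m) → ℂ) →ₗ[ℂ] _))

theorem par_lam_ι (x : Fin (n + n + m) → ℂ) :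
    par (ExteriorAlgebra.ι ℂ x : Lam n m) = -ExteriorAlgebra.ι ℂ x :=
  (ExteriorAlgebra.map_apply_ι (-LinearMap.id : (Fin (n + n + m) → ℂ) →ₗ[ℂ] _) x).trans
    (by rw [LinearMap.neg_apply, LinearMap.id_apply, map_neg])

theorem par_gen (k : Fin (n + n + m)) : Par true (gen k : Lam n m) := by
  simp [Par, gen, par_lam_ι]

theorem lam_induction {P : Lam n m → Prop} (one : P 1)
    (mul : ∀ x l, P l → P (ExteriorAlgebra.ι ℂ x * l)) (add : ∀ k l, P k → P l → P (k + l))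
    (smul : ∀ (a : ℂ) l, P l → P (a • l)) (l : Lam n m) : P l := by
  have key : ∀ t : Lam n m, ∀ l, P l → P (t * l) := by
    intro t
    induction t using ExteriorAlgebra.induction with
    | algebraMap r => intro l hl; rw [← Algebra.smul_def]; exact smul r l hl
    | ι v => exact fun l hl => mul v l hl
    | mul a b ha hb => intro l hl; rw [mul_assoc]; exact ha _ (hb _ hl)
    | add a b ha hb => intro l hl; rw [add_mul]; exact add _ _ (ha l hl) (hb l hl)
  simpa using key l 1 one

theorem lam_ι_mul_comm (x : Fin (n + n + m) → ℂ) (l : Lam n m) :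
    ExteriorAlgebra.ι ℂ x * l = par l * ExteriorAlgebra.ι ℂ x := by
  induction l using lam_induction with
  | one => rw [par_lam_one, mul_one, one_mul]
  | mul y l hl =>
    rw [par_lam_mul, par_lam_ι, mul_assoc, ← hl, ← mul_assoc, ← mul_assoc,
      eq_neg_of_add_eq_zero_left (ExteriorAlgebra.ι_add_mul_swap x y), neg_mul,
      neg_mul, neg_mul]
  | add k l hk hl => rw [mul_add, hk, hl, map_add, add_mul]
  | smul a l hl => rw [mul_smul_comm, hl, map_smul, smul_mul_assoc]

theorem lam_mul_comm {c : Bool} {l : Lam n m} (hl : Par c l) (k : Lam n m) :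
    k * l = l * parPow c k := by
  induction k using lam_induction with
  | one => cases c <;> simp [par_lam_one]
  | mul x k hk =>
    rw [mul_assoc, hk, ← mul_assoc, lam_ι_mul_comm, hl]
    cases c <;> simp [par_lam_mul, par_lam_ι, mul_assoc]
  | add k l hk hl => rw [add_mul, hk, hl, map_add, mul_add]
  | smul a k hk => rw [smul_mul_assoc, hk, map_smul, mul_smul_comm]

theorem parPow_lam_mul {c : Bool} {l : Lam n m} (hl : Par c l) (k : Lam n m) :
    parPow c k * l = l * k := by
  rw [lam_mul_comm hl, parPow_parPow]; simp

end Lam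

/-! ## Forms -/

section Forms

variable {n m : ℕ} {U V : Opens (Spacetime n m)}

/-- The form `f l` for a function `f` and `l` in the exterior algebra. -/
def pt (f : Smooth U) (l : Lam n m) : Forms n m U := (f ⊗ₜ[ℂ] l : Smooth U ⊗[ℂ] Lam n m)

theorem pt_add_left (f g : Smooth U) (l : Lam n m) : pt (f + g) l = pt f l + pt g l :=
  TensorProduct.add_tmul f g l

theorem pt_add_right (f : Smooth U) (k l : Lam n m) : pt f (k + l) = pt f k + pt f l :=
  TensorProduct.tmul_add f k l

theorem pt_smul_left (a : ℂ) (f : Smooth U) (l : Lam n m) : pt (a • f) l = a • pt f l :=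
  (TensorProduct.smul_tmul' a f l).symm

theorem pt_smul_right (a : ℂ) (f : Smooth U) (l : Lam n m) : pt f (a • l) = a • pt f l :=
  TensorProduct.tmul_smul a f l

theorem pt_neg_left (f : Smooth U) (l : Lam n m) : pt (-f) l = -pt f l :=
  TensorProduct.neg_tmul f l

theorem pt_zero_left (l : Lam n m) : pt (0 : Smooth U) l = 0 :=
  TensorProduct.zero_tmul (Smooth U) l

theorem pt_sub_left (f g : Smooth U) (l : Lam n m) : pt (f - g) l = pt f l - pt g l :=
  TensorProduct.sub_tmul f g l

theorem pt_sum_left {ι : Type} (s : Finset ι) (f : ι → Smooth U) (l : Lam n m) :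
    pt (∑ i ∈ s, f i) l = ∑ i ∈ s, pt (f i) l :=
  TensorProduct.sum_tmul s f l

theorem pt_mul (f g : Smooth U) (k l : Lam n m) : pt f k * pt g l = pt (f * g) (k * l) :=
  Algebra.TensorProduct.tmul_mul_tmul f g k l

theorem par_pt (f : Smooth U) (l : Lam n m) : par (pt f l) = pt f (par l) := rfl

theorem parPow_pt (c : Bool) (f : Smooth U) (l : Lam n m) :
    parPow c (pt f l) = pt f (parPow c l) := by cases c <;> rfl

theorem formOp_pt (D : Smooth U →ₗ[ℂ] Smooth U) (L : Lam n m →ₗ[ℂ] Lam n m) (f : Smooth U)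
    (l : Lam n m) : formOp D L (pt f l) = pt (D f) (L l) := rfl

theorem res_pt (h : V ≤ U) (f : Smooth U) (l : Lam n m) :
    res h (pt f l) = pt (resFun h f) l := rfl

theorem forms_induction {P : Forms n m U → Prop} (pt : ∀ f l, P (pt f l))
    (add : ∀ a b, P a → P b → P (a + b)) (a : Forms n m U) : P a := by
  induction a using TensorProduct.induction_on with
  | zero =>
    have := pt 0 0
    rwa [PoissonBF.pt, TensorProduct.zero_tmul] at this
  | tmul f l => exact pt f l
  | add a b ha hb => exact add a b ha hb

/-- A homogeneous form is fixed by the projector ½(1 ± par). The projector acts on the exterior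
factor alone, so applied to any sum of pure tensors it yields a sum of pure tensors with homogeneous
exterior factor. -/
theorem forms_hom_induction {c : Bool} {P : Forms n m U → Prop}
    (pt : ∀ f l, Par c l → P (pt f l)) (add : ∀ a b, P a → P b → P (a + b))
    {a : Forms n m U} (ha : Par c a) : P a := by
  let pL : Lam n m →ₗ[ℂ] Lam n m := (1 / 2 : ℂ) • (LinearMap.id + sg c • par)
  let pF : Forms n m U →ₗ[ℂ] Forms n m U := (1 / 2 : ℂ) • (LinearMap.id + sg c • par)
  have hpt : ∀ f l, pF (PoissonBF.pt f l) = PoissonBF.pt f (pL l) := by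
    intro f l
    simp only [pF, pL, LinearMap.smul_apply, LinearMap.add_apply, LinearMap.id_apply, par_pt,
      pt_smul_right, pt_add_right]
  have hpL : ∀ l, Par c (pL l) := by
    intro l
    simp only [Par, pL, LinearMap.smul_apply, LinearMap.add_apply, LinearMap.id_apply, map_smul,
      map_add, par_par]
    cases c <;> simp only [sg_true, sg_false] <;> module
  have key : ∀ b, P (pF b) := by
    intro b
    induction b using forms_induction with
    | pt f l => rw [hpt]; exact pt _ _ (hpL l)
    | add a b ha hb => rw [map_add]; exact add _ _ ha hb
  have : pF a = a := by
    simp only [pF, LinearMap.smul_apply, LinearMap.add_apply, LinearMap.id_apply, show par a = sg c • a from ha, smul_smul,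
      sg_mul_self]
    module
  rw [← this]; exact key a

end Forms

/-! ### Graded identities for the wedge product, the bracket and the differential on forms -/

section FormOperators

variable {n m : ℕ} {U V : Opens (Spacetime n m)}

theorem par_forms_mul (a b : Forms n m U) : par (a * b) = par a * par b := by
  induction a using forms_induction with
  | pt f l =>
    induction b using forms_induction with
    | pt g k => simp only [pt_mul, par_pt, par_lam_mul]
    | add a b ha hb => rw [mul_add, map_add, ha, hb, map_add, mul_add]
  | add a b ha hb => rw [add_mul, map_add, ha, hb, map_add, add_mul]

theorem wedge_apply (a b : Forms n m U) : wedge a b = a * b := rfl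

theorem poisson_pt (f g : Smooth U) (k l : Lam n m) :
    poisson (pt f k) (pt g l) = pt (pb f g) (k * l) := by
  simp only [poisson, LinearMap.sum_apply, LinearMap.sub_apply, LinearMap.compl₁₂_apply,
    wedge_apply, formOp_pt, pt_mul, LinearMap.id_apply, pb, pt_sum_left, pt_sub_left]

theorem par_poisson (a b : Forms n m U) : par (poisson a b) = poisson (par a) (par b) := by
  induction a using forms_induction with
  | pt f l =>
    induction b using forms_induction with
    | pt g k => simp only [poisson_pt, par_pt, par_lam_mul]
    | add a b ha hb => simp only [map_add, ha, hb]
  | add a b ha hb => simp only [map_add, LinearMap.add_apply, ha, hb]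

theorem poisson_comm {c : Bool} {b : Forms n m U} (hb : Par c b) (a : Forms n m U) :
    poisson a b = -poisson b (parPow c a) := by
  refine forms_hom_induction (P := fun b => poisson a b = -poisson b (parPow c a))
    (fun f l hl => ?_) (fun b b' h h' => by
      rw [map_add, h, h', map_add, LinearMap.add_apply, neg_add]) hb
  induction a using forms_induction with
  | pt g k => rw [parPow_pt, poisson_pt, poisson_pt, lam_mul_comm hl, pb_swap, pt_neg_left]
  | add a a' h h' => rw [map_add, LinearMap.add_apply, h, h', map_add, map_add, neg_add]

/-- On pure tensors the functions satisfy the ordinary Jacobi identity, and the exterior factors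
contribute only the sign of moving `α` past `a`. -/
theorem poisson_jacobi {c : Bool} {α : Forms n m U} (hα : Par c α) (a b : Forms n m U) :
    poisson α (poisson a b) = poisson (poisson α a) b + poisson (parPow c a) (poisson α b) := by
  refine forms_hom_induction (P := fun α => poisson α (poisson a b)
    = poisson (poisson α a) b + poisson (parPow c a) (poisson α b)) (fun f l hl => ?_)
    (fun x y hx hy => by
      simp only [map_add, LinearMap.add_apply] at hx hy ⊢; rw [hx, hy]; abel) hα
  induction a using forms_induction with
  | pt g k =>
    induction b using forms_induction with
    | pt h p =>
      rw [parPow_pt, poisson_pt, poisson_pt, poisson_pt, poisson_pt, poisson_pt, poisson_pt,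
        ← mul_assoc, ← mul_assoc, parPow_lam_mul hl, ← pt_add_left, pb_jacobi]
    | add x y hx hy => simp only [map_add, hx, hy]; abel
  | add x y hx hy => simp only [map_add, LinearMap.add_apply, hx, hy]; abel

/-- The first-order operators `∑ D_k(-) ∧ g_k` with constant coefficients. -/
def dOps (U : Opens (Spacetime n m)) : Submodule ℂ (Forms n m U →ₗ[ℂ] Forms n m U) :=
  Submodule.span ℂ {T | ∃ D ∈ vecs U, ∃ k, T = formOp D (LinearMap.mulLeft ℂ (gen k))}

/-- Parity, both Leibniz rules, Stokes' theorem and locality of the differential are obtained from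
the span `dOps`, where a single operator D(-) ∧ gen has to be treated. -/
theorem dForm_mem : dForm ∈ dOps U := by
  refine Submodule.add_mem _ (Submodule.add_mem _ ?_ ?_) ?_
  · exact Submodule.sum_mem _ fun i _ => Submodule.subset_span ⟨_, dZbar_mem i, _, rfl⟩
  · exact Submodule.sum_mem _ fun i _ => Submodule.subset_span ⟨_, dWbar_mem i, _, rfl⟩
  · exact Submodule.sum_mem _ fun i _ => Submodule.subset_span ⟨_, dirDeriv_mem _, _, rfl⟩

theorem parMap_dOps {T : Forms n m U →ₗ[ℂ] Forms n m U} (hT : T ∈ dOps U) : ParMap true T := by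
  intro a
  induction hT using Submodule.span_induction with
  | mem T hT =>
    obtain ⟨D, hD, k, rfl⟩ := hT
    induction a using forms_induction with
    | pt f l =>
      rw [par_pt, formOp_pt, formOp_pt, par_pt, LinearMap.mulLeft_apply, LinearMap.mulLeft_apply,
        par_lam_mul, par_gen k, smul_mul_assoc, pt_smul_right]
    | add x y hx hy => simp only [map_add, hx, hy, smul_add]
  | zero => simp
  | add S T _ _ hS hT => simp only [LinearMap.add_apply, map_add, hS, hT, smul_add]
  | smul c T _ hT => simp only [LinearMap.smul_apply, map_smul, hT, smul_comm c]

theorem parMap_dForm : ParMap true (dForm : Forms n m U →ₗ[ℂ] Forms n m U) :=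
  parMap_dOps dForm_mem

theorem par_gen_mul (k : Fin (n + n + m)) (l : Lam n m) : par l * gen k = gen k * l := by
  simpa using parPow_lam_mul (par_gen k) l

/-- `D` is a derivation of the bracket of functions, and moving the generator past the exterior part
of `a` produces `par a`. -/
theorem dOps_poisson {T : Forms n m U →ₗ[ℂ] Forms n m U} (hT : T ∈ dOps U) (a b : Forms n m U) :
    T (poisson a b) = poisson (T a) b + poisson (par a) (T b) := by
  induction hT using Submodule.span_induction with
  | mem T hT =>
    obtain ⟨D, hD, k, rfl⟩ := hT
    induction a using forms_induction with
    | pt f l =>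
      induction b using forms_induction with
      | pt g p =>
        rw [par_pt, formOp_pt, formOp_pt, poisson_pt, poisson_pt, poisson_pt, formOp_pt,
          LinearMap.mulLeft_apply, LinearMap.mulLeft_apply, LinearMap.mulLeft_apply, vecs_pb hD,
          ← mul_assoc, ← mul_assoc, par_gen_mul, pt_add_left]
      | add x y hx hy => simp only [map_add, hx, hy]; abel
    | add x y hx hy => simp only [map_add, LinearMap.add_apply, hx, hy]; abel
  | zero => simp
  | add S T _ _ hS hT => simp only [LinearMap.add_apply, map_add, hS, hT]; abel
  | smul c T _ hT => simp only [LinearMap.smul_apply, map_smul, hT, smul_add]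

theorem dOps_mul {T : Forms n m U →ₗ[ℂ] Forms n m U} (hT : T ∈ dOps U) (a b : Forms n m U) :
    T (a * b) = T a * b + par a * T b := by
  induction hT using Submodule.span_induction with
  | mem T hT =>
    obtain ⟨D, hD, k, rfl⟩ := hT
    induction a using forms_induction with
    | pt f l =>
      induction b using forms_induction with
      | pt g p =>
        rw [par_pt, formOp_pt, formOp_pt, pt_mul, pt_mul, pt_mul, formOp_pt,
          LinearMap.mulLeft_apply, LinearMap.mulLeft_apply, LinearMap.mulLeft_apply, vecs_mul hD,
          ← mul_assoc, ← mul_assoc, par_gen_mul, pt_add_left]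
      | add x y hx hy => simp only [map_add, mul_add, hx, hy]; abel
    | add x y hx hy => simp only [map_add, add_mul, hx, hy]; abel
  | zero => simp
  | add S T _ _ hS hT => simp only [LinearMap.add_apply, add_mul, mul_add, hS, hT]; abel
  | smul c T _ hT =>
    simp only [LinearMap.smul_apply, hT, smul_add, smul_mul_assoc, mul_smul_comm]

theorem dForm_poisson (a b : Forms n m U) :
    dForm (poisson a b) = poisson (dForm a) b + poisson (par a) (dForm b) :=
  dOps_poisson dForm_mem a b

theorem dForm_mul (a b : Forms n m U) : dForm (a * b) = dForm a * b + par a * dForm b :=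
  dOps_mul dForm_mem a b

theorem parMap_poisson {c : Bool} {α : Forms n m U} (hα : Par c α) :
    ParMap c (poisson α) := fun a => by
  rw [par_poisson, hα, map_smul, LinearMap.smul_apply]

/-! ### Compatibility with restriction and pullback -/

theorem res_poisson (h : V ≤ U) (a b : Forms n m U) :
    res h (poisson a b) = poisson (res h a) (res h b) := by
  induction a using forms_induction with
  | pt f l =>
    induction b using forms_induction with
    | pt g k => simp only [poisson_pt, res_pt, resFun_pb]
    | add a b ha hb => simp only [map_add, ha, hb]
  | add a b ha hb => simp only [map_add, LinearMap.add_apply, ha, hb]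

theorem dForm_pt (f : Smooth U) (l : Lam n m) :
    dForm (pt f l)
      = ∑ i : Fin n, pt (dZbar i f) (gen (Fin.castAdd m (Fin.castAdd n i)) * l)
        + ∑ i : Fin n, pt (dWbar i f) (gen (Fin.castAdd m (Fin.natAdd n i)) * l)
        + ∑ j : Fin m, pt (dirDeriv (vecT j) f) (gen (Fin.natAdd (n + n) j) * l) := by
  simp only [dForm, LinearMap.add_apply, LinearMap.sum_apply, formOp_pt, LinearMap.mulLeft_apply]

theorem res_dForm (h : V ≤ U) (a : Forms n m U) : res h (dForm a) = dForm (res h a) := by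
  induction a using forms_induction with
  | pt f l =>
    simp only [dForm_pt, res_pt, map_add, map_sum, resFun_dirDeriv, (resFun_vec h _ _).2.2.1,
      (resFun_vec h _ _).2.2.2]
  | add a b ha hb => simp only [map_add, ha, hb]

theorem pull_pt (f : Smooth (⊤ : Opens (Spacetime n 0))) (l : Lam n 0) :
    pull m (pt f l) = pt (pullFun ⊤ f) (ExteriorAlgebra.map (pullGen n m) l) := rfl

/-- Stated for the principal filter of `U`, so that it restricts to the neighbourhood filter of each
point of `U`, where derivatives are compared. -/
theorem extendZero_pullFun (f : Smooth (⊤ : Opens (Spacetime n 0))) :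
    extendZero (pullFun (m := m) U f).1 =ᶠ[Filter.principal (U : Set (Spacetime n m))]
      extendZero f.1 ∘ fun x => ((x.1, x.2.1, 0) : Spacetime n 0) := by
  filter_upwards [Filter.mem_principal_self _] with x hx
  rw [extendZero_apply _ (⟨x, hx⟩ : U), Function.comp_apply]
  exact (extendZero_apply f.1 (⟨(x.1, x.2.1, 0), trivial⟩ : (⊤ : Opens (Spacetime n 0)))).symm

/-- The projection to `ℂ²ⁿ`, as a linear map. -/
def projL (n m : ℕ) : Spacetime n m →L[ℝ] Spacetime n 0 :=
  (ContinuousLinearMap.fst ℝ _ _).prod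
    (((ContinuousLinearMap.fst ℝ _ _).comp (ContinuousLinearMap.snd ℝ _ _)).prod 0)

theorem dirDeriv_pullFun (v : Spacetime n m) (f : Smooth (⊤ : Opens (Spacetime n 0))) :
    dirDeriv v (pullFun U f) = pullFun U (dirDeriv (projL n m v) f) := by
  ext x
  have e : extendZero (pullFun (m := m) U f).1 =ᶠ[nhds (x : Spacetime n m)]
      extendZero f.1 ∘ projL n m :=
    (extendZero_pullFun f).filter_mono (Filter.le_principal_iff.2 (U.isOpen.mem_nhds x.2))
  have hd : DifferentiableAt ℝ (extendZero f.1) (projL n m x) :=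
    differentiableAt_smooth f ⟨projL n m x, trivial⟩
  rw [dirDeriv_apply, e.fderiv_eq, fderiv_comp _ hd (projL n m).differentiableAt,
    ContinuousLinearMap.fderiv]
  rfl

theorem pullFun_vec (i : Fin n) (f : Smooth (⊤ : Opens (Spacetime n 0))) :
    pullFun U (dZ i f) = dZ i (pullFun (m := m) U f)
    ∧ pullFun U (dW i f) = dW i (pullFun (m := m) U f)
    ∧ pullFun U (dZbar i f) = dZbar i (pullFun (m := m) U f)
    ∧ pullFun U (dWbar i f) = dWbar i (pullFun (m := m) U f) := by
  have h1 : ∀ c : ℂ, projL n m (vecZ c i) = vecZ c i := fun c => by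
    simp [projL, vecZ]
  have h2 : ∀ c : ℂ, projL n m (vecW c i) = vecW c i := fun c => by
    simp [projL, vecW]
  simp [dZ, dW, dZbar, dWbar, dirDeriv_pullFun, h1, h2]

theorem pull_poisson (a b : L n) : pull m (poisson a b) = poisson (pull m a) (pull m b) := by
  induction a using forms_induction with
  | pt f l =>
    induction b using forms_induction with
    | pt g k =>
      simp only [poisson_pt, pull_pt, map_mul, pb, map_sum, map_sub, (pullFun_vec _ _).1,
        (pullFun_vec _ _).2.1]
    | add a b ha hb => simp only [map_add, ha, hb]
  | add a b ha hb => simp only [map_add, LinearMap.add_apply, ha, hb]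

theorem pull_gen (i : Fin (n + n)) :
    ExteriorAlgebra.map (pullGen n m) (gen (Fin.castAdd 0 i)) = gen (Fin.castAdd m i) := by
  rw [gen, gen, ExteriorAlgebra.map_apply_ι]
  congr 1
  ext j
  refine Fin.addCases (fun j => ?_) (fun j => ?_) j
  · simp [pullGen, Pi.single_apply]
  · have h : Fin.natAdd (n + n) j ≠ Fin.castAdd m i := fun h => by
      have := congrArg Fin.val h
      simp at this
      omega
    simp [pullGen, h]

theorem pull_dForm (a : L n) : pull m (dForm a) = dForm (pull m a) := by
  induction a using forms_induction with
  | pt f l =>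
    -- A pulled-back function does not depend on t, so the d_{dR} part of the differential
    -- contributes nothing.
    have h0 : ∀ j, dirDeriv (vecT j) (pullFun (m := m) ⊤ f) = 0 := fun j => by
      rw [dirDeriv_pullFun, show projL n m (vecT j) = 0 from by simp [projL, vecT]]
      have h : dirDeriv 0 f = 0 := by
        ext x
        rw [dirDeriv_apply, map_zero]
        rfl
      rw [h, map_zero]
    rw [pull_pt, dForm_pt, dForm_pt]
    simp only [Finset.univ_eq_empty, Finset.sum_empty, add_zero, map_add, map_sum, pull_pt, h0,
      map_mul, (pullFun_vec _ _).2.2.1, (pullFun_vec _ _).2.2.2, pull_gen, pt_zero_left,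
      Finset.sum_const_zero]
  | add a b ha hb => simp only [map_add, ha, hb]

theorem pull_par (a : L n) : pull m (par a) = par (pull m a) := by
  have h : ∀ l : Lam n 0, ExteriorAlgebra.map (pullGen n m) (par l)
      = par (ExteriorAlgebra.map (pullGen n m) l) := by
    intro l
    induction l using lam_induction with
    | one => rw [par_lam_one, map_one, par_lam_one]
    | mul x l hl =>
      rw [par_lam_mul, map_mul, map_mul, par_lam_mul, hl, par_lam_ι, map_neg,
        ExteriorAlgebra.map_apply_ι, par_lam_ι]
    | add k l hk hl => simp only [map_add, hk, hl]
    | smul a l hl => simp only [map_smul, hl]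
  induction a using forms_induction with
  | pt f l => rw [par_pt, pull_pt, pull_pt, par_pt, h]
  | add a b ha hb => simp only [map_add, ha, hb]

/-! ### Form degrees -/

/-- The parity of an integer. -/
def pty (j : ℤ) : Bool := decide (Odd j)

theorem sg_pty (j : ℤ) : sg (pty j) = (-1 : ℂ) ^ j := by
  rcases Int.even_or_odd j with h | h
  · simp [pty, h.neg_one_zpow, Int.not_odd_iff_even.2 h]
  · simp [pty, h.neg_one_zpow, h]

theorem pty_add (i j : ℤ) : pty (i + j) = xor (pty i) (pty j) := by
  simp only [pty, Int.odd_add, ← Int.not_odd_iff_even]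
  by_cases h : Odd i <;> by_cases h' : Odd j <;> simp [h, h']

theorem par_of_mem_exteriorPower {k : ℕ} {l : Lam n m}
    (hl : l ∈ ⋀[ℂ]^k (Fin (n + n + m) → ℂ)) : Par (pty k) l := by
  rw [← ExteriorAlgebra.ιMulti_span_fixedDegree] at hl
  induction hl using Submodule.span_induction with
  | mem x hx =>
    obtain ⟨v, rfl⟩ := hx
    rw [Par, sg_pty]
    change ExteriorAlgebra.map (-LinearMap.id : (Fin (n + n + m) → ℂ) →ₗ[ℂ] _) _ = _
    rw [ExteriorAlgebra.map_apply_ιMulti]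
    have : (⇑(-LinearMap.id : (Fin (n + n + m) → ℂ) →ₗ[ℂ] _) ∘ v) = fun i => (-1 : ℂ) • v i := by
      funext i; simp
    rw [this, AlternatingMap.map_smul_univ]
    simp
  | zero => simp [Par]
  | add x y _ _ hx hy => rw [Par, map_add, hx, hy, smul_add]
  | smul a x _ hx => rw [Par, map_smul, hx, smul_comm]

theorem par_of_mem_formsDeg {p : ℤ} {a : Forms n m U} (ha : a ∈ formsDeg U p) : Par (pty p) a := by
  induction ha using Submodule.span_induction with
  | mem x hx =>
    obtain ⟨k, f, l, rfl, hl, rfl⟩ := hx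
    change par (pt f l) = _ • pt f l
    rw [par_pt, par_of_mem_exteriorPower hl, pt_smul_right]
  | zero => simp [Par]
  | add x y _ _ hx hy => rw [Par, map_add, hx, hy, smul_add]
  | smul a x _ hx => rw [Par, map_smul, hx, smul_comm]

theorem pt_mem_formsDeg {k : ℕ} {f : Smooth U} {l : Lam n m}
    (hl : l ∈ ⋀[ℂ]^k (Fin (n + n + m) → ℂ)) : pt f l ∈ formsDeg U k :=
  Submodule.subset_span ⟨k, f, l, rfl, hl, rfl⟩

theorem bilin_mem_formsDeg {β : Forms n m U →ₗ[ℂ] Forms n m U →ₗ[ℂ] Forms n m U}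
    (hβ : ∀ f g k l, ∃ h, β (pt f k) (pt g l) = pt h (k * l)) {p q : ℤ} {a b : Forms n m U}
    (ha : a ∈ formsDeg U p) (hb : b ∈ formsDeg U q) : β a b ∈ formsDeg U (p + q) := by
  induction ha using Submodule.span_induction with
  | mem x hx =>
    obtain ⟨k, f, l, rfl, hl, rfl⟩ := hx
    induction hb using Submodule.span_induction with
    | mem y hy =>
      obtain ⟨k', g, l', rfl, hl', rfl⟩ := hy
      obtain ⟨h, hh⟩ := hβ f g l l'
      change β (pt f l) (pt g l') ∈ _
      rw [hh, ← Nat.cast_add]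
      exact pt_mem_formsDeg (SetLike.mul_mem_graded hl hl')
    | zero => simp
    | add x y _ _ hx hy => rw [map_add]; exact Submodule.add_mem _ hx hy
    | smul a x _ hx => rw [map_smul]; exact Submodule.smul_mem _ _ hx
  | zero => simp
  | add x y _ _ hx hy => rw [map_add, LinearMap.add_apply]; exact Submodule.add_mem _ hx hy
  | smul a x _ hx => rw [map_smul, LinearMap.smul_apply]; exact Submodule.smul_mem _ _ hx

theorem poisson_mem_formsDeg {p q : ℤ} {a b : Forms n m U} (ha : a ∈ formsDeg U p)
    (hb : b ∈ formsDeg U q) : poisson a b ∈ formsDeg U (p + q) :=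
  bilin_mem_formsDeg (fun f g k l => ⟨_, poisson_pt f g k l⟩) ha hb

theorem mul_mem_formsDeg {p q : ℤ} {a b : Forms n m U} (ha : a ∈ formsDeg U p)
    (hb : b ∈ formsDeg U q) : a * b ∈ formsDeg U (p + q) :=
  bilin_mem_formsDeg (β := wedge) (fun f g k l => ⟨_, pt_mul f g k l⟩) ha hb

theorem parPow_mem_formsDeg {p : ℤ} {a : Forms n m U} (ha : a ∈ formsDeg U p) (c : Bool) :
    parPow c a ∈ formsDeg U p := by
  rw [(par_of_mem_formsDeg ha).parPow]
  exact Submodule.smul_mem _ _ ha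

theorem res_mem_formsDeg (h : V ≤ U) {p : ℤ} {a : Forms n m U} (ha : a ∈ formsDeg U p) :
    res h a ∈ formsDeg V p := by
  induction ha using Submodule.span_induction with
  | mem x hx =>
    obtain ⟨k, f, l, rfl, hl, rfl⟩ := hx
    exact pt_mem_formsDeg hl
  | zero => simp
  | add x y _ _ hx hy => rw [map_add]; exact Submodule.add_mem _ hx hy
  | smul a x _ hx => rw [map_smul]; exact Submodule.smul_mem _ _ hx

theorem pull_mem_formsDeg {p : ℤ} {a : L n} (ha : a ∈ formsDeg ⊤ p) :
    pull m a ∈ formsDeg ⊤ p := by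
  induction ha using Submodule.span_induction with
  | mem x hx =>
    obtain ⟨k, f, l, rfl, hl, rfl⟩ := hx
    refine pt_mem_formsDeg (f := pullFun ⊤ f) ?_
    rw [← ExteriorAlgebra.ιMulti_span_fixedDegree] at hl
    induction hl using Submodule.span_induction with
    | mem x hx =>
      obtain ⟨v, rfl⟩ := hx
      change ExteriorAlgebra.map (pullGen n m) _ ∈ _
      rw [ExteriorAlgebra.map_apply_ιMulti]
      exact ExteriorAlgebra.ιMulti_range ℂ k ⟨_, rfl⟩
    | zero => rw [map_zero]; exact Submodule.zero_mem _
    | add x y _ _ hx hy => rw [map_add]; exact Submodule.add_mem _ hx hy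
    | smul a x _ hx => rw [map_smul]; exact Submodule.smul_mem _ _ hx
  | zero => simp
  | add x y _ _ hx hy => rw [map_add]; exact Submodule.add_mem _ hx hy
  | smul a x _ hx => rw [map_smul]; exact Submodule.smul_mem _ _ hx

end FormOperators

open GSym

section VectorFields

variable {n m : ℕ} {U V : Opens (Spacetime n m)}

/-! ### Components of fields -/

/-- The `A`-component of a field. -/
def pA : Fields n m U →ₗ[ℂ] Forms n m U := LinearMap.fst ℂ (Forms n m U) (Forms n m U)

/-- The `B`-component of a field. -/
def pB : Fields n m U →ₗ[ℂ] Forms n m U := LinearMap.snd ℂ (Forms n m U) (Forms n m U)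

/-- The field `(a, 0)`. -/
def iA : Forms n m U →ₗ[ℂ] Fields n m U := LinearMap.inl ℂ (Forms n m U) (Forms n m U)

/-- The field `(0, b)`. -/
def iB : Forms n m U →ₗ[ℂ] Fields n m U := LinearMap.inr ℂ (Forms n m U) (Forms n m U)

@[simp] theorem pA_iA (a : Forms n m U) : pA (iA a) = a := rfl
@[simp] theorem pA_iB (a : Forms n m U) : pA (iB a) = 0 := rfl
@[simp] theorem pB_iA (a : Forms n m U) : pB (iA a) = 0 := rfl
@[simp] theorem pB_iB (a : Forms n m U) : pB (iB a) = a := rfl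

theorem fields_ext {φ ψ : Fields n m U} (hA : pA φ = pA ψ) (hB : pB φ = pB ψ) : φ = ψ :=
  Prod.ext hA hB

theorem sg_pty_nat (m : ℕ) : sg (pty m) = (-1 : ℂ) ^ m := by
  rw [sg_pty, zpow_natCast]

theorem pA_par (φ : Fields n m U) : pA (par φ) = -par (pA φ) := rfl

theorem pB_par (φ : Fields n m U) : pB (par φ) = sg (pty m) • par (pB φ) := by
  rw [sg_pty_nat]; rfl

theorem parMap_pA : ParMap true (pA : Fields n m U →ₗ[ℂ] Forms n m U) := fun φ => by
  rw [pA_par]; simp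

theorem parMap_pB : ParMap (pty m) (pB : Fields n m U →ₗ[ℂ] Forms n m U) := fun φ => by
  rw [pB_par, smul_smul, sg_mul_self, one_smul]

theorem parMap_iA : ParMap true (iA : Forms n m U →ₗ[ℂ] Fields n m U) := fun a =>
  fields_ext (by rw [pA_par]; simp) (by rw [pB_par]; simp)

theorem parMap_iB : ParMap (pty m) (iB : Forms n m U →ₗ[ℂ] Fields n m U) := fun a =>
  fields_ext (by rw [pA_par]; simp) (by rw [pB_par]; simp)

/-- The `A`-field as a functional. -/
def fA (U : Opens (Spacetime n m)) : GSym (Fields n m U) →ₗ[ℂ] Forms n m U := pA ∘ₗ lin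

/-- The `B`-field as a functional. -/
def fB (U : Opens (Spacetime n m)) : GSym (Fields n m U) →ₗ[ℂ] Forms n m U := pB ∘ₗ lin

theorem parMap_fA : ParMap true (fA U) := by
  rw [fA]
  simpa using parMap_pA.comp (parMap_lin (V := Fields n m U))

theorem parMap_fB : ParMap (pty m) (fB U) := by
  rw [fB]
  simpa using parMap_pB.comp (parMap_lin (V := Fields n m U))

/-! ### The Hamiltonian vector fields -/

/-- The linear vector field `(A, B) ↦ ({a, A}, {par^{m+1} a, B})`. -/
def actL : Forms n m U →ₗ[ℂ] Fields n m U →ₗ[ℂ] Fields n m U :=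
  (poisson.compl₂ pA).compr₂ iA + ((poisson ∘ₗ parPow (!pty m)).compl₂ pB).compr₂ iB

theorem pA_actL (a : Forms n m U) (φ : Fields n m U) : pA (actL a φ) = poisson a (pA φ) := by
  simp [actL]

theorem pB_actL (a : Forms n m U) (φ : Fields n m U) :
    pB (actL a φ) = poisson (parPow (!pty m) a) (pB φ) := by
  simp [actL]

theorem parMap_actL {c : Bool} {a : Forms n m U} (ha : Par c a) : ParMap c (actL a) := fun φ => by
  refine fields_ext ?_ ?_
  · rw [pA_par, pA_actL, map_smul, pA_actL, pA_par, par_poisson, ha, map_smul,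
      LinearMap.smul_apply, map_neg, smul_neg]
  · rw [pB_par, pB_actL, map_smul, pB_actL, pB_par, par_poisson,
      (parMap_parPow (!pty m)) a, ha, map_smul, map_smul, map_smul]
    simp only [sg_false, one_smul, map_smul, LinearMap.smul_apply]
    rw [smul_comm]

/-- The pullback of a form on `ℂ²ⁿ` to `U`. -/
def pullU (U : Opens (Spacetime n m)) : L n →ₗ[ℂ] Forms n m U :=
  (res (le_top : U ≤ ⊤)).toLinearMap ∘ₗ (pull m).toLinearMap

theorem pullU_poisson (a b : L n) :
    pullU U (poisson a b) = poisson (pullU U a) (pullU U b) := by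
  simp [pullU, pull_poisson, res_poisson]

theorem pullU_dForm (a : L n) : pullU U (dForm a) = dForm (pullU U a) := by
  simp [pullU, pull_dForm, res_dForm]

theorem pullU_par (a : L n) : pullU U (par a) = par (pullU U a) := by
  simp [pullU, pull_par, res_par]

theorem Par.pullU {c : Bool} {a : L n} (h : Par c a) : Par c (PoissonBF.pullU U a) := by
  rw [Par, ← pullU_par, h, map_smul]

theorem res_res {W : Opens (Spacetime n m)} (h : V ≤ U) (h' : W ≤ V) (a : Forms n m U) :
    res h' (res h a) = res (h'.trans h) a := by
  induction a using forms_induction with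
  | pt f l => rfl
  | add a b ha hb => simp only [map_add, ha, hb]

theorem res_pullU (h : V ≤ U) (a : L n) : res h (pullU U a) = pullU V a :=
  res_res le_top h (pull m a)

/-- The Hamiltonian vector field of `Φ(x)`. -/
def xVF (U : Opens (Spacetime n m)) :
    LdR n →ₗ[ℂ] GSym (Fields n m U) →ₗ[ℂ] Fields n m U :=
  ((actL ∘ₗ pullU U ∘ₗ LinearMap.fst ℂ (L n) (L n)).compl₂ lin)
    - (LinearMap.lsmul ℂ (Fields n m U)).flip.compl₁₂
        (iA ∘ₗ pullU U ∘ₗ par ∘ₗ LinearMap.snd ℂ (L n) (L n)) aug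

theorem xVF_apply (x : LdR n) (w : GSym (Fields n m U)) :
    xVF U x w = actL (pullU U x.1) (lin w) - aug w • iA (pullU U (par x.2)) := rfl

/-- The vector field is affine: a linear component and a constant one. Homogeneity, the effect on
degrees and continuity are read off from this decomposition. -/
theorem xVF_eq (x : LdR n) :
    xVF U x = actL (pullU U x.1) ∘ₗ lin + const (-iA (pullU U (par x.2))) := by
  ext w
  simp [xVF_apply, sub_eq_add_neg]

/-- The Hamiltonian vector field of the action functional. -/
def sVF (U : Opens (Spacetime n m)) : GSym (Fields n m U) →ₗ[ℂ] Fields n m U :=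
  iA ∘ₗ (dForm ∘ₗ fA U + (1 / 2 : ℂ) • conv poisson (fA U) (fA U))
    + sg (!pty m) • iB ∘ₗ (dForm ∘ₗ fB U + conv poisson (fA U) (fB U))

/-- `x ∈ (L_n)_{dR}` is homogeneous of parity `c`. -/
def ParX (c : Bool) (x : LdR n) : Prop := Par c x.1 ∧ Par (!c) x.2

theorem parX_of_mem {j : ℤ} {x : LdR n} (hx : x ∈ dRDeg n j) : ParX (pty j) x := by
  refine ⟨par_of_mem_formsDeg hx.1, ?_⟩
  have := par_of_mem_formsDeg hx.2
  rwa [pty_add, show pty 1 = true by simp [pty], Bool.xor_true] at this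

theorem parMap_xVF {c : Bool} {x : LdR n} (hx : ParX c x) : ParMap c (xVF U x) := by
  rw [xVF_eq]
  refine ParMap.add ?_ (parMap_const ?_)
  · simpa using (parMap_actL hx.1.pullU).comp (parMap_lin (V := Fields n m U))
  · have h : Par c (iA (pullU U (par x.2))) := by
      have := Par.map parMap_iA (Par.map (i := false) (f := par) (fun v => by simp) hx.2).pullU
        (v := pullU U (par x.2))
      simpa using this
    rw [Par, map_neg, h, smul_neg]

theorem parMap_sVF : ParMap true (sVF U) := by
  refine ParMap.add ?_ (ParMap.smul ?_ _)
  · have h : ParMap false (dForm ∘ₗ fA U + (1 / 2 : ℂ) • conv poisson (fA U) (fA U)) := by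
      refine ParMap.add ?_ (ParMap.smul ?_ _)
      · simpa using parMap_dForm.comp (parMap_fA (U := U))
      · simpa using parMap_conv par_poisson (parMap_fA (U := U)) (parMap_fA (U := U))
    simpa using parMap_iA.comp h
  · have h : ParMap (!pty m) (dForm ∘ₗ fB U + conv poisson (fA U) (fB U)) := by
      refine ParMap.add ?_ ?_
      · simpa using parMap_dForm.comp (parMap_fB (U := U))
      · simpa using parMap_conv par_poisson (parMap_fA (U := U)) parMap_fB
    simpa using parMap_iB.comp h

/-- A coderivation produces no term of symmetric degree zero, so the constant part of the affine
field dies and only its linear part acts on `D`. -/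
theorem xVF_comp_lins (x : LdR n) {c : Bool} {D : GSym (Fields n m U) →ₗ[ℂ] Fields n m U}
    (hD : ParMap c D) : xVF U x ∘ₗ lins D = actL (pullU U x.1) ∘ₗ D := by
  ext1 w
  rw [LinearMap.comp_apply, xVF_apply, lin_lins hD, aug_lins, zero_smul, sub_zero]
  rfl

/-- For affine fields the commutator has as linear part the commutator of the linear parts, which is
the Jacobi identity, and as constant part the linear part of each applied to the constant of the
other. -/
theorem xVF_bracket {i j : Bool} {x y : LdR n} (hx : ParX i x) (hy : ParX j y) :
    xVF U (dRBracket x y)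
      = xVF U x ∘ₗ lins (xVF U y) - sg (i && j) • xVF U y ∘ₗ lins (xVF U x) := by
  rw [xVF_comp_lins x (parMap_xVF hy), xVF_comp_lins y (parMap_xVF hx)]
  ext1 w
  have ha : Par i (pullU U x.1) := hx.1.pullU
  have ha' : Par j (pullU U y.1) := hy.1.pullU
  have hb : Par (!i) (pullU U (par x.2)) :=
    by rw [pullU_par]; simpa using Par.map (i := false) (f := par) (fun v => by simp) hx.2.pullU
  simp only [LinearMap.sub_apply, LinearMap.smul_apply, LinearMap.comp_apply, xVF_apply]
  refine fields_ext ?_ ?_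
  · have e := poisson_comm ha' (pullU U (par x.2))
    -- Graded antisymmetry rewrites the first half of the ε-component as the linear part of the
    -- field of `y` applied to the constant part of the field of `x`.
    have e2 : pullU U (par (poisson x.2 y.1 + poisson (par x.1) y.2))
        = -(sg (i && j) • poisson (pullU U y.1) (pullU U (par x.2)))
          + poisson (pullU U x.1) (pullU U (par y.2)) := by
      rw [map_add, map_add, par_poisson, par_poisson, par_par, pullU_poisson, pullU_poisson,
        pullU_par y.1, ha', map_smul, e, hb.parPow, map_smul]
      cases i <;> cases j <;> simp
    have jac := poisson_jacobi ha (pullU U y.1) (pA (lin w))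
    rw [ha'.parPow, map_smul, LinearMap.smul_apply] at jac
    simp only [map_sub, map_smul, pA_actL, pA_iA, dRBracket, e2, pullU_poisson, jac]
    module
  · have jac := poisson_jacobi (c := i) (α := parPow (!pty m) (pullU U x.1))
      (by rw [ha.parPow, Par, map_smul, ha, smul_comm])
      (parPow (!pty m) (pullU U y.1)) (pB (lin w))
    have e : parPow (!pty m) (poisson (pullU U x.1) (pullU U y.1))
        = poisson (parPow (!pty m) (pullU U x.1)) (parPow (!pty m) (pullU U y.1)) := by
      cases pty m <;> simp [par_poisson]
    have e4 : parPow i (parPow (!pty m) (pullU U y.1))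
        = sg (i && j) • parPow (!pty m) (pullU U y.1) := by
      rw [parPow_parPow, Bool.xor_comm, ← parPow_parPow, ha'.parPow, map_smul]
    rw [e4, map_smul, LinearMap.smul_apply] at jac
    simp only [map_sub, map_smul, pB_actL, pB_iA, dRBracket, pullU_poisson, e, jac, map_zero,
      smul_zero]
    module

/-- The Jacobi identity on forms, lifted to form-valued functionals: {a, -} is a derivation of
convolution along the bracket, and the sign arises from moving it past the odd functional `f`. -/
theorem conv_jacobi {V : Type} [AddCommGroup V] [Module ℂ V] [SuperSpace V] {i γ : Bool}
    {f : GSym V →ₗ[ℂ] Forms n m U} (hf : ParMap true f) {a : Forms n m U} (ha : Par i a)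
    {g : GSym V →ₗ[ℂ] Forms n m U} (hg : ParMap γ g) (w : GSym V) :
    conv poisson (poisson a ∘ₗ f) g w + sg i • conv poisson f (poisson a ∘ₗ g) w
      = poisson a (conv poisson f g w) := by
  rw [conv_comp_left, conv_comp_right poisson hf (parMap_poisson ha) hg, Bool.and_true,
    LinearMap.smul_apply, smul_smul, sg_mul_self, one_smul, ← LinearMap.add_apply,
    ← conv_add_form, ← LinearMap.comp_apply, comp_conv]
  congr 2
  ext x y
  simp [poisson_jacobi ha x y]

/-- The commutator of d with {a, -} is {da, -}, and the quadratic terms cancel by `conv_jacobi`. The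
constant shift by b turns the quadratic part of the field of `S` into a bracket with b and its
linear part into db; these are the extra terms of `dRDiff`. -/
theorem sVF_bracket {i : Bool} {x : LdR n} (hx : ParX i x) :
    xVF U (dRDiff x) = sVF U ∘ₗ lins (xVF U x) - sg i • xVF U x ∘ₗ lins (sVF U) := by
  rw [xVF_comp_lins x parMap_sVF]
  ext1 w
  have ha : Par i (pullU U x.1) := hx.1.pullU
  have hX := parMap_xVF (U := U) hx
  have hb : Par (!i) (pullU U (par x.2)) :=
    by rw [pullU_par]; simpa using Par.map (i := false) (f := par) (fun v => by simp) hx.2.pullU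
  set a := pullU U x.1 with haa
  set b := pullU U (par x.2) with hbb
  have hA : fA U ∘ₗ lins (xVF U x) = poisson a ∘ₗ fA U + const (-b) := by
    ext1 w
    simp only [LinearMap.comp_apply, fA, lin_lins hX, xVF_apply, map_sub, map_smul, pA_actL, pA_iA,
      LinearMap.add_apply, const_apply, smul_neg]
    rw [sub_eq_add_neg]
  have hB : fB U ∘ₗ lins (xVF U x) = poisson (parPow (!pty m) a) ∘ₗ fB U := by
    ext1 w
    simp only [LinearMap.comp_apply, fB, lin_lins hX, xVF_apply, map_sub, map_smul, pB_actL, pB_iA,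
      smul_zero, sub_zero]
    rfl
  have hx2 : pullU U x.2 = -(sg i • b) := by
    rw [hbb, hx.2, map_smul, smul_smul]; cases i <;> simp
  have hnb : Par (!i) (-b) := by rw [Par, map_neg, hb, smul_neg]
  -- Inserting the constant into either slot of {A, A} gives the same result, which compensates the
  -- factor ½.
  have swap : poisson (fA U (parPow (!i) w)) (-b) = -(sg i • poisson b (fA U w)) := by
    have h1 := parMap_fA.parPow (!i) w
    have h2 : fA U (parPow (!i) w) = sg (!i) • parPow (!i) (fA U w) := by
      rw [h1, smul_smul, Bool.true_and, sg_mul_self, one_smul]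
    rw [h2, poisson_comm hnb, map_smul, parPow_parPow]
    cases i <;> simp
  simp only [LinearMap.sub_apply, LinearMap.smul_apply, LinearMap.comp_apply]
  refine fields_ext ?_ ?_
  · have hAw := DFunLike.congr_fun hA w
    have j := conv_jacobi parMap_fA ha (parMap_fA (U := U)) w
    have hc := conv_lins poisson (fA U) (parMap_fA (U := U)) hX w
    rw [hA, conv_add_left, conv_add_right, LinearMap.add_apply, LinearMap.add_apply,
      conv_const_left poisson _ parMap_fA, conv_const_right poisson _ hnb, swap] at hc
    have hd := dForm_poisson a (fA U w)
    rw [ha, map_smul, LinearMap.smul_apply] at hd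
    have hdb : pullU U (par (-dForm x.2)) = dForm b := by
      have e : par (-dForm x.2) = dForm (par x.2) := by rw [map_neg, parMap_dForm]; simp
      rw [e, pullU_dForm]
    simp only [LinearMap.comp_apply, LinearMap.add_apply, const_apply] at hAw
    have ej : conv poisson (poisson a ∘ₗ fA U) (fA U) w
        = poisson a (conv poisson (fA U) (fA U) w)
          - sg i • conv poisson (fA U) (poisson a ∘ₗ fA U) w := eq_sub_of_add_eq j
    simp only [sVF, LinearMap.add_apply, LinearMap.smul_apply, LinearMap.comp_apply, map_add,
      map_sub, map_smul, pA_iA, pA_iB, xVF_apply, pA_actL, dRDiff, hdb, hx2, hAw, hd, hc, ej,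
      pullU_dForm]
    rw [← haa]
    simp only [map_neg, map_smul, LinearMap.neg_apply, LinearMap.smul_apply, map_zero,
      show pA (lin w) = fA U w from rfl]
    cases i <;> simp only [sg_true, sg_false, Bool.and_true, Bool.true_and] <;> module
  · have hAw := DFunLike.congr_fun hB w
    have j := conv_jacobi parMap_fA ha (parMap_fB (U := U)) w
    have hc := conv_lins poisson (fA U) (parMap_fB (U := U)) hX w
    rw [hA, hB, conv_add_left, LinearMap.add_apply,
      conv_const_left poisson _ parMap_fB] at hc
    have hd := dForm_poisson a (fB U w)
    rw [ha, map_smul, LinearMap.smul_apply] at hd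
    simp only [LinearMap.comp_apply, ha.parPow, map_smul, LinearMap.smul_apply,
      LinearMap.smul_comp, conv_smul_right] at hAw hc
    have ej : conv poisson (poisson a ∘ₗ fA U) (fB U) w
        = poisson a (conv poisson (fA U) (fB U) w)
          - sg i • conv poisson (fA U) (poisson a ∘ₗ fB U) w := eq_sub_of_add_eq j
    have hda : Par (!i) (dForm a) := by simpa using ha.map parMap_dForm
    simp only [sVF, LinearMap.add_apply, LinearMap.smul_apply, LinearMap.comp_apply, map_add,
      map_sub, map_smul, pB_iA, pB_iB, xVF_apply, pB_actL, dRDiff, hx2, hAw, hd, hc, ej,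
      pullU_dForm]
    rw [← haa]
    simp only [map_neg, map_smul, LinearMap.neg_apply, LinearMap.smul_apply,
      show pB (lin w) = fB U w from rfl, hda.parPow, hb.parPow, ha.parPow, map_zero, smul_zero,
      sub_zero, zero_add]
    cases i <;> cases pty m <;> simp <;> module

end VectorFields

open GSym

/-! ## Degrees -/

section Grading

variable {W : Type} [AddCommGroup W] [Module ℂ W] [SuperSpace W]

namespace GSym

theorem mon_zero (φ : Fin 0 → W) : mon φ = 1 := by simp [mon]

theorem mon_succ {k : ℕ} (φ : Fin (k + 1) → W) :
    mon φ = ι (φ 0) * mon (fun i => φ i.succ) := by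
  simp [mon, List.ofFn_succ]

/-- The span of the monomials of total degree `e`. -/
def grade (𝒱 : ℤ → Submodule ℂ W) (e : ℤ) : Submodule ℂ (GSym W) :=
  Submodule.span ℂ {w | ∃ (k : ℕ) (φ : Fin k → W) (d : Fin k → ℤ),
    (∀ i, φ i ∈ 𝒱 (d i)) ∧ ∑ i, d i = e ∧ w = mon φ}

theorem hasDegree_iff {𝒱 : ℤ → Submodule ℂ W} {F : Module.Dual ℂ (GSym W)} {d : ℤ} :
    HasDegree 𝒱 F d ↔ ∀ e, e ≠ -d → ∀ w ∈ grade 𝒱 e, F w = 0 := by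
  constructor
  · intro h e he w hw
    induction hw using Submodule.span_induction with
    | mem w hw =>
      obtain ⟨k, φ, c, hφ, rfl, rfl⟩ := hw
      exact h k φ c hφ he
    | zero => exact map_zero F
    | add x y _ _ hx hy => rw [map_add, hx, hy, add_zero]
    | smul a x _ hx => rw [map_smul, hx, smul_zero]
  · intro h k φ e hφ he
    exact h _ he _ (Submodule.subset_span ⟨k, φ, e, hφ, rfl, rfl⟩)

theorem one_mem_grade (𝒱 : ℤ → Submodule ℂ W) : (1 : GSym W) ∈ grade 𝒱 0 :=
  Submodule.subset_span ⟨0, Fin.elim0, Fin.elim0, fun i => i.elim0, rfl, (mon_zero _).symm⟩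

theorem ι_mul_mem_grade {𝒱 : ℤ → Submodule ℂ W} {c e : ℤ} {v : W} (hv : v ∈ 𝒱 c) {w : GSym W}
    (hw : w ∈ grade 𝒱 e) : ι v * w ∈ grade 𝒱 (c + e) := by
  induction hw using Submodule.span_induction with
  | mem w hw =>
    obtain ⟨k, φ, d, hφ, rfl, rfl⟩ := hw
    refine Submodule.subset_span ⟨k + 1, Fin.cons v φ, Fin.cons c d, ?_, ?_, ?_⟩
    · intro i
      refine Fin.cases ?_ (fun i => ?_) i
      · simpa using hv
      · simpa using hφ i
    · rw [Fin.sum_univ_succ]; simp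
    · rw [mon_succ]; simp
  | zero => simp
  | add x y _ _ hx hy => rw [mul_add]; exact Submodule.add_mem _ hx hy
  | smul a x _ hx => rw [mul_smul_comm]; exact Submodule.smul_mem _ _ hx

theorem grade_induction {𝒱 : ℤ → Submodule ℂ W} {P : ℤ → GSym W → Prop} (one : P 0 1)
    (mul : ∀ c e v w, v ∈ 𝒱 c → w ∈ grade 𝒱 e → P e w → P (c + e) (ι v * w))
    (zero : ∀ e, P e 0)
    (add : ∀ e w w', P e w → P e w' → P e (w + w')) (smul : ∀ e (a : ℂ) w, P e w → P e (a • w))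
    {e : ℤ} {w : GSym W} (hw : w ∈ grade 𝒱 e) : P e w := by
  induction hw using Submodule.span_induction with
  | mem w hw =>
    obtain ⟨k, φ, d, hφ, rfl, rfl⟩ := hw
    induction k with
    | zero => simpa [mon_zero] using one
    | succ k ih =>
      rw [mon_succ, Fin.sum_univ_succ]
      exact mul _ _ _ _ (hφ 0)
        (Submodule.subset_span ⟨k, _, _, fun i => hφ i.succ, rfl, rfl⟩)
        (ih (fun i => φ i.succ) (fun i => d i.succ) fun i => hφ i.succ)
  | zero => exact zero e
  | add x y _ _ hx hy => exact add _ _ _ hx hy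
  | smul a x _ hx => exact smul _ _ _ hx

theorem par_of_mem_grade {𝒱 : ℤ → Submodule ℂ W} (h𝒱 : ∀ d, ∀ v ∈ 𝒱 d, Par (pty d) v) {e : ℤ}
    {w : GSym W} (hw : w ∈ grade 𝒱 e) : Par (pty e) w := by
  refine grade_induction (P := fun e w => Par (pty e) w) ?_ ?_ ?_ ?_ ?_ hw
  · simp [Par, pty, par_one]
  · intro c e v w hv _ hw
    rw [Par, par_mul, par_ι, h𝒱 c v hv, hw, pty_add, map_smul, smul_mul_smul_comm]
    cases pty c <;> cases pty e <;> simp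
  · intro e; simp [Par]
  · intro e w w' h h'; rw [Par, map_add, h, h', smul_add]
  · intro e a w h; rw [Par, map_smul, h, smul_comm]

/-- A vector field with components of symmetric degree `0` and `1` only, both of degree `j`,
shifts degrees by `j`. -/
theorem rins_mem_grade {𝒱 : ℤ → Submodule ℂ W} (h𝒱 : ∀ d, ∀ v ∈ 𝒱 d, Par (pty d) v) {j : ℤ}
    {i : Bool} {f : W →ₗ[ℂ] W} {u : W} (hf : ParMap i f) (hu : Par i u)
    (hf' : ∀ d, ∀ v ∈ 𝒱 d, f v ∈ 𝒱 (d + j)) (hu' : u ∈ 𝒱 j) {e : ℤ} {w : GSym W}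
    (hw : w ∈ grade 𝒱 e) : rins (f ∘ₗ lin + const u) w ∈ grade 𝒱 (e + j) := by
  have hfl : ParMap i (f ∘ₗ lin) := by simpa using hf.comp (parMap_lin (V := W))
  rw [rins_eq_lins (hfl.add (parMap_const hu)), (par_of_mem_grade h𝒱 hw).parPow, map_smul]
  refine Submodule.smul_mem _ _ ?_
  rw [lins_add, LinearMap.add_apply, lins_const]
  refine Submodule.add_mem _ ?_ ?_
  · refine grade_induction (P := fun e w => lins (f ∘ₗ lin) w ∈ grade 𝒱 (e + j))
      ?_ ?_ ?_ ?_ ?_ hw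
    · simp [lins_one]
    · intro c e v w hv hw h
      rw [lins_ι_mul hfl, cut_lin, lins_const, (h𝒱 c v hv).parPow, map_smul, smul_mul_assoc]
      refine Submodule.add_mem _ ?_ (Submodule.smul_mem _ _ ?_)
      · rw [add_right_comm]
        exact ι_mul_mem_grade (hf' c v hv) hw
      · rw [add_assoc]
        exact ι_mul_mem_grade hv h
    · simp
    · intro e w w' h h'; rw [map_add]; exact Submodule.add_mem _ h h'
    · intro e a w h; rw [map_smul]; exact Submodule.smul_mem _ _ h
  · rw [add_comm]
    exact ι_mul_mem_grade hu' hw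

/-- The factorization-algebra axioms speak of integer degrees, while the convolution lemmas need
parities. Words of homogeneous letters span, and `F` is nonzero only on those of degree `-d`, whose
parity is that of `d`. -/
theorem parMap_of_hasDegree {𝒱 : ℤ → Submodule ℂ W} (h𝒱 : ∀ d, ∀ v ∈ 𝒱 d, Par (pty d) v)
    (htop : ⨆ d, 𝒱 d = ⊤) {F : Module.Dual ℂ (GSym W)} {d : ℤ} (hF : HasDegree 𝒱 F d) :
    ParMap (pty d) F := by
  have hspan : ∀ w : GSym W, w ∈ ⨆ e, grade 𝒱 e := by
    intro w
    have hS : Submodule.span ℂ (⋃ d, (𝒱 d : Set W)) = ⊤ := by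
      rw [Submodule.span_iUnion]; simpa using htop
    induction w using span_induction hS with
    | one => exact Submodule.mem_iSup_of_mem 0 (one_mem_grade 𝒱)
    | mul v hv w hw =>
      obtain ⟨c, hc⟩ := Set.mem_iUnion.1 hv
      induction hw using Submodule.iSup_induction' with
      | mem e w hw => exact Submodule.mem_iSup_of_mem _ (ι_mul_mem_grade hc hw)
      | zero => simp
      | add x y _ _ hx hy => rw [mul_add]; exact Submodule.add_mem _ hx hy
    | add w w' hw hw' => exact Submodule.add_mem _ hw hw'
    | smul a w hw => exact Submodule.smul_mem _ _ hw
  rw [hasDegree_iff] at hF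
  intro w
  change F w = _
  have hw := hspan w
  induction hw using Submodule.iSup_induction' with
  | mem e w hw =>
    have hp := par_of_mem_grade h𝒱 hw
    by_cases he : e = -d
    · subst he
      have : pty (-d) = pty d := by simp [pty]
      rw [hp, map_smul, this, smul_smul, sg_mul_self, one_smul]
    · rw [hp, map_smul, hF e he w hw]; simp
  | zero => simp
  | add x y _ _ hx hy => rw [map_add, map_add, hx, hy, map_add, smul_add]

end GSym

end Grading

/-! ### The grading of the fields, and derivations of the observables -/

section Derivations

variable {n m : ℕ} {U V : Opens (Spacetime n m)}

theorem par_of_mem_fieldsDeg (d : ℤ) (φ : Fields n m U) (h : φ ∈ fieldsDeg U d) :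
    Par (pty d) φ := by
  have h1 : Par (pty (d + 1)) (pA φ) := par_of_mem_formsDeg h.1
  have h2 : Par (pty (d + (2 * n + m - 2))) (pB φ) := par_of_mem_formsDeg h.2
  refine fields_ext ?_ ?_
  · rw [pA_par, h1, map_smul, pty_add, show pty 1 = true by simp [pty]]
    cases pty d <;> simp
  · have e : pty (2 * n + m - 2) = pty m := by
      have : (2 * n + m - 2 : ℤ) = (2 * (n - 1) : ℤ) + m := by ring
      have h0 : pty (2 * (n - 1 : ℤ)) = false := by
        simp [pty]
      rw [this, pty_add, h0, Bool.false_xor]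
    rw [pB_par, h2, map_smul, pty_add, e, smul_smul]
    cases pty d <;> cases pty m <;> simp

theorem iSup_formsDeg : ⨆ p, formsDeg U p = ⊤ := by
  refine Submodule.eq_top_iff'.2 fun a => ?_
  induction a using forms_induction with
  | pt f l =>
    have hl : l ∈ ⨆ k : ℕ, ⋀[ℂ]^k (Fin (n + n + m) → ℂ) := by
      rw [(DirectSum.Decomposition.isInternal
        (fun k : ℕ => ⋀[ℂ]^k (Fin (n + n + m) → ℂ))).submodule_iSup_eq_top]
      trivial
    induction hl using Submodule.iSup_induction' with
    | mem k l hl => exact Submodule.mem_iSup_of_mem _ (pt_mem_formsDeg hl)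
    | zero => rw [pt, TensorProduct.tmul_zero]; exact Submodule.zero_mem _
    | add x y _ _ hx hy => rw [pt_add_right]; exact Submodule.add_mem _ hx hy
  | add a b ha hb => exact Submodule.add_mem _ ha hb

theorem iSup_fieldsDeg : ⨆ d, fieldsDeg U d = ⊤ := by
  refine eq_top_iff.2 fun φ _ => ?_
  have key : ∀ a : Forms n m U, iA a ∈ ⨆ d, fieldsDeg U d ∧ iB a ∈ ⨆ d, fieldsDeg U d := by
    intro a
    have ha : a ∈ ⨆ p, formsDeg U p := iSup_formsDeg ▸ trivial
    induction ha using Submodule.iSup_induction' with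
    | mem p a ha =>
      refine ⟨Submodule.mem_iSup_of_mem (p - 1) ⟨?_, Submodule.zero_mem _⟩,
        Submodule.mem_iSup_of_mem (p - (2 * n + m - 2)) ⟨Submodule.zero_mem _, ?_⟩⟩
      · change a ∈ formsDeg U _
        rwa [sub_add_cancel]
      · change a ∈ formsDeg U _
        rwa [sub_add_cancel]
    | zero => simp
    | add x y _ _ hx hy =>
      simp only [map_add]
      exact ⟨Submodule.add_mem _ hx.1 hy.1, Submodule.add_mem _ hx.2 hy.2⟩
  have : φ = iA (pA φ) + iB (pB φ) := fields_ext (by simp) (by simp)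
  rw [this]
  exact Submodule.add_mem _ (key _).1 (key _).2

theorem pullU_mem_formsDeg {p : ℤ} {a : L n} (ha : a ∈ formsDeg ⊤ p) :
    pullU U a ∈ formsDeg U p :=
  res_mem_formsDeg _ (pull_mem_formsDeg ha)

theorem rins_xVF_mem_grade {j e : ℤ} {x : LdR n} (hx : x ∈ dRDeg n j) {w : GSym (Fields n m U)}
    (hw : w ∈ grade (fieldsDeg U) e) : rins (xVF U x) w ∈ grade (fieldsDeg U) (e + j) := by
  have hp := parX_of_mem hx
  rw [xVF_eq]
  have ha : pullU U x.1 ∈ formsDeg U j := pullU_mem_formsDeg hx.1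
  have hb : -iA (pullU U (par x.2)) ∈ fieldsDeg U j :=
    Submodule.neg_mem _ ⟨pullU_mem_formsDeg (parPow_mem_formsDeg hx.2 true), Submodule.zero_mem _⟩
  refine rins_mem_grade par_of_mem_fieldsDeg (parMap_actL hp.1.pullU)
    (par_of_mem_fieldsDeg j _ hb) ?_ hb hw
  intro d φ hφ
  refine ⟨?_, ?_⟩
  · have : pA (actL (pullU U x.1) φ) ∈ formsDeg U (j + (d + 1)) := by
      rw [pA_actL]; exact poisson_mem_formsDeg ha hφ.1
    rw [show d + j + 1 = j + (d + 1) by ring]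
    exact this
  · have : pB (actL (pullU U x.1) φ) ∈ formsDeg U (j + (d + (2 * n + m - 2))) := by
      rw [pB_actL]; exact poisson_mem_formsDeg (parPow_mem_formsDeg ha _) hφ.2
    rw [show d + j + (2 * n + m - 2 : ℤ) = j + (d + (2 * n + m - 2)) by ring]
    exact this

/-! ## Naturality -/

theorem pA_resFields (h : V ≤ U) (φ : Fields n m U) : pA (resFields h φ) = res h (pA φ) := rfl

theorem pB_resFields (h : V ≤ U) (φ : Fields n m U) : pB (resFields h φ) = res h (pB φ) := rfl

/-- Both claims are proved together, since the linear part of `ι v * w` involves the augmentation of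
`w`. -/
theorem low_resSym (h : V ≤ U) (w : GSym (Fields n m U)) :
    aug (resSym h w) = aug w ∧ lin (resSym h w) = resFields h (lin w) := by
  induction w using GSym.induction with
  | one => simp
  | mul v w hw => simp [resSym, ← hw.1]
  | add w w' hw hw' => simp only [map_add, hw.1, hw'.1, hw.2, hw'.2, and_self]
  | smul a w hw => simp only [map_smul, hw.1, hw.2, and_self]

theorem res_parPow (h : V ≤ U) (c : Bool) (a : Forms n m U) :
    res h (parPow c a) = parPow c (res h a) := by
  cases c <;> simp [res_par]

theorem xVF_natural (h : V ≤ U) (x : LdR n) (w : GSym (Fields n m U)) :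
    resFields h (xVF U x w) = xVF V x (resSym h w) := by
  rw [xVF_apply, xVF_apply, (low_resSym h w).1, (low_resSym h w).2]
  refine fields_ext ?_ ?_
  · simp only [map_sub, map_smul, pA_resFields, pA_actL, res_poisson, res_pullU, pA_iA]
  · simp only [map_sub, map_smul, pB_resFields, pB_actL, res_poisson, res_pullU, pB_iA,
      res_parPow, map_zero]

theorem conv_poisson_natural (h : V ≤ U) {γ : Bool}
    {f g : ∀ U : Opens (Spacetime n m), GSym (Fields n m U) →ₗ[ℂ] Forms n m U}
    (hf : ∀ w, res h (f U w) = f V (resSym h w)) (hg : ∀ w, res h (g U w) = g V (resSym h w))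
    (hγ : ∀ U, ParMap γ (g U)) (w : GSym (Fields n m U)) :
    res h (conv poisson (f U) (g U) w) = conv poisson (f V) (g V) (resSym h w) := by
  have h1 : f V ∘ₗ (resSym h).toLinearMap = (res h).toLinearMap ∘ₗ f U :=
    LinearMap.ext fun w => (hf w).symm
  have h2 : g V ∘ₗ (resSym h).toLinearMap = (res h).toLinearMap ∘ₗ g U :=
    LinearMap.ext fun w => (hg w).symm
  have hr : ParMap false ((res h).toLinearMap : Forms n m U →ₗ[ℂ] Forms n m V) := fun a => by
    simp [res_par]
  have e := conv_map poisson (resFields h) (resFields_par h) (f V) (hγ V) w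
  change conv poisson (f V) (g V) (resSym h w)
    = conv poisson (f V ∘ₗ (resSym h).toLinearMap) (g V ∘ₗ (resSym h).toLinearMap) w at e
  have hg' : ParMap γ ((res h).toLinearMap ∘ₗ g U) := by simpa using hr.comp (hγ U)
  rw [e, h1, h2, conv_apply _ _ (hγ U), conv_apply _ _ hg']
  induction comul w using TensorProduct.induction_on with
  | zero => simp
  | tmul x y => simp [res_poisson]
  | add a b ha hb => simp only [map_add, ha, hb]

theorem fA_natural (h : V ≤ U) (w : GSym (Fields n m U)) : res h (fA U w) = fA V (resSym h w) := by
  simp only [fA, LinearMap.comp_apply, (low_resSym h w).2, pA_resFields]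

theorem fB_natural (h : V ≤ U) (w : GSym (Fields n m U)) : res h (fB U w) = fB V (resSym h w) := by
  simp only [fB, LinearMap.comp_apply, (low_resSym h w).2, pB_resFields]

theorem sVF_natural (h : V ≤ U) (w : GSym (Fields n m U)) :
    resFields h (sVF U w) = sVF V (resSym h w) := by
  have hA := conv_poisson_natural h (fA_natural h) (fA_natural h) (fun _ => parMap_fA) w
  have hB := conv_poisson_natural h (fA_natural h) (fB_natural h) (fun _ => parMap_fB) w
  refine fields_ext ?_ ?_
  · simp only [sVF, LinearMap.add_apply, LinearMap.smul_apply, LinearMap.comp_apply, map_add,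
      map_smul, pA_resFields, pA_iA, pA_iB, res_dForm, hA, fA_natural, map_zero]
  · simp only [sVF, LinearMap.add_apply, LinearMap.smul_apply, LinearMap.comp_apply, map_add,
      map_smul, pB_resFields, pB_iA, pB_iB, res_dForm, hB, fB_natural, map_zero, smul_zero]

/-- The Hamiltonian vector field of `Φ(x)`, on all open sets. -/
def xLVF (m : ℕ) (x : LdR n) : LocalVF n m := ⟨fun U => xVF U x, fun _ _ h w => xVF_natural h x w⟩

/-- The Hamiltonian vector field of the action functional, on all open sets. -/
def sLVF (n m : ℕ) : LocalVF n m := ⟨sVF, fun _ _ h w => sVF_natural h w⟩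

theorem extObs_comp_rins (h : U ≤ V) (x : LdR n) (F : Module.Dual ℂ (GSym (Fields n m U))) :
    extObs h F ∘ₗ rins (xVF V x) = extObs h (F ∘ₗ rins (xVF U x)) := by
  ext1 w
  change F (resSym h (rins (xVF V x) w)) = F (rins (xVF U x) (resSym h w))
  exact congrArg F (rins_map (resFields_par h) (xVF_natural h x) w)

theorem parMap_extObs (h : U ≤ V) {c : Bool} {F : Module.Dual ℂ (GSym (Fields n m U))}
    (hF : ParMap c F) : ParMap c (extObs h F) := fun w => by
  have e : resSym h (par w) = par (resSym h w) := by
    have : (resSym h).comp parHom = parHom.comp (resSym h) :=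
      hom_ext fun v => by simp [resSym, resFields_par]
    exact DFunLike.congr_fun this w
  have := hF (resSym h w)
  rw [← e] at this
  exact this

/-- Operators on observables given by the vector fields of `(L_n)_{dR}` are derivations. -/
theorem isDerivation_of_eq {T : ObsOp n m} {j : ℤ} {x : LdR n} (hx : x ∈ dRDeg n j)
    (hT : ∀ U (O : Obs U), (T U O).1 = -(O.1 ∘ₗ rins (xVF U x))) : IsDerivation T j where
  degree U O d hO := by
    rw [hasDegree_iff] at hO ⊢
    intro e he w hw
    rw [hT, LinearMap.neg_apply, LinearMap.comp_apply,
      hO (e + j) (by intro h; apply he; linarith) _ (rins_xVF_mem_grade hx hw), neg_zero]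
  unit U O hO := by
    refine Subtype.ext ?_
    rw [hT, hO]
    ext1 w
    simp [aug_rins]
  ext U V h O O' hO := by
    rw [hT, hT, hO, extObs_comp_rins, map_neg]
  leibniz U₁ U₂ V h₁ h₂ _ O₁ O₂ O d hd hO := by
    have hp := parMap_extObs h₁ (parMap_of_hasDegree par_of_mem_fieldsDeg iSup_fieldsDeg hd)
    have hX := parMap_xVF (U := V) (parX_of_mem hx)
    have hs : sg (pty j && pty d) = (-1 : ℂ) ^ (j * d) := by
      rw [← sg_pty]
      congr 1
      simp only [pty, Int.odd_mul, Bool.decide_and]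
    -- The Leibniz rule is applied over `V`; naturality of the vector field then moves each
    -- derivative inside the extension from `U₁` or `U₂`.
    rw [hT, hT, hT, hO, mulObs, conv_rins hp _ hX, hs, mulObs, mulObs, map_neg, map_neg,
      ← extObs_comp_rins, ← extObs_comp_rins, ← neg_one_smul ℂ (_ ∘ₗ _),
      ← neg_one_smul ℂ (extObs h₂ _ ∘ₗ _), conv_smul_left, conv_smul_right, neg_add, smul_comm]
    simp

end Derivations

open GSym

/-! ## Integration -/

section Integration

variable {n m : ℕ} {U V : Opens (Spacetime n m)}

theorem coeff_pt (l : Module.Dual ℂ (Lam n m)) (f : Smooth U) (k : Lam n m) :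
    coeff l (pt f k) = l k • f := by
  change (TensorProduct.rid ℂ (Smooth U)) (f ⊗ₜ l k) = _
  simp

theorem coeff_formOp (l : Module.Dual ℂ (Lam n m)) (D : Smooth U →ₗ[ℂ] Smooth U)
    (M : Lam n m →ₗ[ℂ] Lam n m) (a : Forms n m U) :
    coeff l (formOp D M a) = D (coeff (l ∘ₗ M) a) := by
  induction a using forms_induction with
  | pt f k => rw [formOp_pt, coeff_pt, coeff_pt, map_smul, LinearMap.comp_apply]
  | add a b ha hb => simp only [map_add, ha, hb]

/-- Compatibility with restriction is all that preservation of supports requires: where the form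
restricts to zero, so does its image. -/
theorem formOp_mem_FormsC {D : Smooth (⊤ : Opens (Spacetime n m)) →ₗ[ℂ] Smooth ⊤}
    (hD : ∀ V : Opens (Spacetime n m), ∃ D' : Smooth V →ₗ[ℂ] Smooth V,
      ∀ f, resFun (le_top : V ≤ ⊤) (D f) = D' (resFun le_top f))
    (M : Lam n m →ₗ[ℂ] Lam n m) {a : Forms n m ⊤} (ha : a ∈ FormsC n m) :
    formOp D M a ∈ FormsC n m := by
  obtain ⟨K, hK, h⟩ := ha
  refine ⟨K, hK, fun V hV => ?_⟩
  obtain ⟨D', hD'⟩ := hD V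
  have e : res (le_top : V ≤ ⊤) (formOp D M a) = formOp D' M (res le_top a) := by
    clear h
    induction a using forms_induction with
    | pt f k => rw [formOp_pt, res_pt, res_pt, formOp_pt, hD']
    | add a b ha hb => simp only [map_add, ha, hb]
  rw [e, h V hV, map_zero]

theorem isAddHaar_spacetime :
    (MeasureTheory.volume : MeasureTheory.Measure (Spacetime n m)).IsAddHaarMeasure := by
  have h1 : (MeasureTheory.volume : MeasureTheory.Measure (Fin n → ℂ)).IsAddHaarMeasure :=
    inferInstance
  have h2 : (MeasureTheory.volume : MeasureTheory.Measure (Fin m → ℝ)).IsAddHaarMeasure :=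
    inferInstance
  have h3 : (MeasureTheory.volume :
      MeasureTheory.Measure ((Fin n → ℂ) × (Fin m → ℝ))).IsAddHaarMeasure :=
    MeasureTheory.Measure.prod.instIsAddHaarMeasure _ _
  exact MeasureTheory.Measure.prod.instIsAddHaarMeasure _ _

theorem integral_dirDeriv (v : Spacetime n m) (l : Module.Dual ℂ (Lam n m)) {a : Forms n m ⊤}
    (ha : a ∈ FormsC n m) :
    ∫ x : Spacetime n m, (dirDeriv v (coeff l a)).1 ⟨x, trivial⟩ = 0 := by
  have hmem : formOp (dirDeriv v) LinearMap.id a ∈ FormsC n m :=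
    formOp_mem_FormsC (fun V => ⟨dirDeriv v, fun f => resFun_dirDeriv _ v f⟩) _ ha
  have h1 := integrable_of_FormsC ha l
  have h2 := integrable_of_FormsC hmem l
  rw [coeff_formOp, LinearMap.comp_id] at h2
  set g := coeff l a with hg
  have e : ∀ x, extendZero g.1 x = g.1 ⟨x, trivial⟩ := fun x =>
    extendZero_apply g.1 (⟨x, trivial⟩ : (⊤ : Opens (Spacetime n m)))
  have hd : ∀ x, (dirDeriv v g).1 ⟨x, trivial⟩ = fderiv ℝ (extendZero g.1) x v := fun x => rfl
  simp only [hd] at h2 ⊢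
  have := isAddHaar_spacetime (n := n) (m := m)
  -- Integration by parts against the constant function 1, whose derivative vanishes.
  have key := integral_mul_fderiv_eq_neg_fderiv_mul_of_integrable
    (f := fun _ : Spacetime n m => (1 : ℂ)) (g := extendZero g.1) (v := v)
    (μ := MeasureTheory.volume) (by simp) (by simpa using h2) (by simpa [e] using h1)
    (fun x _ => differentiableAt_const _) (fun x _ => differentiableAt_smooth g ⟨x, trivial⟩)
  simpa using key

theorem formOp_zero_left (M : Lam n m →ₗ[ℂ] Lam n m) (a : Forms n m U) :
    formOp (0 : Smooth U →ₗ[ℂ] Smooth U) M a = 0 := by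
  induction a using forms_induction with
  | pt f k => rw [formOp_pt, LinearMap.zero_apply, pt_zero_left]
  | add a b ha hb => rw [map_add, ha, hb, add_zero]

theorem formOp_add_left (D E : Smooth U →ₗ[ℂ] Smooth U) (M : Lam n m →ₗ[ℂ] Lam n m)
    (a : Forms n m U) : formOp (D + E) M a = formOp D M a + formOp E M a := by
  induction a using forms_induction with
  | pt f k => simp only [formOp_pt, LinearMap.add_apply, pt_add_left]
  | add a b ha hb => simp only [map_add, ha, hb]; abel

theorem formOp_smul_left (c : ℂ) (D : Smooth U →ₗ[ℂ] Smooth U) (M : Lam n m →ₗ[ℂ] Lam n m)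
    (a : Forms n m U) : formOp (c • D) M a = c • formOp D M a := by
  induction a using forms_induction with
  | pt f k => simp only [formOp_pt, LinearMap.smul_apply, pt_smul_left]
  | add a b ha hb => simp only [map_add, ha, hb, smul_add]

/-- Membership and vanishing are carried through the induction together, since additivity of the
integral is available on `FormsC`. -/
theorem integral_formOp {D : Smooth (⊤ : Opens (Spacetime n m)) →ₗ[ℂ] Smooth ⊤} (hD : D ∈ vecs ⊤)
    (M : Lam n m →ₗ[ℂ] Lam n m) {a : Forms n m ⊤} (ha : a ∈ FormsC n m) :
    ∃ h : formOp D M a ∈ FormsC n m, integralC ⟨_, h⟩ = 0 := by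
  induction hD using Submodule.span_induction with
  | mem D hD =>
    obtain ⟨v, rfl⟩ := hD
    refine ⟨formOp_mem_FormsC (fun V => ⟨dirDeriv v, fun f => resFun_dirDeriv _ v f⟩) _ ha, ?_⟩
    change integral _ = 0
    rw [integral, coeff_formOp, integral_dirDeriv v _ ha, mul_zero]
  | zero =>
    rw [formOp_zero_left]
    exact ⟨Submodule.zero_mem _, map_zero integralC⟩
  | add D E _ _ hD hE =>
    obtain ⟨h, hi⟩ := hD
    obtain ⟨h', hi'⟩ := hE
    rw [formOp_add_left]
    refine ⟨Submodule.add_mem _ h h', ?_⟩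
    have := map_add integralC ⟨_, h⟩ ⟨_, h'⟩
    rw [hi, hi', add_zero] at this
    exact this
  | smul c D _ hD =>
    obtain ⟨h, hi⟩ := hD
    rw [formOp_smul_left]
    refine ⟨Submodule.smul_mem _ c h, ?_⟩
    have := map_smul integralC c ⟨_, h⟩
    rw [hi, smul_zero] at this
    exact this

theorem topLam_eq_zero {k : ℕ} (hk : k ≠ n + n + m) {l : Lam n m}
    (hl : l ∈ ⋀[ℂ]^k (Fin (n + n + m) → ℂ)) : topLam l = 0 := by
  rw [← ExteriorAlgebra.ιMulti_span_fixedDegree] at hl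
  induction hl using Submodule.span_induction with
  | mem l hl =>
    obtain ⟨v, rfl⟩ := hl
    rw [topLam, ExteriorAlgebra.liftAlternating_apply_ιMulti, Function.update_of_ne hk]
    rfl
  | zero => exact map_zero _
  | add x y _ _ hx hy => rw [map_add, hx, hy, add_zero]
  | smul c x _ hx => rw [map_smul, hx, smul_zero]

theorem pty_dim : pty ((n + n + m : ℕ) : ℤ) = pty m := by
  rw [Nat.cast_add, Nat.cast_add, pty_add, pty_add]
  simp

/-- Only the exterior power of degree 2n + m contributes, and its parity is that of m. -/
theorem topLam_par (l : Lam n m) : topLam (par l) = sg (pty m) • topLam l := by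
  have hl : l ∈ ⨆ k : ℕ, ⋀[ℂ]^k (Fin (n + n + m) → ℂ) := by
    rw [(DirectSum.Decomposition.isInternal
      (fun k : ℕ => ⋀[ℂ]^k (Fin (n + n + m) → ℂ))).submodule_iSup_eq_top]
    trivial
  induction hl using Submodule.iSup_induction' with
  | mem k l hl =>
    have hp : Par (pty k) l := par_of_mem_exteriorPower hl
    by_cases hk : k = n + n + m
    · subst hk
      rw [hp, map_smul, pty_dim]
    · rw [hp, map_smul, topLam_eq_zero hk hl, smul_zero, smul_zero]
  | zero => simp
  | add x y _ _ hx hy => rw [map_add, map_add, hx, hy, map_add, smul_add]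

theorem coeff_par (l : Module.Dual ℂ (Lam n m)) (a : Forms n m U) :
    coeff l (par a) = coeff (l ∘ₗ par) a := coeff_formOp l LinearMap.id _ a

theorem coeff_topLam_par (a : Forms n m U) :
    coeff topLam (par a) = sg (pty m) • coeff topLam a := by
  induction a using forms_induction with
  | pt f l => rw [par_pt, coeff_pt, coeff_pt, topLam_par, smul_assoc]
  | add a b ha hb => simp only [map_add, ha, hb, smul_add]

theorem integral_par (a : Forms n m ⊤) : integral (par a) = sg (pty m) * integral a := by
  rw [integral, integral, coeff_topLam_par, mul_left_comm (sg _)]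
  congr 1
  exact MeasureTheory.integral_const_mul (sg (pty m)) _

theorem integral_of_mem_formsDeg {p : ℤ} (hp : p ≠ 2 * n + m) {a : Forms n m ⊤}
    (ha : a ∈ formsDeg ⊤ p) : integral a = 0 := by
  have h : coeff topLam a = 0 := by
    induction ha using Submodule.span_induction with
    | mem a ha =>
      obtain ⟨k, f, l, rfl, hl, rfl⟩ := ha
      have hk : k ≠ n + n + m := by
        rintro rfl
        apply hp
        push_cast
        ring
      have := coeff_pt topLam f l
      rw [topLam_eq_zero hk hl, zero_smul] at this
      exact this
    | zero => exact map_zero _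
    | add x y _ _ hx hy => rw [map_add, hx, hy, add_zero]
    | smul c x _ hx => rw [map_smul, hx, smul_zero]
  rw [integral, h]
  simp

/-- There is a linear extension of the integral to all forms, which is compatible with parity. -/
theorem exists_intExt : ∃ I : Forms n m ⊤ →ₗ[ℂ] ℂ, (∀ a ∈ FormsC n m, I a = integral a) ∧
    ∀ a, I (par a) = sg (pty m) * I a := by
  -- `integral` is known to be additive only on compactly supported forms. An algebraic extension
  -- makes the pairing of forms bilinear everywhere; wherever its value is compared with an
  -- integral, the form has compact support.
  obtain ⟨I, hI⟩ := LinearMap.exists_extend (integralC (n := n) (m := m))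
  have hI' : ∀ a ∈ FormsC n m, I a = integral a := fun a ha =>
    DFunLike.congr_fun hI (⟨a, ha⟩ : FormsC n m)
  -- Averaging with the parity twist makes the extension compatible with `par`. By `integral_par`
  -- nothing changes on compactly supported forms.
  refine ⟨(1 / 2 : ℂ) • (I + sg (pty m) • I ∘ₗ par), fun a ha => ?_, fun a => ?_⟩
  · simp only [LinearMap.smul_apply, LinearMap.add_apply, LinearMap.comp_apply, hI' a ha,
      hI' _ (par_mem_FormsC ha), integral_par, smul_eq_mul, ← mul_assoc, sg_mul_self]
    ring
  · simp only [LinearMap.smul_apply, LinearMap.add_apply, LinearMap.comp_apply, smul_eq_mul,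
      par_par]
    have := sg_mul_self (pty m)
    linear_combination (-(1 / 2) * I (par a)) * this

/-- A linear extension of the integral to all forms. -/
def intExt : Forms n m ⊤ →ₗ[ℂ] ℂ := exists_intExt.choose

theorem intExt_of_mem {a : Forms n m ⊤} (ha : a ∈ FormsC n m) : intExt a = integral a :=
  exists_intExt.choose_spec.1 a ha

theorem intExt_par (a : Forms n m ⊤) : intExt (par a) = sg (pty m) * intExt a :=
  exists_intExt.choose_spec.2 a

theorem intExt_formOp {D : Smooth (⊤ : Opens (Spacetime n m)) →ₗ[ℂ] Smooth ⊤} (hD : D ∈ vecs ⊤)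
    (M : Lam n m →ₗ[ℂ] Lam n m) {a : Forms n m ⊤} (ha : a ∈ FormsC n m) :
    intExt (formOp D M a) = 0 := by
  obtain ⟨h, hi⟩ := integral_formOp hD M ha
  rw [intExt_of_mem h]
  exact hi

theorem formOp_mem {D : Smooth (⊤ : Opens (Spacetime n m)) →ₗ[ℂ] Smooth ⊤} (hD : D ∈ vecs ⊤)
    (M : Lam n m →ₗ[ℂ] Lam n m) {a : Forms n m ⊤} (ha : a ∈ FormsC n m) :
    formOp D M a ∈ FormsC n m := (integral_formOp hD M ha).1

theorem formOp_mul {D : Smooth U →ₗ[ℂ] Smooth U} (hD : D ∈ vecs U) (a b : Forms n m U) :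
    formOp D LinearMap.id (a * b)
      = formOp D LinearMap.id a * b + a * formOp D LinearMap.id b := by
  induction a using forms_induction with
  | pt f l =>
    induction b using forms_induction with
    | pt g k => simp only [formOp_pt, pt_mul, vecs_mul hD, LinearMap.id_apply, pt_add_left]
    | add x y hx hy => simp only [map_add, mul_add, hx, hy]; abel
  | add x y hx hy => simp only [map_add, add_mul, hx, hy]; abel

theorem formOp_comm {D E : Smooth U →ₗ[ℂ] Smooth U} (hD : D ∈ vecs U) (hE : E ∈ vecs U)
    (a : Forms n m U) :
    formOp D LinearMap.id (formOp E LinearMap.id a)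
      = formOp E LinearMap.id (formOp D LinearMap.id a) := by
  induction a using forms_induction with
  | pt f l => simp only [formOp_pt, vecs_comm hD hE]
  | add x y hx hy => simp only [map_add, hx, hy]

theorem poisson_apply (a b : Forms n m U) :
    poisson a b = ∑ i : Fin n, (formOp (dZ i) LinearMap.id a * formOp (dW i) LinearMap.id b
      - formOp (dW i) LinearMap.id a * formOp (dZ i) LinearMap.id b) := by
  simp [poisson, wedge_apply]

theorem mul_mem_FormsC' {b : Forms n m ⊤} (hb : b ∈ FormsC n m) (a : Forms n m ⊤) :
    a * b ∈ FormsC n m := by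
  obtain ⟨K, hK, h⟩ := hb
  exact ⟨K, hK, fun V hV => by rw [map_mul, h V hV, mul_zero]⟩

theorem poisson_mem_FormsC {b : Forms n m ⊤} (hb : b ∈ FormsC n m) (a : Forms n m ⊤) :
    poisson a b ∈ FormsC n m := by
  rw [poisson_apply]
  exact Submodule.sum_mem _ fun i _ => Submodule.sub_mem _
    (mul_mem_FormsC' (formOp_mem (dW_mem i) _ hb) _)
    (mul_mem_FormsC' (formOp_mem (dZ_mem i) _ hb) _)

theorem dForm_mem_FormsC {b : Forms n m ⊤} (hb : b ∈ FormsC n m) : dForm b ∈ FormsC n m := by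
  obtain ⟨K, hK, h⟩ := hb
  exact ⟨K, hK, fun V hV => by rw [res_dForm, h V hV, map_zero]⟩

theorem parPow_mem_FormsC {b : Forms n m ⊤} (hb : b ∈ FormsC n m) (c : Bool) :
    parPow c b ∈ FormsC n m := by
  cases c
  · exact hb
  · exact par_mem_FormsC hb

/-- Integration by parts for the Poisson bracket. -/
theorem intExt_poisson {b : Forms n m ⊤} (hb : b ∈ FormsC n m) (a t : Forms n m ⊤) :
    intExt (poisson b a * t) = intExt (b * poisson a t) := by
  rw [← sub_eq_zero, ← map_sub, poisson_apply, poisson_apply, Finset.sum_mul, Finset.mul_sum,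
    ← Finset.sum_sub_distrib, map_sum]
  refine Finset.sum_eq_zero fun i _ => ?_
  set Z : Forms n m ⊤ →ₗ[ℂ] Forms n m ⊤ := formOp (dZ i) LinearMap.id
  set W : Forms n m ⊤ →ₗ[ℂ] Forms n m ⊤ := formOp (dW i) LinearMap.id
  have hZ : ∀ x y, Z (x * y) = Z x * y + x * Z y := formOp_mul (dZ_mem i)
  have hW : ∀ x y, W (x * y) = W x * y + x * W y := formOp_mul (dW_mem i)
  have hc : Z (W a) = W (Z a) := formOp_comm (dZ_mem i) (dW_mem i) a
  -- The difference of the two integrands is a sum of total derivatives of compactly supported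
  -- forms; the mixed second derivatives of `a` cancel.
  have e : (Z b * W a - W b * Z a) * t - b * (Z a * W t - W a * Z t)
      = Z (b * (W a * t)) - W (b * (Z a * t)) := by
    simp only [hZ, hW, hc, mul_add, sub_mul, mul_sub, mul_assoc]
    abel
  rw [e, map_sub, intExt_formOp (dZ_mem i) _ (mul_mem_FormsC hb _),
    intExt_formOp (dW_mem i) _ (mul_mem_FormsC hb _), sub_zero]

/-- Stokes' theorem. -/
theorem intExt_dForm {b : Forms n m ⊤} (hb : b ∈ FormsC n m) : intExt (dForm b) = 0 := by
  have key : ∀ T ∈ dOps (⊤ : Opens (Spacetime n m)), intExt (T b) = 0 := by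
    intro T hT
    induction hT using Submodule.span_induction with
    | mem T hT =>
      obtain ⟨D, hD, k, rfl⟩ := hT
      exact intExt_formOp hD _ hb
    | zero => simp
    | add S T _ _ hS hT => rw [LinearMap.add_apply, map_add, hS, hT, add_zero]
    | smul c T _ hT => rw [LinearMap.smul_apply, map_smul, hT, smul_zero]
  exact key _ dForm_mem

theorem intExt_dForm_mul {b : Forms n m ⊤} (hb : b ∈ FormsC n m) (t : Forms n m ⊤) :
    intExt (dForm b * t) = -intExt (par b * dForm t) := by
  have := intExt_dForm (mul_mem_FormsC hb t)
  rw [dForm_mul, map_add] at this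
  exact eq_neg_of_add_eq_zero_left this

end Integration

open GSym

/-! ### Symmetry and associativity of convolution -/

namespace GSym

variable {V X Y Z : Type} [AddCommGroup V] [Module ℂ V] [SuperSpace V]
  [AddCommGroup X] [Module ℂ X] [AddCommGroup Y] [Module ℂ Y] [SuperSpace Y]
  [AddCommGroup Z] [Module ℂ Z]

theorem conv_mem {γ : Bool} {β : X →ₗ[ℂ] Y →ₗ[ℂ] Z} {f : GSym V →ₗ[ℂ] X} {g : GSym V →ₗ[ℂ] Y}
    (hg : ParMap γ g) {P : Submodule ℂ Z} (h : ∀ x y, β (f x) (g y) ∈ P) (w : GSym V) :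
    conv β f g w ∈ P := by
  rw [conv_apply _ _ hg]
  induction comul w using TensorProduct.induction_on with
  | zero => simp
  | tmul x y => exact h _ _
  | add a b ha hb => rw [map_add]; exact P.add_mem ha hb

/-- The two bilinear maps need to agree only on values of `f` and `g`. Taking the B-field for `f`
admits identities which hold only for compactly supported first arguments, such as integration by
parts. -/
theorem conv_congr {γ : Bool} {β β' : X →ₗ[ℂ] Y →ₗ[ℂ] Z} {f : GSym V →ₗ[ℂ] X}
    {g : GSym V →ₗ[ℂ] Y} (hg : ParMap γ g) (h : ∀ x y, β (f x) (g y) = β' (f x) (g y)) :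
    conv β f g = conv β' f g := by
  ext1 w
  rw [conv_apply _ _ hg, conv_apply _ _ hg]
  induction comul w using TensorProduct.induction_on with
  | zero => simp
  | tmul x y => exact h _ _
  | add a b ha hb => rw [map_add, map_add, ha, hb]

/-- Convolution along a bilinear map which is graded-symmetric up to the factor `s`. -/
theorem conv_swap [SuperSpace X] {a b : Bool} {s : ℂ} {β : X →ₗ[ℂ] Y →ₗ[ℂ] Z}
    {β' : Y →ₗ[ℂ] X →ₗ[ℂ] Z}
    (hβ : ∀ c d x y, Par c x → Par d y → β x y = (s * sg (c && d)) • β' y x)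
    {f : GSym V →ₗ[ℂ] X} (hf : ParMap a f) {g : GSym V →ₗ[ℂ] Y} (hg : ParMap b g) :
    conv β f g = (s * sg (a && b)) • conv β' g f := by
  ext1 w
  rw [LinearMap.smul_apply]
  induction w using GSym.hom_induction generalizing a b f g with
  | one =>
    have h1 : Par false (1 : GSym V) := by rw [Par, par_one]; simp
    have hf1 : Par a (f 1) := by simpa using h1.map hf
    have hg1 : Par b (g 1) := by simpa using h1.map hg
    rw [conv_one _ _ hg, conv_one _ _ hf, hβ a b _ _ hf1 hg1]
  | mul c v w hv ih =>
    rw [conv_ι_mul _ _ hg hv, conv_ι_mul _ _ hf hv, ih (ParMap.cut hf hv) hg,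
      ih hf (ParMap.cut hg hv)]
    cases a <;> cases b <;> cases c <;> simp <;> abel
  | add w w' hw hw' => rw [map_add, hw hf hg, hw' hf hg, map_add, smul_add]
  | smul c w hw => rw [map_smul, hw hf hg, map_smul, smul_comm]

/-- Contraction of letters replaces an appeal to coassociativity. The hypothesis on the bilinear
maps survives the induction because values of `cut v f` are values of `f`. -/
theorem conv_assoc {X' Y' Z' : Type} [AddCommGroup X'] [Module ℂ X'] [AddCommGroup Y']
    [Module ℂ Y'] [SuperSpace Y'] [AddCommGroup Z'] [Module ℂ Z'] [SuperSpace Z'] {b c : Bool}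
    {β : X' →ₗ[ℂ] Z' →ₗ[ℂ] Z} {β₁ : X →ₗ[ℂ] Y →ₗ[ℂ] X'} {β₂ : X →ₗ[ℂ] Y' →ₗ[ℂ] Z}
    {β₃ : Y →ₗ[ℂ] Z' →ₗ[ℂ] Y'} (hβ₃ : ∀ y z, par (β₃ y z) = β₃ (par y) (par z))
    {f : GSym V →ₗ[ℂ] X} {g : GSym V →ₗ[ℂ] Y} {h : GSym V →ₗ[ℂ] Z'}
    (hg : ParMap b g) (hh : ParMap c h)
    (hβ : ∀ x y z, β (β₁ (f x) y) z = β₂ (f x) (β₃ y z)) :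
    conv β (conv β₁ f g) h = conv β₂ f (conv β₃ g h) := by
  ext1 w
  induction w using GSym.hom_induction generalizing b c f g h with
  | one => rw [conv_one _ _ hh, conv_one _ _ hg, conv_one _ _ (parMap_conv hβ₃ hg hh),
      conv_one _ _ hh, hβ]
  | mul i v w hv ih =>
    have e1 : cut v (conv β₁ f g) = sg (b && i) • conv β₁ (cut v f) g + conv β₁ f (cut v g) :=
      LinearMap.ext fun w => conv_ι_mul _ _ hg hv w
    have e2 : cut v (conv β₃ g h) = sg (c && i) • conv β₃ (cut v g) h + conv β₃ g (cut v h) :=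
      LinearMap.ext fun w => conv_ι_mul _ _ hh hv w
    rw [conv_ι_mul _ _ hh hv, conv_ι_mul _ _ (parMap_conv hβ₃ hg hh) hv, e1, e2, conv_add_left,
      conv_add_right, conv_smul_left, conv_smul_right]
    simp only [LinearMap.add_apply, LinearMap.smul_apply]
    rw [ih (ParMap.cut hg hv) hh hβ, ih hg (ParMap.cut hh hv) hβ,
      ih (f := cut v f) hg hh fun x y z => hβ _ y z]
    cases b <;> cases c <;> cases i <;> simp <;> abel
  | add w w' hw hw' => rw [map_add, hw hg hh hβ, hw' hg hh hβ, map_add]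
  | smul c w hw => rw [map_smul, hw hg hh hβ, map_smul]

theorem conv_compl {k a γ : Bool} [SuperSpace X] {Y' : Type} [AddCommGroup Y'] [Module ℂ Y']
    [SuperSpace Y'] (β : X →ₗ[ℂ] Y →ₗ[ℂ] Z) {f : GSym V →ₗ[ℂ] X} (hf : ParMap a f)
    {L : Y' →ₗ[ℂ] Y} (hL : ParMap k L) {g : GSym V →ₗ[ℂ] Y'} (hg : ParMap γ g) :
    conv (β.compl₁₂ (parPow k) L) f g = sg (k && a) • conv β f (L ∘ₗ g) := by
  rw [conv_comp_right β hf hL hg, smul_smul, sg_mul_self, one_smul]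

end GSym

/-! ### The pairing ∫ b ∧ t and integration by parts -/

section Hamiltonians

variable {n m : ℕ}

/-- The `A`-field and the `B`-field, on compactly supported fields. -/
def cA (n m : ℕ) : GSym (FieldsC n m) →ₗ[ℂ] Forms n m ⊤ := pA ∘ₗ inclC ∘ₗ lin
def cB (n m : ℕ) : GSym (FieldsC n m) →ₗ[ℂ] Forms n m ⊤ := pB ∘ₗ inclC ∘ₗ lin

theorem cB_mem (w : GSym (FieldsC n m)) : cB n m w ∈ FormsC n m := (lin w).2.2

theorem parMap_inclC : ParMap false (inclC : FieldsC n m →ₗ[ℂ] Fields n m ⊤) := fun φ => by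
  simp [inclC_par]

theorem parMap_cA : ParMap true (cA n m) := by
  simpa [cA] using parMap_pA.comp (parMap_inclC.comp (parMap_lin (V := FieldsC n m)))

theorem parMap_cB : ParMap (pty m) (cB n m) := by
  simpa [cB] using parMap_pB.comp (parMap_inclC.comp (parMap_lin (V := FieldsC n m)))

/-- `∫ b ∧ t`. -/
def intMul : Forms n m ⊤ →ₗ[ℂ] Forms n m ⊤ →ₗ[ℂ] ℂ := wedge.compr₂ intExt

theorem intMul_apply (b t : Forms n m ⊤) : intMul b t = intExt (b * t) := rfl

theorem intMul_par (b t : Forms n m ⊤) : intMul (par b) t = sg (pty m) * intMul b (par t) := by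
  rw [intMul_apply, intMul_apply, ← intExt_par, par_forms_mul, par_par]

theorem intMul_poisson {b : Forms n m ⊤} (hb : b ∈ FormsC n m) (a t : Forms n m ⊤) :
    intMul (poisson b a) t = intMul b (poisson a t) := intExt_poisson hb a t

theorem intMul_dForm {b : Forms n m ⊤} (hb : b ∈ FormsC n m) (t : Forms n m ⊤) :
    intMul (dForm b) t = -intMul (par b) (dForm t) := intExt_dForm_mul hb t

theorem intB_eq {γ : Bool} {T : GSym (FieldsC n m) →ₗ[ℂ] Forms n m ⊤} (hT : ParMap γ T) :
    intB T = conv intMul (cB n m) T := by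
  have e : cB n m = (FormsC n m).subtype ∘ₗ fieldB := rfl
  rw [intB, comp_conv, e, conv_comp_left]
  refine conv_congr hT fun x y => ?_
  exact (intExt_of_mem (mul_mem_FormsC (fieldB x).2 _)).symm

end Hamiltonians

open GSym

/-! ### The symplectic pairing and a criterion for Hamiltonian vector fields -/

section Brackets

variable {n m : ℕ}

theorem omegaDensity_apply {U : Opens (Spacetime n m)} (φ ψ : Fields n m U) :
    omegaDensity φ ψ = pB ψ * par (pA φ) - pB φ * par (pA ψ) := rfl

/-- The integral sees only forms whose parity is that of m. Against `b` of the given parity, `par`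
therefore acts on `t` as a scalar. -/
theorem intMul_par_right {c : Bool} {b : Forms n m ⊤} (hb : Par (xor c (pty m)) b)
    (t : Forms n m ⊤) : intMul b (par t) = sg c * intMul b t := by
  have h := intMul_par b t
  rw [hb, map_smul, LinearMap.smul_apply, smul_eq_mul] at h
  have h1 := sg_mul_self (pty m)
  have h2 : sg (xor c (pty m)) = sg c * sg (pty m) := by cases c <;> cases pty m <;> simp
  rw [h2] at h
  linear_combination (-intMul b (par t) + sg c * intMul b t) * h1 - sg (pty m) * h

/-- The pairing of vector fields in terms of their components. -/
theorem omega_conv {i j : Bool} {X Y : GSym (FieldsC n m) →ₗ[ℂ] Fields n m ⊤} (hX : ParMap i X)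
    (hY : ParMap j Y) (hXB : ∀ w, pB (X w) ∈ FormsC n m) (hYB : ∀ w, pB (Y w) ∈ FormsC n m)
    (w : GSym (FieldsC n m)) :
    conv omegaDensity X Y w ∈ FormsC n m ∧ integral (conv omegaDensity X Y w)
      = sg (xor (i && j) j) * conv intMul (pB ∘ₗ Y) (pA ∘ₗ X) w
        - sg i * conv intMul (pB ∘ₗ X) (pA ∘ₗ Y) w := by
  have hmem : conv omegaDensity X Y w ∈ FormsC n m := conv_mem hY (fun x y => by
    rw [omegaDensity_apply]
    exact Submodule.sub_mem _ (mul_mem_FormsC (hYB y) _) (mul_mem_FormsC (hXB x) _)) w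
  refine ⟨hmem, ?_⟩
  have key : ∀ {i j : Bool} {X Y : GSym (FieldsC n m) →ₗ[ℂ] Fields n m ⊤}, ParMap i X →
      ParMap j Y → conv (intMul.compl₁₂ pB (par ∘ₗ pA)) X Y
        = sg i • conv intMul (pB ∘ₗ X) (pA ∘ₗ Y) := by
    intro i j X Y hX hY
    rw [conv_comp_left, conv_comp_right (intMul ∘ₗ pB) hX parMap_pA hY, Bool.true_and, smul_smul,
      sg_mul_self, one_smul]
    refine conv_congr hY fun x y => ?_
    change intMul (pB (X x)) (par (pA (Y y))) = intMul (pB (par (X x))) (pA (Y y))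
    rw [pB_par, map_smul, LinearMap.smul_apply, intMul_par, smul_eq_mul, ← mul_assoc, sg_mul_self,
      one_mul]
  -- Exchanging the two fields costs only the Koszul sign: where the signs would disagree, the
  -- integrand has the wrong parity and its integral vanishes.
  have hflip : conv (intMul.compl₁₂ pB (par ∘ₗ pA)).flip X Y
      = sg (i && j) • conv (intMul.compl₁₂ pB (par ∘ₗ pA)) Y X := by
    have h := conv_swap (s := 1) (β := ((intMul (n := n) (m := m)).compl₁₂ pB (par ∘ₗ pA)).flip)
      (β' := intMul.compl₁₂ pB (par ∘ₗ pA)) ?_ hX hY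
    · rw [h, one_mul]
    · intro c d p q hp hq
      change intMul (pB q) (par (pA p)) = (1 * sg (c && d)) • intMul (pB q) (par (pA p))
      have hq' : Par (xor d (pty m)) (pB q) := by
        have := hq.map parMap_pB
        rwa [Bool.xor_comm] at this
      have h1 := intMul_par_right hq' (pA p)
      have h2 : Par (!c) (pA p) := by simpa using hp.map parMap_pA
      rw [h2, map_smul, smul_eq_mul] at h1
      rw [h2, map_smul, one_mul, smul_eq_mul, smul_eq_mul]
      generalize intMul (pB q) (pA p) = A at h1
      revert h1
      cases c <;> cases d <;> simp only [Bool.not_true, Bool.not_false, Bool.and_true,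
        Bool.and_false, sg_true, sg_false] <;> intro h1
      · ring
      · ring
      · ring
      · linear_combination h1
  have hω : (omegaDensity (U := (⊤ : Opens (Spacetime n m)))).compr₂ intExt
      = (intMul.compl₁₂ pB (par ∘ₗ pA)).flip + (-1 : ℂ) • intMul.compl₁₂ pB (par ∘ₗ pA) := by
    ext p q
    change intExt (omegaDensity p q) = intExt (pB q * par (pA p))
      + (-1 : ℂ) • intExt (pB p * par (pA q))
    rw [omegaDensity_apply, map_sub, neg_one_smul, sub_eq_add_neg]
  rw [← intExt_of_mem hmem, ← LinearMap.comp_apply, comp_conv, hω, conv_add_form, conv_smul_form,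
    hflip, key hY hX, key hX hY, smul_smul]
  simp only [LinearMap.add_apply, LinearMap.smul_apply, smul_eq_mul]
  cases i <;> cases j <;> simp <;> ring

/-- A criterion for Hamiltonian vector fields of functionals `∫ B ∧ T`. -/
theorem isHamiltonian_of {γ : Bool} {T : GSym (FieldsC n m) →ₗ[ℂ] Forms n m ⊤} (hT : ParMap γ T)
    {X : LocalVF n m} (hA : ∀ w, pA (X.toFun ⊤ (inclSym w)) = T w)
    (hB : ∀ w, pB (X.toFun ⊤ (inclSym w)) ∈ FormsC n m)
    (h : ∀ c φ, Par c φ → ∀ w, conv intMul (cB n m) (cut φ T) (parPow c w)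
      = sg c * intMul (pB (X.toFun ⊤ (inclSym w))) (pA (inclC φ))) :
    IsHamiltonian (intB T) X := by
  have key : ∀ w φ, intMul (pB (inclC φ)) (par (T w))
      - intMul (pB (X.toFun ⊤ (inclSym w))) (par (pA (inclC φ))) = intB T (w * ι φ) := by
    intro w φ
    have hom : ∀ c φ, Par c φ → intMul (pB (inclC φ)) (par (T w))
        - intMul (pB (X.toFun ⊤ (inclSym w))) (par (pA (inclC φ))) = intB T (w * ι φ) := by
      intro c φ hφ
      have h1 : Par (xor c (pty m)) (pB (inclC φ)) := by
        have := (hφ.map parMap_inclC).map parMap_pB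
        simpa [Bool.xor_comm] using this
      have h2 : Par (!c) (pA (inclC φ)) := by
        simpa using (hφ.map parMap_inclC).map parMap_pA
      have e : cut φ (cB n m) = const (pB (inclC φ)) := cut_lin (pB ∘ₗ inclC)
      -- With φ moved to the front, contraction differentiates ∫ B ∧ T either in B, which leaves T
      -- and so matches the A-component, or in T, which is the content of the hypothesis `h`.
      rw [mul_ι hφ, intB_eq hT, conv_ι_mul _ _ hT hφ, h c φ hφ, e, conv_const_left _ _ hT,
        intMul_par_right h1, h2, map_smul, smul_eq_mul, smul_eq_mul]
      have e2 : intMul (pB (inclC φ)) (T (parPow c w))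
          = sg (γ && c) * (sg c * intMul (pB (inclC φ)) (T w)) := by
        cases c
        · simp
        · have := hT w
          simp only [parPow_true, Bool.and_true, sg_true]
          have e3 : T (par w) = sg γ • par (T w) := by
            rw [this, smul_smul, sg_mul_self, one_smul]
          rw [e3, map_smul, intMul_par_right h1, smul_eq_mul, sg_true]
      rw [e2, ← mul_assoc, sg_mul_self]
      cases c <;> simp [sub_eq_add_neg]
    have h0 := hom _ _ (par_ev φ)
    have h1 := hom _ _ (par_od φ)
    rw [← ev_add_od φ]
    simp only [map_add, mul_add, LinearMap.add_apply]
    linear_combination h0 + h1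
  intro w φ
  rw [← key, ← intExt_of_mem, omegaDensity_apply, map_sub, hA]
  · rfl
  · rw [omegaDensity_apply]
    exact Submodule.sub_mem _ (mul_mem_FormsC φ.2.2 _) (mul_mem_FormsC (hB w) _)

end Brackets

open GSym

/-! ### Components of the Hamiltonian vector fields -/

section Components

variable {n m : ℕ}

theorem low_inclSym (w : GSym (FieldsC n m)) :
    aug (inclSym w) = aug w ∧ lin (inclSym w) = inclC (lin w) := by
  induction w using GSym.induction with
  | one => simp
  | mul v w hw => simp [inclSym, ← hw.1]
  | add w w' hw hw' => simp only [map_add, hw.1, hw'.1, hw.2, hw'.2, and_self]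
  | smul a w hw => simp only [map_smul, hw.1, hw.2, and_self]

theorem parMap_inclSym :
    ParMap false (inclSym.toLinearMap : GSym (FieldsC n m) →ₗ[ℂ] GSym (Fields n m ⊤)) := fun w => by
  have : (inclSym (n := n) (m := m)).comp parHom = parHom.comp inclSym :=
    hom_ext fun v => by simp [inclSym, inclC_par]
  rw [sg_false, one_smul]
  exact (DFunLike.congr_fun this w).symm

theorem fA_inclSym : fA ⊤ ∘ₗ (inclSym (n := n) (m := m)).toLinearMap = cA n m :=
  LinearMap.ext fun w => congrArg pA (low_inclSym w).2

theorem fB_inclSym : fB ⊤ ∘ₗ (inclSym (n := n) (m := m)).toLinearMap = cB n m :=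
  LinearMap.ext fun w => congrArg pB (low_inclSym w).2

/-- The form-valued functional `T` with `Φ(x) = ∫ B ∧ T`. -/
def tX (m : ℕ) (x : LdR n) : GSym (FieldsC n m) →ₗ[ℂ] Forms n m ⊤ :=
  pA ∘ₗ xVF ⊤ x ∘ₗ inclSym.toLinearMap

theorem tX_eq (x : LdR n) :
    tX m x = poisson (pullU ⊤ x.1) ∘ₗ cA n m + const (-pullU ⊤ (par x.2)) := by
  ext1 w
  simp only [tX, LinearMap.comp_apply, xVF_apply, map_sub, map_smul, pA_actL, pA_iA,
    LinearMap.add_apply, const_apply, smul_neg, ← fA_inclSym, fA, AlgHom.toLinearMap_apply,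
    (low_inclSym w).1]
  rw [sub_eq_add_neg]

theorem parMap_tX {i : Bool} {x : LdR n} (hx : ParX i x) : ParMap (!i) (tX m x) := by
  simpa [tX] using parMap_pA.comp ((parMap_xVF hx).comp (parMap_inclSym (n := n) (m := m)))

theorem pB_xVF (x : LdR n) (w : GSym (FieldsC n m)) :
    pB (xVF ⊤ x (inclSym w)) = poisson (parPow (!pty m) (pullU ⊤ x.1)) (cB n m w) := by
  rw [xVF_apply, map_sub, pB_actL, map_smul, pB_iA, smul_zero, sub_zero, ← fB_inclSym]
  rfl

/-- The form-valued functional `T` with `S = ∫ B ∧ T`. -/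
def tS (n m : ℕ) : GSym (FieldsC n m) →ₗ[ℂ] Forms n m ⊤ :=
  dForm ∘ₗ cA n m + (1 / 2 : ℂ) • conv poisson (cA n m) (cA n m)

theorem parMap_tS : ParMap false (tS n m) := by
  refine ParMap.add ?_ (ParMap.smul ?_ _)
  · simpa using parMap_dForm.comp (parMap_cA (n := n) (m := m))
  · simpa using parMap_conv par_poisson (parMap_cA (n := n) (m := m)) parMap_cA

theorem pA_sVF (w : GSym (FieldsC n m)) : pA (sVF ⊤ (inclSym w)) = tS n m w := by
  have e := conv_map poisson inclC inclC_par (fA ⊤) (parMap_fA (n := n) (m := m)) w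
  change conv poisson (fA ⊤) (fA ⊤) (inclSym w)
    = conv poisson (fA ⊤ ∘ₗ inclSym.toLinearMap) (fA ⊤ ∘ₗ inclSym.toLinearMap) w at e
  rw [fA_inclSym] at e
  simp only [sVF, tS, LinearMap.add_apply, LinearMap.smul_apply, LinearMap.comp_apply, map_add,
    map_smul, pA_iA, pA_iB, smul_zero, add_zero, e, ← fA_inclSym, AlgHom.toLinearMap_apply]

theorem pB_sVF (w : GSym (FieldsC n m)) : pB (sVF ⊤ (inclSym w))
    = sg (!pty m) • (dForm (cB n m w) + conv poisson (cA n m) (cB n m) w) := by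
  have e := conv_map poisson inclC inclC_par (fA ⊤) (parMap_fB (n := n) (m := m)) w
  change conv poisson (fA ⊤) (fB ⊤) (inclSym w)
    = conv poisson (fA ⊤ ∘ₗ inclSym.toLinearMap) (fB ⊤ ∘ₗ inclSym.toLinearMap) w at e
  rw [fA_inclSym, fB_inclSym] at e
  simp only [sVF, LinearMap.add_apply, LinearMap.smul_apply, LinearMap.comp_apply, map_add,
    map_smul, pB_iA, pB_iB, zero_add, e, ← fB_inclSym, AlgHom.toLinearMap_apply, smul_zero]

theorem pB_xVF_mem (x : LdR n) (w : GSym (FieldsC n m)) :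
    pB (xVF ⊤ x (inclSym w)) ∈ FormsC n m := by
  rw [pB_xVF]
  exact poisson_mem_FormsC (cB_mem w) _

theorem pB_sVF_mem (w : GSym (FieldsC n m)) : pB (sVF ⊤ (inclSym w)) ∈ FormsC n m := by
  rw [pB_sVF]
  exact Submodule.smul_mem _ _ (Submodule.add_mem _ (dForm_mem_FormsC (cB_mem w))
    (conv_mem parMap_cB (fun x y => poisson_mem_FormsC (cB_mem y) _) w))

theorem conv_poisson_swap {V : Type} [AddCommGroup V] [Module ℂ V] [SuperSpace V] {a b : Bool}
    {f g : GSym V →ₗ[ℂ] Forms n m ⊤} (hf : ParMap a f) (hg : ParMap b g) :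
    conv poisson f g = (-1 * sg (a && b)) • conv poisson g f := by
  refine conv_swap (fun c d x y hx hy => ?_) hf hg
  rw [poisson_comm hy, hx.parPow, map_smul, Bool.and_comm, neg_one_mul, neg_smul]

theorem cut_add {V X : Type} [AddCommGroup V] [Module ℂ V] [SuperSpace V] [AddCommGroup X]
    [Module ℂ X] (v : V) (f g : GSym V →ₗ[ℂ] X) : cut v (f + g) = cut v f + cut v g := rfl

theorem cut_smul {V X : Type} [AddCommGroup V] [Module ℂ V] [SuperSpace V] [AddCommGroup X]
    [Module ℂ X] (v : V) (a : ℂ) (f : GSym V →ₗ[ℂ] X) : cut v (a • f) = a • cut v f := rfl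

theorem cut_cA (φ : FieldsC n m) : cut φ (cA n m) = const (pA (inclC φ)) := cut_lin (pA ∘ₗ inclC)

theorem cut_comp_cA (L : Forms n m ⊤ →ₗ[ℂ] Forms n m ⊤) (φ : FieldsC n m) :
    cut φ (L ∘ₗ cA n m) = const (L (pA (inclC φ))) := cut_lin (L ∘ₗ pA ∘ₗ inclC)

theorem par_pA_inclC {c : Bool} {φ : FieldsC n m} (hφ : Par c φ) : Par (!c) (pA (inclC φ)) := by
  simpa using (hφ.map parMap_inclC).map parMap_pA

/-- `xVF` is the Hamiltonian vector field of `Φ(x)`. -/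
theorem isHamiltonian_xVF_hom {i : Bool} {x : LdR n} (hx : ParX i x) :
    IsHamiltonian (intB (tX m x)) (xLVF m x) := by
  refine isHamiltonian_of (parMap_tX hx) (fun w => rfl) (pB_xVF_mem x) fun c φ hφ w => ?_
  have ha : Par i (pullU (m := m) ⊤ x.1) := hx.1.pullU
  change _ = sg c * intMul (pB (xVF ⊤ x (inclSym w))) (pA (inclC φ))
  rw [pB_xVF, tX_eq, cut_add, cut_const, add_zero, cut_comp_cA]
  set a := pullU (m := m) ⊤ x.1
  set y := pA (inclC φ) with hy
  have hyp : Par (!c) y := par_pA_inclC hφ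
  have hp : Par (xor i (!c)) (poisson a y) := hyp.map (parMap_poisson ha)
  rw [conv_const_right _ _ hp, parPow_parPow, ha.parPow]
  change intMul (cB n m (parPow (xor (xor i (!c)) c) w)) (poisson a y) = _
  have e1 : ∀ d, cB n m (parPow d w) = sg (pty m && d) • parPow d (cB n m w) := fun d => by
    rw [parMap_cB.parPow, smul_smul, sg_mul_self, one_smul]
  -- Integration by parts takes the bracket with `a` off the test field and puts it on B; graded
  -- antisymmetry then brings `a` to the left.
  rw [e1, map_smul, LinearMap.smul_apply, ← intMul_poisson (parPow_mem_FormsC (cB_mem w) _),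
    poisson_comm ha, parPow_parPow]
  have e2 : xor i (xor (xor i (!c)) c) = true := by cases i <;> cases c <;> rfl
  have e3 : poisson a (par (cB n m w)) = sg i • par (poisson a (cB n m w)) := by
    rw [par_poisson, ha, map_smul, LinearMap.smul_apply, smul_smul, sg_mul_self, one_smul]
  rw [e2, parPow_true, e3, map_neg, map_smul, LinearMap.neg_apply, LinearMap.smul_apply, intMul_par,
    hyp]
  simp only [map_smul, LinearMap.smul_apply, smul_eq_mul]
  cases i <;> cases c <;> cases pty m <;> simp

theorem isHamiltonian_sVF : IsHamiltonian (intB (tS n m)) (sLVF n m) := by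
  refine isHamiltonian_of parMap_tS pA_sVF pB_sVF_mem fun c φ hφ w => ?_
  change _ = sg c * intMul (pB (sVF ⊤ (inclSym w))) (pA (inclC φ))
  set y := pA (inclC φ) with hy
  have hyp : Par (!c) y := par_pA_inclC hφ
  have hdy : Par c (dForm y) := by simpa using hyp.map parMap_dForm
  -- The bracket is graded symmetric on the odd functional A, so the two insertions into {A, A}
  -- agree and the factor ½ disappears.
  have e1 : cut φ (tS n m) = const (dForm y) + conv poisson (cA n m) (const y) := by
    have h : cut φ (conv poisson (cA n m) (cA n m))
        = sg (true && c) • conv poisson (cut φ (cA n m)) (cA n m)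
          + conv poisson (cA n m) (cut φ (cA n m)) :=
      LinearMap.ext fun w => conv_ι_mul _ _ parMap_cA hφ w
    rw [tS, cut_add, cut_smul, h, cut_cA, ← hy, conv_poisson_swap (parMap_const hyp) parMap_cA,
      cut_comp_cA, ← hy, smul_smul]
    cases c <;> simp <;> module
  -- Associativity of convolution promotes the pointwise identity ∫ {B, A} ∧ t = ∫ B ∧ {A, t} to
  -- functionals.
  have e2 : conv intMul (cB n m) (conv poisson (cA n m) (const y))
      = conv intMul (conv poisson (cB n m) (cA n m)) (const y) :=
    (conv_assoc par_poisson parMap_cA (parMap_const hyp)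
      fun x a t => intMul_poisson (cB_mem x) a t).symm
  have hC := parMap_conv par_poisson (parMap_cB (n := n) (m := m)) parMap_cA
  set C := conv poisson (cB n m) (cA n m) with hCdef
  have e3 : C (par w) = sg (!pty m) • par (C w) := by
    have := hC w
    rw [Bool.xor_true] at this
    rw [this, smul_smul, sg_mul_self, one_smul]
  have e4 : parPow (!c) (parPow c w) = par w := by
    rw [parPow_parPow]; cases c <;> rfl
  have e5 : parPow c (parPow c w) = w := by
    rw [parPow_parPow, Bool.xor_self]; rfl
  rw [e1, conv_add_right, LinearMap.add_apply, e2, conv_const_right _ _ hdy,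
    conv_const_right _ _ hyp, e4, e5, e3, pB_sVF, conv_poisson_swap parMap_cA parMap_cB, ← hCdef]
  -- Stokes' theorem moves d from the test field to B.
  have e6 : intMul (dForm (par (cB n m w))) y = -intMul (cB n m w) (dForm y) := by
    rw [intMul_dForm (par_mem_FormsC (cB_mem w)), par_par]
  have e7 : dForm (par (cB n m w)) = -par (dForm (cB n m w)) := by
    have := parMap_dForm (cB n m w)
    simp only [sg_true, neg_smul, one_smul] at this
    rw [this, neg_neg]
  have e8 : ∀ b, intMul (par b) y = sg (pty m) * (sg (!c) * intMul b y) := fun b => by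
    rw [intMul_par, hyp, map_smul, smul_eq_mul]
  rw [e7, map_neg, LinearMap.neg_apply, e8, neg_inj] at e6
  rw [← e6]
  simp only [map_smul, map_add, LinearMap.smul_apply, LinearMap.add_apply, smul_eq_mul, e8]
  cases c <;> cases pty m <;> simp <;> ring

end Components

open GSym

/-! ### The BV brackets -/

section BVBrackets

variable {n m : ℕ}

/-- Integration by parts for functionals. The power of `par` in the B-component of the vector field
makes the resulting sign depend on the parity of `a` alone and not on m. -/
theorem conv_intMul_poisson {i γ : Bool} {a : Forms n m ⊤} (ha : Par i a)
    {T : GSym (FieldsC n m) →ₗ[ℂ] Forms n m ⊤} (hT : ParMap γ T) :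
    conv intMul (poisson (parPow (!pty m) a) ∘ₗ cB n m) T
      = (-sg i) • conv intMul (cB n m) (poisson a ∘ₗ T) := by
  have h : conv (intMul ∘ₗ poisson (parPow (!pty m) a)) (cB n m) T
      = conv ((-sg (!pty m && i)) • intMul.compl₁₂ (parPow i) (poisson a)) (cB n m) T := by
    refine conv_congr hT fun w t => ?_
    change intMul (poisson (parPow (!pty m) a) (cB n m w)) (T t)
      = (-sg (!pty m && i)) • intMul (parPow i (cB n m w)) (poisson a (T t))
    rw [ha.parPow, map_smul, LinearMap.smul_apply, ← intMul_poisson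
      (parPow_mem_FormsC (cB_mem w) i), poisson_comm ha, parPow_parPow, Bool.xor_self]
    simp
  rw [conv_comp_left, h, conv_smul_form, conv_compl _ parMap_cB (parMap_poisson ha) hT, smul_smul]
  cases i <;> cases pty m <;> simp

theorem conv_intMul_dForm {γ : Bool} {T : GSym (FieldsC n m) →ₗ[ℂ] Forms n m ⊤}
    (hT : ParMap γ T) :
    conv intMul (dForm ∘ₗ cB n m) T = (-sg (pty m)) • conv intMul (cB n m) (dForm ∘ₗ T) := by
  have h : conv (intMul ∘ₗ dForm) (cB n m) T
      = conv ((-1 : ℂ) • intMul.compl₁₂ (parPow true) dForm) (cB n m) T := by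
    refine conv_congr hT fun w t => ?_
    change intMul (dForm (cB n m w)) (T t)
      = (-1 : ℂ) • intMul (par (cB n m w)) (dForm (T t))
    rw [intMul_dForm (cB_mem w), neg_one_smul]
  rw [conv_comp_left, h, conv_smul_form, conv_compl _ parMap_cB parMap_dForm hT, smul_smul,
    neg_one_mul, Bool.true_and]

theorem conv_intMul_conv {γ : Bool} {T : GSym (FieldsC n m) →ₗ[ℂ] Forms n m ⊤}
    (hT : ParMap γ T) :
    conv intMul (conv poisson (cA n m) (cB n m)) T
      = (-sg (pty m)) • conv intMul (cB n m) (conv poisson (cA n m) T) := by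
  rw [conv_poisson_swap parMap_cA parMap_cB, conv_smul_left, neg_one_mul, Bool.true_and,
    conv_assoc par_poisson parMap_cA hT fun x a t => intMul_poisson (cB_mem x) a t]

theorem conv_omega_inclSym {j : Bool} (X : GSym (Fields n m ⊤) →ₗ[ℂ] Fields n m ⊤)
    {Y : GSym (Fields n m ⊤) →ₗ[ℂ] Fields n m ⊤} (hY : ParMap j Y) (w : GSym (FieldsC n m)) :
    conv omegaDensity X Y (inclSym w)
      = conv omegaDensity (X ∘ₗ inclSym.toLinearMap) (Y ∘ₗ inclSym.toLinearMap) w :=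
  conv_map _ inclC inclC_par X hY w

theorem tX_bracket {i j : Bool} {x y : LdR n} (hx : ParX i x) (hy : ParX j y) :
    tX m (dRBracket x y) = poisson (pullU ⊤ x.1) ∘ₗ tX m y
      + (-sg (i && j)) • poisson (pullU ⊤ y.1) ∘ₗ tX m x := by
  have h := xVF_bracket (U := (⊤ : Opens (Spacetime n m))) hx hy
  rw [xVF_comp_lins x (parMap_xVF hy), xVF_comp_lins y (parMap_xVF hx)] at h
  ext1 w
  simp only [tX, h, LinearMap.comp_apply, LinearMap.sub_apply, LinearMap.smul_apply, map_sub,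
    map_smul, pA_actL, LinearMap.add_apply]
  rw [sub_eq_add_neg, neg_smul]

/-- The right-hand side is the shape which the symplectic pairing of the two fields takes after
integration by parts. It collapses by the Leibniz rule for d and the Jacobi identity. -/
theorem tX_diff {i : Bool} {x : LdR n} (hx : ParX i x) :
    tX m (dRDiff x) = (-sg i) • poisson (pullU ⊤ x.1) ∘ₗ tS n m + dForm ∘ₗ tX m x
      + conv poisson (cA n m) (tX m x) := by
  have ha : Par i (pullU (m := m) ⊤ x.1) := hx.1.pullU
  have hb : Par (!i) (pullU (m := m) ⊤ x.2) := hx.2.pullU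
  have hpar : par (-dForm x.2) = dForm (par x.2) := by
    rw [map_neg, parMap_dForm]
    simp
  have h0 : tX m (dRDiff x) = poisson (dForm (pullU ⊤ x.1) + pullU ⊤ x.2) ∘ₗ cA n m
      + const (-dForm (pullU ⊤ (par x.2))) := by
    rw [tX_eq, dRDiff, hpar, map_add, pullU_dForm, pullU_dForm]
  have hx2 : pullU (m := m) ⊤ x.2 = sg (!i) • pullU ⊤ (par x.2) := by
    rw [pullU_par, hb, smul_smul, sg_mul_self, one_smul]
  rw [h0, hx2, tX_eq]
  set u := pullU (m := m) ⊤ (par x.2)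
  have hu : Par (!i) (-u) := by
    have : Par (!i) u := by
      rw [hx2] at hb
      have := congrArg (sg (!i) • ·) hb
      simpa [smul_smul, sg_mul_self, Par] using this
    rw [Par, map_neg, this, smul_neg]
  have e1 := conv_poisson_swap (parMap_cA (n := n) (m := m)) (parMap_const hu)
  have hAa : ParMap (!i) (poisson (pullU (m := m) ⊤ x.1) ∘ₗ cA n m) := by
    simpa using (parMap_poisson ha).comp parMap_cA
  have e2 := conv_poisson_swap hAa (parMap_cA (n := n) (m := m))
  rw [conv_add_right, e1]
  set a := pullU (m := m) ⊤ x.1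
  ext1 w
  have jac := conv_jacobi parMap_cA ha (parMap_cA (n := n) (m := m)) w
  rw [e2] at jac
  have e3 := dForm_poisson a (cA n m w)
  rw [ha] at e3
  simp only [tS, LinearMap.add_apply, LinearMap.smul_apply, LinearMap.comp_apply,
    const_apply, map_add, map_smul, conv_const_left _ _ parMap_cA, ← jac, e3, map_neg,
    LinearMap.neg_apply]
  cases i <;> simp <;> module

/-- The pairing has two terms, each a B-component against an A-component. Integrating both by parts
gives ∫ B ∧ ({a, T_y} ∓ {a', T_x}), with a and a' the pulled-back forms of `x` and `y`, and
`tX_bracket` identifies the combination. -/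
theorem bracket_xVF_hom {i j : Bool} {x y : LdR n} (hx : ParX i x) (hy : ParX j y)
    (w : GSym (FieldsC n m)) :
    conv omegaDensity (xVF ⊤ x) (xVF ⊤ y) (inclSym w) ∈ FormsC n m ∧
      integral (conv omegaDensity (xVF ⊤ x) (xVF ⊤ y) (inclSym w))
        = intB (tX m (dRBracket x y)) w := by
  have hX := (parMap_xVF hx).comp (parMap_inclSym (n := n) (m := m))
  have hY := (parMap_xVF hy).comp (parMap_inclSym (n := n) (m := m))
  rw [Bool.xor_false] at hX hY
  have key := omega_conv hX hY (pB_xVF_mem x) (pB_xVF_mem y) w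
  rw [conv_omega_inclSym _ (parMap_xVF hy)]
  refine ⟨key.1, key.2.trans ?_⟩
  have eB : ∀ z : LdR n, pB ∘ₗ xVF ⊤ z ∘ₗ inclSym.toLinearMap
      = poisson (parPow (!pty m) (pullU ⊤ z.1)) ∘ₗ cB n m := fun z => LinearMap.ext (pB_xVF z)
  have eA : ∀ z : LdR n, pA ∘ₗ xVF ⊤ z ∘ₗ inclSym.toLinearMap = tX m z := fun z => rfl
  have hp : ParMap (xor i (!j)) (tX m (dRBracket x y)) := by
    rw [tX_bracket hx hy]
    refine ParMap.add ((parMap_poisson hx.1.pullU).comp (parMap_tX hy)) (ParMap.smul ?_ _)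
    have := (parMap_poisson (hy.1.pullU (U := (⊤ : Opens (Spacetime n m))))).comp (parMap_tX hx)
    rwa [show xor j (!i) = xor i (!j) by cases i <;> cases j <;> rfl] at this
  rw [eB, eB, eA, eA, conv_intMul_poisson hy.1.pullU (parMap_tX hx),
    conv_intMul_poisson hx.1.pullU (parMap_tX hy), intB_eq hp, tX_bracket hx hy, conv_add_right, conv_smul_right]
  simp only [LinearMap.add_apply, LinearMap.smul_apply, smul_eq_mul]
  cases i <;> cases j <;> simp <;> ring

theorem bracket_sVF_hom {i : Bool} {x : LdR n} (hx : ParX i x) (w : GSym (FieldsC n m)) :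
    conv omegaDensity (sVF ⊤) (xVF ⊤ x) (inclSym w) ∈ FormsC n m ∧
      integral (conv omegaDensity (sVF ⊤) (xVF ⊤ x) (inclSym w))
        = intB (tX m (dRDiff x)) w := by
  have hX := (parMap_xVF hx).comp (parMap_inclSym (n := n) (m := m))
  have hS := parMap_sVF.comp (parMap_inclSym (n := n) (m := m))
  rw [Bool.xor_false] at hX hS
  have key := omega_conv hS hX pB_sVF_mem (pB_xVF_mem x) w
  rw [conv_omega_inclSym _ (parMap_xVF hx)]
  refine ⟨key.1, key.2.trans ?_⟩
  have eB : pB ∘ₗ xVF ⊤ x ∘ₗ inclSym.toLinearMap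
      = poisson (parPow (!pty m) (pullU ⊤ x.1)) ∘ₗ cB n m := LinearMap.ext (pB_xVF x)
  have eA : pA ∘ₗ xVF ⊤ x ∘ₗ inclSym.toLinearMap = tX m x := rfl
  have eSB : pB ∘ₗ sVF ⊤ ∘ₗ inclSym.toLinearMap
      = sg (!pty m) • (dForm ∘ₗ cB n m + conv poisson (cA n m) (cB n m)) := LinearMap.ext pB_sVF
  have eSA : pA ∘ₗ sVF ⊤ ∘ₗ inclSym.toLinearMap = tS n m := LinearMap.ext pA_sVF
  have hp : ParMap i (tX m (dRDiff x)) := by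
    rw [tX_diff hx]
    refine ParMap.add (ParMap.add (ParMap.smul ?_ _) ?_) ?_
    · simpa using (parMap_poisson (hx.1.pullU (U := (⊤ : Opens (Spacetime n m))))).comp parMap_tS
    · simpa using parMap_dForm.comp (parMap_tX (m := m) hx)
    · simpa using parMap_conv par_poisson parMap_cA (parMap_tX (m := m) hx)
  rw [eB, eA, eSB, eSA, conv_intMul_poisson hx.1.pullU parMap_tS, conv_smul_left, conv_add_left,
    conv_intMul_dForm (parMap_tX hx), conv_intMul_conv (parMap_tX hx), intB_eq hp, tX_diff hx,
    conv_add_right, conv_add_right, conv_smul_right]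
  simp only [LinearMap.add_apply, LinearMap.smul_apply, smul_eq_mul]
  cases i <;> cases pty m <;> simp <;> ring

end BVBrackets

open GSym

/-! ### The inner action Φ -/

section InnerAction

variable {n m : ℕ}

theorem intB_add (T T' : GSym (FieldsC n m) →ₗ[ℂ] Forms n m ⊤) :
    intB (T + T') = intB T + intB T' := by
  rw [intB, conv_add_right, LinearMap.comp_add]
  rfl

theorem intB_smul (a : ℂ) (T : GSym (FieldsC n m) →ₗ[ℂ] Forms n m ⊤) :
    intB (a • T) = a • intB T := by
  rw [intB, conv_smul_right, LinearMap.comp_smul]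
  rfl

/-- The inner action `Φ`. -/
def Phi (n m : ℕ) : LdR n →ₗ[ℂ] Functional n m where
  toFun x := intB (tX m x)
  map_add' x y := by
    rw [← intB_add]
    congr 1
    simp only [tX, map_add, LinearMap.add_comp, LinearMap.comp_add]
  map_smul' a x := by
    rw [RingHom.id_apply, ← intB_smul]
    congr 1
    simp only [tX, map_smul, LinearMap.smul_comp, LinearMap.comp_smul]

theorem Phi_apply (x : LdR n) : Phi n m x = intB (tX m x) := rfl

/-- The homogeneous components of an element of `(L_n)_{dR}`. -/
def homPart (c : Bool) (x : LdR n) : LdR n :=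
  if c then (od x.1, ev x.2) else (ev x.1, od x.2)

theorem parX_homPart (c : Bool) (x : LdR n) : ParX c (homPart c x) := by
  cases c
  · exact ⟨par_ev _, par_od _⟩
  · exact ⟨par_od _, par_ev _⟩

theorem homPart_add_homPart (x : LdR n) : homPart false x + homPart true x = x := by
  refine Prod.ext ?_ ?_
  · exact ev_add_od x.1
  · change od x.2 + ev x.2 = x.2
    rw [add_comm]
    exact ev_add_od x.2

theorem LdR_induction {P : LdR n → Prop} (hom : ∀ i x, ParX i x → P x)
    (add : ∀ x y, P x → P y → P (x + y)) (x : LdR n) : P x := by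
  rw [← homPart_add_homPart x]
  exact add _ _ (hom _ _ (parX_homPart _ _)) (hom _ _ (parX_homPart _ _))

theorem omega_xVF_mem (x : LdR n) (w : GSym (FieldsC n m)) (φ : FieldsC n m) :
    omegaDensity (xVF ⊤ x (inclSym w)) (inclC φ) ∈ FormsC n m := by
  rw [omegaDensity_apply]
  exact Submodule.sub_mem _ (mul_mem_FormsC φ.2.2 _) (mul_mem_FormsC (pB_xVF_mem x w) _)

theorem isHamiltonian_Phi (x : LdR n) : IsHamiltonian (Phi n m x) (xLVF m x) := by
  induction x using LdR_induction with
  | hom i x hx => exact isHamiltonian_xVF_hom hx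
  | add x y hx hy =>
    intro w φ
    have h1 := hx w φ
    have h2 := hy w φ
    change integral (omegaDensity (xVF ⊤ _ (inclSym w)) (inclC φ)) = _ at h1 h2 ⊢
    -- The sum is split after passing to the linear extension of the integral.
    rw [← intExt_of_mem (omega_xVF_mem _ _ _)] at h1 h2 ⊢
    rw [map_add, LinearMap.add_apply, map_add, LinearMap.add_apply, map_add, h1, h2, map_add,
      LinearMap.add_apply]

/-- Compact support of the density is carried along because it is needed to add up the integrals of
the homogeneous parts. -/
theorem bracket_sVF (x : LdR n) (w : GSym (FieldsC n m)) :
    conv omegaDensity (sVF ⊤) (xVF ⊤ x) (inclSym w) ∈ FormsC n m ∧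
      integral (conv omegaDensity (sVF ⊤) (xVF ⊤ x) (inclSym w)) = Phi n m (dRDiff x) w := by
  induction x using LdR_induction with
  | hom i x hx => exact bracket_sVF_hom hx w
  | add x y hx hy =>
    have e : dRDiff (x + y) = dRDiff x + dRDiff y := by
      refine Prod.ext ?_ ?_
      · change dForm (x.1 + y.1) + (x.2 + y.2) = dForm x.1 + x.2 + (dForm y.1 + y.2)
        rw [map_add]; abel
      · change -dForm (x.2 + y.2) = -dForm x.2 + -dForm y.2
        rw [map_add, neg_add]
    have h : conv omegaDensity (sVF ⊤) (xVF ⊤ (x + y)) (inclSym w)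
        = conv omegaDensity (sVF ⊤) (xVF ⊤ x) (inclSym w)
          + conv omegaDensity (sVF ⊤) (xVF ⊤ y) (inclSym w) := by
      rw [map_add, conv_add_right, LinearMap.add_apply]
    have hmem := Submodule.add_mem _ hx.1 hy.1
    rw [h, e, map_add, LinearMap.add_apply]
    refine ⟨hmem, ?_⟩
    rw [← intExt_of_mem hmem, map_add, intExt_of_mem hx.1, intExt_of_mem hy.1, hx.2, hy.2]

theorem poisson_add_left {U : Opens (Spacetime n m)} (a b c : Forms n m U) :
    poisson (a + b) c = poisson a c + poisson b c := by
  rw [map_add, LinearMap.add_apply]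

theorem par_forms_add {U : Opens (Spacetime n m)} (a b : Forms n m U) :
    par (a + b) = par a + par b := map_add par a b

theorem dRBracket_add_left (x z y : LdR n) :
    dRBracket (x + z) y = dRBracket x y + dRBracket z y := by
  refine Prod.ext (poisson_add_left x.1 z.1 y.1) ?_
  have e1 := poisson_add_left x.2 z.2 y.1
  have e2 : poisson (par (x.1 + z.1)) y.2 = poisson (par x.1) y.2 + poisson (par z.1) y.2 :=
    (congrArg (fun t => poisson t y.2) (par_forms_add x.1 z.1)).trans (poisson_add_left _ _ _)
  exact (congrArg₂ (· + ·) e1 e2).trans (add_add_add_comm _ _ _ _)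

theorem dRBracket_add_right (x y z : LdR n) :
    dRBracket x (y + z) = dRBracket x y + dRBracket x z :=
  Prod.ext (map_add (poisson x.1) y.1 z.1)
    ((congrArg₂ (· + ·) (map_add (poisson x.2) y.1 z.1)
      (map_add (poisson (par x.1)) y.2 z.2)).trans (add_add_add_comm _ _ _ _))

theorem bracket_xVF_right {i : Bool} {x : LdR n} (hx : ParX i x) (y : LdR n)
    (w : GSym (FieldsC n m)) :
    conv omegaDensity (xVF ⊤ x) (xVF ⊤ y) (inclSym w) ∈ FormsC n m ∧
      integral (conv omegaDensity (xVF ⊤ x) (xVF ⊤ y) (inclSym w))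
        = Phi n m (dRBracket x y) w := by
  induction y using LdR_induction with
  | hom j y hy => exact bracket_xVF_hom hx hy w
  | add y z hy hz =>
    have h : conv omegaDensity (xVF ⊤ x) (xVF ⊤ (y + z)) (inclSym w)
        = conv omegaDensity (xVF ⊤ x) (xVF ⊤ y) (inclSym w)
          + conv omegaDensity (xVF ⊤ x) (xVF ⊤ z) (inclSym w) := by
      rw [map_add, conv_add_right, LinearMap.add_apply]
    have hmem := Submodule.add_mem _ hy.1 hz.1
    rw [h, dRBracket_add_right, map_add, LinearMap.add_apply]
    refine ⟨hmem, ?_⟩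
    rw [← intExt_of_mem hmem, map_add, intExt_of_mem hy.1, intExt_of_mem hz.1, hy.2, hz.2]

theorem bracket_xVF (x y : LdR n) (w : GSym (FieldsC n m)) :
    conv omegaDensity (xVF ⊤ x) (xVF ⊤ y) (inclSym w) ∈ FormsC n m ∧
      integral (conv omegaDensity (xVF ⊤ x) (xVF ⊤ y) (inclSym w))
        = Phi n m (dRBracket x y) w := by
  induction x using LdR_induction with
  | hom i x hx => exact bracket_xVF_right hx y w
  | add x z hx hz =>
    have h : conv omegaDensity (xVF ⊤ (x + z)) (xVF ⊤ y) (inclSym w)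
        = conv omegaDensity (xVF ⊤ x) (xVF ⊤ y) (inclSym w)
          + conv omegaDensity (xVF ⊤ z) (xVF ⊤ y) (inclSym w) := by
      rw [map_add, conv_add_left, LinearMap.add_apply]
    have hmem := Submodule.add_mem _ hx.1 hz.1
    rw [h, dRBracket_add_left, map_add, LinearMap.add_apply]
    refine ⟨hmem, ?_⟩
    rw [← intExt_of_mem hmem, map_add, intExt_of_mem hx.1, intExt_of_mem hz.1, hx.2, hz.2]

theorem Phi_one (x : LdR n) : Phi n m x 1 = 0 := by
  induction x using LdR_induction with
  | hom i x hx =>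
    rw [Phi_apply, intB_eq (parMap_tX hx), conv_one _ _ (parMap_tX hx)]
    simp [cB]
  | add x y hx hy => rw [map_add, LinearMap.add_apply, hx, hy, add_zero]

theorem fieldA_eq : fieldA = cA n m := rfl

theorem isBVBracket_diff (x : LdR n) :
    IsBVBracket (actionS n m) (Phi n m x) (Phi n m (dRDiff x)) :=
  ⟨sLVF n m, xLVF m x, isHamiltonian_sVF, isHamiltonian_Phi x, Phi_one _, fun w _ =>
    (bracket_sVF x w).2.symm⟩

theorem isBVBracket_bracket (x y : LdR n) :
    IsBVBracket (Phi n m x) (Phi n m y) (Phi n m (dRBracket x y)) :=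
  ⟨xLVF m x, xLVF m y, isHamiltonian_Phi x, isHamiltonian_Phi y, Phi_one _, fun w _ =>
    (bracket_xVF x y w).2.symm⟩

theorem pullU_top (α : L n) : pullU ⊤ α = pull m α := by
  have : ∀ a : Forms n m ⊤, res (le_top : (⊤ : Opens (Spacetime n m)) ≤ ⊤) a = a := by
    intro a
    induction a using forms_induction with
    | pt f l => rfl
    | add a b ha hb => rw [map_add, ha, hb]
  exact this (pull m α)

theorem Phi_left (α : L n) : Phi n m (α, 0) = funP m α := by
  have e : tX m (α, 0) = conv poisson (constForm (pull m α)) fieldA := by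
    ext1 w
    rw [tX_eq, pullU_top, fieldA_eq]
    have := conv_const_left poisson (pull m α) (parMap_cA (n := n) (m := m)) w
    rw [LinearMap.add_apply, map_zero, map_zero, neg_zero]
    refine Eq.trans ?_ this.symm
    simp
  rw [Phi_apply, e]
  rfl

/-- The constant part of T is -par α, and `par` acts on forms of degree k by (-1)^k; this is the
sign (-1)^(k+1). -/
theorem Phi_right {k : ℤ} {α : L n} (hα : α ∈ formsDeg ⊤ k) :
    Phi n m (0, α) = (-1 : ℂ) ^ (k + 1) • funQ m α := by
  have hp := par_of_mem_formsDeg hα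
  have e : tX m (0, α) = (-1 : ℂ) ^ (k + 1) • constForm (pull m α) := by
    ext1 w
    rw [tX_eq, pullU_top, pullU_top, hp, sg_pty, zpow_add₀ (by norm_num)]
    simp [constForm, const, smul_comm ((-1 : ℂ) ^ k)]
  rw [Phi_apply, e, intB_smul]
  rfl

end InnerAction

/-! ### Degrees of the functionals Φ(x) -/

section Degrees

variable {V X Y Z : Type} [AddCommGroup V] [Module ℂ V] [SuperSpace V]
  [AddCommGroup X] [Module ℂ X] [AddCommGroup Y] [Module ℂ Y] [SuperSpace Y]
  [AddCommGroup Z] [Module ℂ Z]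

theorem lin_mem_grade {𝒱 : ℤ → Submodule ℂ V} {e : ℤ} {w : GSym V} (hw : w ∈ grade 𝒱 e) :
    (e ≠ 0 → aug w = 0) ∧ lin w ∈ 𝒱 e := by
  refine grade_induction (P := fun e w => (e ≠ 0 → aug w = 0) ∧ lin w ∈ 𝒱 e) ?_ ?_ ?_ ?_ ?_ hw
  · simp
  · intro c e v w hv _ h
    refine ⟨fun _ => by simp, ?_⟩
    rw [lin_ι_mul]
    by_cases he : e = 0
    · subst he
      rw [add_zero]
      exact Submodule.smul_mem _ _ hv
    · rw [h.1 he, zero_smul]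
      exact Submodule.zero_mem _
  · intro e; simp
  · intro e w w' h h'
    refine ⟨fun he => by rw [map_add, h.1 he, h'.1 he, add_zero], ?_⟩
    rw [map_add]; exact Submodule.add_mem _ h.2 h'.2
  · intro e a w h
    refine ⟨fun he => by rw [map_smul, h.1 he, smul_zero], ?_⟩
    rw [map_smul]; exact Submodule.smul_mem _ _ h.2

/-- The shifts `p` and `q` vary in the induction: contraction with a letter of degree c raises the
shift of the contracted functional by c. -/
theorem conv_mem_grade {𝒱 : ℤ → Submodule ℂ V} (h𝒱 : ∀ d, ∀ v ∈ 𝒱 d, Par (pty d) v)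
    {𝒳 : ℤ → Submodule ℂ X} {𝒴 : ℤ → Submodule ℂ Y} {𝒵 : ℤ → Submodule ℂ Z}
    {β : X →ₗ[ℂ] Y →ₗ[ℂ] Z} (hβ : ∀ p q, ∀ x ∈ 𝒳 p, ∀ y ∈ 𝒴 q, β x y ∈ 𝒵 (p + q))
    {γ : Bool} {f : GSym V →ₗ[ℂ] X} {g : GSym V →ₗ[ℂ] Y} (hg : ParMap γ g) {p q : ℤ}
    (hf' : ∀ e, ∀ w ∈ grade 𝒱 e, f w ∈ 𝒳 (e + p)) (hg' : ∀ e, ∀ w ∈ grade 𝒱 e, g w ∈ 𝒴 (e + q))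
    {e : ℤ} {w : GSym V} (hw : w ∈ grade 𝒱 e) : conv β f g w ∈ 𝒵 (e + (p + q)) := by
  refine grade_induction (P := fun e w => ∀ (γ : Bool) (f : GSym V →ₗ[ℂ] X) (g : GSym V →ₗ[ℂ] Y)
    (p q : ℤ), ParMap γ g → (∀ e, ∀ w ∈ grade 𝒱 e, f w ∈ 𝒳 (e + p)) →
      (∀ e, ∀ w ∈ grade 𝒱 e, g w ∈ 𝒴 (e + q)) → conv β f g w ∈ 𝒵 (e + (p + q)))
    ?_ ?_ ?_ ?_ ?_ hw γ f g p q hg hf' hg'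
  · intro γ f g p q hg hf hg'
    rw [conv_one _ _ hg]
    have h1 := hf 0 1 (one_mem_grade 𝒱)
    have h2 := hg' 0 1 (one_mem_grade 𝒱)
    rw [zero_add] at h1 h2 ⊢
    exact hβ _ _ _ h1 _ h2
  · intro c e v w hv _ ih γ f g p q hg hf hg'
    rw [conv_ι_mul _ _ hg (h𝒱 c v hv)]
    refine Submodule.add_mem _ (Submodule.smul_mem _ _ ?_) ?_
    · have := ih γ (cut v f) g (c + p) q hg (fun e w hw => by
        rw [show e + (c + p) = c + e + p by ring]
        exact hf _ _ (ι_mul_mem_grade hv hw)) hg'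
      rwa [show e + (c + p + q) = c + e + (p + q) by ring] at this
    · have := ih _ f (cut v g) p (c + q) (ParMap.cut hg (h𝒱 c v hv)) hf (fun e w hw => by
        rw [show e + (c + q) = c + e + q by ring]
        exact hg' _ _ (ι_mul_mem_grade hv hw))
      rwa [show e + (p + (c + q)) = c + e + (p + q) by ring] at this
  · intro e γ f g p q _ _ _; simp
  · intro e w w' h h' γ f g p q hg hf hg'
    rw [map_add]
    exact Submodule.add_mem _ (h γ f g p q hg hf hg') (h' γ f g p q hg hf hg')
  · intro e a w h γ f g p q hg hf hg'
    rw [map_smul]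
    exact Submodule.smul_mem _ _ (h γ f g p q hg hf hg')

variable {n m : ℕ}

theorem par_of_mem_fieldsCDeg (d : ℤ) (φ : FieldsC n m) (h : φ ∈ fieldsCDeg n m d) :
    Par (pty d) φ := by
  have h1 : par (inclC φ) = sg (pty d) • inclC φ := par_of_mem_fieldsDeg d (inclC φ) h
  have h2 : Function.Injective (inclC : FieldsC n m →ₗ[ℂ] Fields n m ⊤) := fun a b hab =>
    Prod.ext (Subtype.ext (congrArg Prod.fst hab)) (Subtype.ext (congrArg Prod.snd hab))
  apply h2
  rw [inclC_par, h1, map_smul]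

theorem hasDegree_Phi {j : ℤ} {x : LdR n} (hx : x ∈ dRDeg n j) :
    HasDegree (fieldsCDeg n m) (Phi n m x) (j - 1) := by
  rw [hasDegree_iff]
  intro e he w hw
  have hT := parMap_tX (m := m) (parX_of_mem hx)
  have hB : ∀ e, ∀ w ∈ grade (fieldsCDeg n m) e,
      cB n m w ∈ formsDeg ⊤ (e + (2 * n + m - 2)) := fun e w hw => (lin_mem_grade hw).2.2
  have hX : ∀ e, ∀ w ∈ grade (fieldsCDeg n m) e, tX m x w ∈ formsDeg ⊤ (e + (j + 1)) := by
    intro e w hw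
    have hl := lin_mem_grade hw
    rw [tX_eq, LinearMap.add_apply]
    refine Submodule.add_mem _ ?_ ?_
    · have : poisson (pullU ⊤ x.1) (cA n m w) ∈ formsDeg ⊤ (j + (e + 1)) :=
        poisson_mem_formsDeg (pullU_mem_formsDeg hx.1) hl.2.1
      rwa [show j + (e + 1) = e + (j + 1) by ring] at this
    · rw [const_apply]
      by_cases h0 : e = 0
      · subst h0
        rw [zero_add]
        exact Submodule.smul_mem _ _ (Submodule.neg_mem _
          (pullU_mem_formsDeg (parPow_mem_formsDeg hx.2 true)))
      · rw [hl.1 h0, zero_smul]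
        exact Submodule.zero_mem _
  have key := conv_mem_grade par_of_mem_fieldsCDeg (β := wedge) (𝒳 := formsDeg ⊤)
    (𝒴 := formsDeg ⊤) (𝒵 := formsDeg ⊤) (fun p q a ha b hb => mul_mem_formsDeg ha hb) hT hB hX hw
  have hmem : conv wedge (cB n m) (tX m x) w ∈ FormsC n m :=
    conv_mem hT (fun a b => mul_mem_FormsC (cB_mem a) _) w
  rw [Phi_apply, intB_eq hT, intMul, ← comp_conv, LinearMap.comp_apply, intExt_of_mem hmem]
  -- The integrand has form degree e + (2n + m - 2) + (j + 1), which is the top degree 2n + m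
  -- exactly when e = -(j - 1).
  refine integral_of_mem_formsDeg ?_ key
  intro h
  apply he
  linarith

end Degrees

open GSym

/-! ## Differential operators -/

section Jets

variable {n m : ℕ} {U : Opens (Spacetime n m)}

/-- Provides the finite basis in which the wedge product is expanded. Each exterior power is
finite-dimensional, and those above degree 2n + m vanish. -/
theorem finite_lam : Module.Finite ℂ (Lam n m) := by
  let E : ℕ → Submodule ℂ (Lam n m) := fun k => ⋀[ℂ]^k (Fin (n + n + m) → ℂ)
  have hfg : ∀ k, (E k).FG := fun k => by
    rw [← Module.Finite.iff_fg]
    exact exteriorPower.instFinite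
  have hz : ∀ k, n + n + m < k → E k = ⊥ := by
    intro k hk
    have h := exteriorPower.finrank_eq (R := ℂ) (M := Fin (n + n + m) → ℂ) k
    rw [Module.finrank_fin_fun, Nat.choose_eq_zero_of_lt hk] at h
    exact Submodule.finrank_eq_zero.1 h
  have htop : ⨆ k ∈ Finset.range (n + n + m + 1), E k = ⊤ := by
    rw [eq_top_iff, ← (DirectSum.Decomposition.isInternal E).submodule_iSup_eq_top]
    refine iSup_le fun k => ?_
    by_cases hk : k ∈ Finset.range (n + n + m + 1)
    · exact le_iSup₂_of_le k hk le_rfl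
    · rw [hz k (by simpa using hk)]
      exact bot_le
  exact ⟨htop ▸ Submodule.fg_biSup _ _ fun k _ => hfg k⟩

/-- Labels of the jet coordinates of a form. -/
abbrev FJet (n m : ℕ) : Type := Module.Dual ℂ (Lam n m) × List (Spacetime n m)

/-- The jet coordinates of a form. -/
def fjet (j : FJet n m) : Forms n m U →ₗ[ℂ] Smooth U :=
  j.2.foldr (fun v D => dirDeriv v ∘ₗ D) (coeff j.1)

theorem fjet_nil (l : Module.Dual ℂ (Lam n m)) : fjet (U := U) (l, []) = coeff l := rfl

theorem fjet_cons (l : Module.Dual ℂ (Lam n m)) (v : Spacetime n m) (vs : List (Spacetime n m)) :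
    fjet (U := U) (l, v :: vs) = dirDeriv v ∘ₗ fjet (l, vs) := rfl

theorem jet_eq (j : JetIndex n m) (φ : Fields n m U) :
    jet j φ = fjet j.2 (if j.1 then pA φ else pB φ) := by
  obtain ⟨b, l, vs⟩ := j
  change vs.foldr (fun v f => dirDeriv v f) (coeff l (if b then pA φ else pB φ)) = _
  induction vs with
  | nil => rfl
  | cons v vs ih => rw [List.foldr_cons, ih]; rfl

/-- Linear differential operators from forms to functions. -/
def LocLin (U : Opens (Spacetime n m)) : Submodule ℂ (Forms n m U →ₗ[ℂ] Smooth U) :=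
  Submodule.span ℂ {D | ∃ (f : Smooth U) (j : FJet n m),
    D = (LinearMap.mulLeft ℂ f : Smooth U →ₗ[ℂ] Smooth U) ∘ₗ fjet j}

/-- Bilinear differential operators from forms to functions. -/
def LocBil (U : Opens (Spacetime n m)) :
    Submodule ℂ (Forms n m U →ₗ[ℂ] Forms n m U →ₗ[ℂ] Smooth U) :=
  Submodule.span ℂ {B | ∃ (f : Smooth U) (j j' : FJet n m), B
    = (LinearMap.mul ℂ (Smooth U)).compl₁₂ (LinearMap.mulLeft ℂ f ∘ₗ fjet j) (fjet j')}

/-- Linear differential operators on forms. -/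
def IsLoc (L : Forms n m U →ₗ[ℂ] Forms n m U) : Prop := ∀ l, coeff l ∘ₗ L ∈ LocLin U

/-- Bilinear differential operators on forms. -/
def IsLoc₂ (B : Forms n m U →ₗ[ℂ] Forms n m U →ₗ[ℂ] Forms n m U) : Prop :=
  ∀ l, B.compr₂ (coeff l) ∈ LocBil U

theorem mul_mem_LocLin {D : Forms n m U →ₗ[ℂ] Smooth U} (hD : D ∈ LocLin U) (g : Smooth U) :
    LinearMap.mulLeft ℂ g ∘ₗ D ∈ LocLin U := by
  induction hD using Submodule.span_induction with
  | mem D hD =>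
    obtain ⟨f, j, rfl⟩ := hD
    refine Submodule.subset_span ⟨g * f, j, ?_⟩
    rw [← LinearMap.comp_assoc, ← LinearMap.mulLeft_mul]
  | zero => simp
  | add D E _ _ hD hE => rw [LinearMap.comp_add]; exact Submodule.add_mem _ hD hE
  | smul c D _ hD => rw [LinearMap.comp_smul]; exact Submodule.smul_mem _ _ hD

theorem fjet_mem_LocLin (j : FJet n m) :
    fjet j ∈ LocLin U :=
  Submodule.subset_span ⟨1, j, by rw [LinearMap.mulLeft_one]; rfl⟩

/-- The Leibniz rule keeps the coefficient functions to the left of the derivatives. -/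
theorem dirDeriv_mem_LocLin {D : Forms n m U →ₗ[ℂ] Smooth U} (hD : D ∈ LocLin U)
    (v : Spacetime n m) : dirDeriv v ∘ₗ D ∈ LocLin U := by
  induction hD using Submodule.span_induction with
  | mem D hD =>
    obtain ⟨f, ⟨l, vs⟩, rfl⟩ := hD
    have e : dirDeriv v ∘ₗ LinearMap.mulLeft ℂ f ∘ₗ fjet (U := U) (l, vs)
        = LinearMap.mulLeft ℂ (dirDeriv v f) ∘ₗ fjet (l, vs)
          + LinearMap.mulLeft ℂ f ∘ₗ fjet (l, v :: vs) := by
      ext1 a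
      exact dirDeriv_mul v f (fjet (l, vs) a)
    rw [e]
    exact Submodule.add_mem _ (Submodule.subset_span ⟨_, _, rfl⟩)
      (Submodule.subset_span ⟨_, _, rfl⟩)
  | zero => simp
  | add D E _ _ hD hE => rw [LinearMap.comp_add]; exact Submodule.add_mem _ hD hE
  | smul c D _ hD => rw [LinearMap.comp_smul]; exact Submodule.smul_mem _ _ hD

theorem vecs_mem_LocLin {D : Forms n m U →ₗ[ℂ] Smooth U} (hD : D ∈ LocLin U)
    {E : Smooth U →ₗ[ℂ] Smooth U} (hE : E ∈ vecs U) : E ∘ₗ D ∈ LocLin U := by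
  induction hE using Submodule.span_induction with
  | mem E hE => obtain ⟨v, rfl⟩ := hE; exact dirDeriv_mem_LocLin hD v
  | zero => simp
  | add E F _ _ hE hF => rw [LinearMap.add_comp]; exact Submodule.add_mem _ hE hF
  | smul c E _ hE => rw [LinearMap.smul_comp]; exact Submodule.smul_mem _ _ hE

theorem IsLoc.fjet {L : Forms n m U →ₗ[ℂ] Forms n m U} (hL : IsLoc L)
    (j : FJet n m) : PoissonBF.fjet j ∘ₗ L ∈ LocLin U := by
  obtain ⟨l, vs⟩ := j
  induction vs with
  | nil => exact hL l
  | cons v vs ih =>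
    rw [fjet_cons, LinearMap.comp_assoc]
    exact dirDeriv_mem_LocLin ih v

theorem mul_mem_LocBil {D E : Forms n m U →ₗ[ℂ] Smooth U} (hD : D ∈ LocLin U)
    (hE : E ∈ LocLin U) : (LinearMap.mul ℂ (Smooth U)).compl₁₂ D E ∈ LocBil U := by
  induction hD using Submodule.span_induction with
  | mem D hD =>
    obtain ⟨f, j, rfl⟩ := hD
    induction hE using Submodule.span_induction with
    | mem E hE =>
      obtain ⟨g, j', rfl⟩ := hE
      refine Submodule.subset_span ⟨f * g, j, j', ?_⟩
      ext1 a; ext1 b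
      change f * fjet j a * (g * fjet j' b) = f * g * fjet j a * fjet j' b
      ring
    | zero => convert Submodule.zero_mem _; ext a b; simp
    | add E F _ _ hE hF =>
      convert Submodule.add_mem _ hE hF using 1
      ext1 a; ext1 b
      exact mul_add _ _ _
    | smul c E _ hE =>
      convert Submodule.smul_mem _ c hE using 1
      ext1 a; ext1 b
      change (f * fjet j a) * (c • E b) = c • ((f * fjet j a) * E b)
      exact mul_smul_comm _ _ _
  | zero => convert Submodule.zero_mem _; ext a b; simp
  | add D F _ _ hD hF =>
    convert Submodule.add_mem _ hD hF using 1
    ext1 a; ext1 b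
    exact add_mul _ _ _
  | smul c D _ hD =>
    convert Submodule.smul_mem _ c hD using 1
    ext1 a; ext1 b
    change (c • D a) * E b = c • (D a * E b)
    exact smul_mul_assoc _ _ _

theorem LocBil.comp {B : Forms n m U →ₗ[ℂ] Forms n m U →ₗ[ℂ] Smooth U} (hB : B ∈ LocBil U)
    {L M : Forms n m U →ₗ[ℂ] Forms n m U} (hL : IsLoc L) (hM : IsLoc M) :
    B.compl₁₂ L M ∈ LocBil U := by
  induction hB using Submodule.span_induction with
  | mem B hB =>
    obtain ⟨f, j, j', rfl⟩ := hB
    exact mul_mem_LocBil (mul_mem_LocLin (hL.fjet j) f) (hM.fjet j')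
  | zero => exact Submodule.zero_mem _
  | add B C _ _ hB hC => exact Submodule.add_mem _ hB hC
  | smul c B _ hB => exact Submodule.smul_mem _ c hB

theorem dirDeriv_mem_LocBil {B : Forms n m U →ₗ[ℂ] Forms n m U →ₗ[ℂ] Smooth U}
    (hB : B ∈ LocBil U) (v : Spacetime n m) : B.compr₂ (dirDeriv v) ∈ LocBil U := by
  induction hB using Submodule.span_induction with
  | mem B hB =>
    obtain ⟨f, j, j', rfl⟩ := hB
    have h1 := mul_mem_LocLin (fjet_mem_LocLin (U := U) j) f
    have h2 := fjet_mem_LocLin (U := U) j'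
    convert Submodule.add_mem _ (mul_mem_LocBil (dirDeriv_mem_LocLin h1 v) h2)
      (mul_mem_LocBil h1 (dirDeriv_mem_LocLin h2 v)) using 1
    ext1 a; ext1 b
    exact dirDeriv_mul v _ _
  | zero => convert Submodule.zero_mem _; ext a b; simp
  | add B C _ _ hB hC =>
    convert Submodule.add_mem _ hB hC using 1
    ext1 a; ext1 b
    exact map_add (dirDeriv v) _ _
  | smul c B _ hB =>
    convert Submodule.smul_mem _ c hB using 1
    ext1 a; ext1 b
    exact map_smul (dirDeriv v) _ _

theorem IsLoc₂.fjet {B : Forms n m U →ₗ[ℂ] Forms n m U →ₗ[ℂ] Forms n m U} (hB : IsLoc₂ B)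
    (j : FJet n m) :
    B.compr₂ (PoissonBF.fjet j) ∈ LocBil U := by
  obtain ⟨l, vs⟩ := j
  induction vs with
  | nil => exact hB l
  | cons v vs ih => exact dirDeriv_mem_LocBil ih v

theorem apply_mem_LocLin {B : Forms n m U →ₗ[ℂ] Forms n m U →ₗ[ℂ] Smooth U} (hB : B ∈ LocBil U)
    (a : Forms n m U) : B a ∈ LocLin U := by
  induction hB using Submodule.span_induction with
  | mem B hB =>
    obtain ⟨f, j, j', rfl⟩ := hB
    exact Submodule.subset_span ⟨f * fjet j a, j', rfl⟩
  | zero => exact Submodule.zero_mem _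
  | add B C _ _ hB hC => exact Submodule.add_mem _ hB hC
  | smul c B _ hB => exact Submodule.smul_mem _ c hB

theorem flip_mem_LocBil {B : Forms n m U →ₗ[ℂ] Forms n m U →ₗ[ℂ] Smooth U} (hB : B ∈ LocBil U) :
    B.flip ∈ LocBil U := by
  induction hB using Submodule.span_induction with
  | mem B hB =>
    obtain ⟨f, j, j', rfl⟩ := hB
    refine Submodule.subset_span ⟨f, j', j, ?_⟩
    ext1 a; ext1 b
    change f * fjet j b * fjet j' a = f * fjet j' a * fjet j b
    ring
  | zero => exact Submodule.zero_mem _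
  | add B C _ _ hB hC => exact Submodule.add_mem _ hB hC
  | smul c B _ hB => exact Submodule.smul_mem _ c hB

theorem IsLoc₂.apply {B : Forms n m U →ₗ[ℂ] Forms n m U →ₗ[ℂ] Forms n m U} (hB : IsLoc₂ B)
    (a : Forms n m U) : IsLoc (B a) := fun l => apply_mem_LocLin (hB l) a

theorem isLoc_formOp {D : Smooth U →ₗ[ℂ] Smooth U} (hD : D ∈ vecs U)
    (M : Lam n m →ₗ[ℂ] Lam n m) : IsLoc (formOp D M) := fun l => by
  have e : coeff l ∘ₗ formOp D M = D ∘ₗ fjet (l ∘ₗ M, []) :=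
    LinearMap.ext fun a => coeff_formOp l D M a
  rw [e]
  exact vecs_mem_LocLin (fjet_mem_LocLin _) hD

theorem isLoc_id : IsLoc (LinearMap.id : Forms n m U →ₗ[ℂ] Forms n m U) := fun l =>
  fjet_mem_LocLin (l, [])

theorem isLoc_dForm : IsLoc (dForm : Forms n m U →ₗ[ℂ] Forms n m U) := fun l => by
  have key : ∀ T ∈ dOps U, coeff l ∘ₗ T ∈ LocLin U := by
    intro T hT
    induction hT using Submodule.span_induction with
    | mem T hT => obtain ⟨D, hD, k, rfl⟩ := hT; exact isLoc_formOp hD _ l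
    | zero => simp
    | add S T _ _ hS hT => rw [LinearMap.comp_add]; exact Submodule.add_mem _ hS hT
    | smul c T _ hT => rw [LinearMap.comp_smul]; exact Submodule.smul_mem _ _ hT
  exact key _ dForm_mem

/-- In a basis of the exterior algebra, a coefficient of a product is a finite sum of products of
coordinate functions, weighted by the structure constants l (b_p b_q). -/
theorem isLoc₂_wedge : IsLoc₂ (wedge : Forms n m U →ₗ[ℂ] Forms n m U →ₗ[ℂ] Forms n m U) := by
  intro l
  have := finite_lam (n := n) (m := m)
  let b := Module.finBasis ℂ (Lam n m)
  have e : (wedge (U := U)).compr₂ (coeff l) = ∑ p, ∑ q, l (b p * b q) •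
      (LinearMap.mul ℂ (Smooth U)).compl₁₂ (fjet (b.coord p, [])) (fjet (b.coord q, [])) := by
    ext1 x; ext1 y
    simp only [LinearMap.sum_apply, LinearMap.smul_apply, LinearMap.compl₁₂_apply, fjet_nil,
      LinearMap.mul_apply', LinearMap.compr₂_apply, wedge_apply]
    induction x using forms_induction with
    | pt f k =>
      induction y using forms_induction with
      | pt g k' =>
        have hk : l (k * k') = ∑ p, ∑ q, l (b p * b q) * (b.coord p k * b.coord q k') := by
          conv_lhs => rw [← b.sum_repr k, ← b.sum_repr k']
          simp only [Finset.sum_mul, Finset.mul_sum, map_sum, smul_mul_smul_comm, map_smul,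
            smul_eq_mul, Module.Basis.coord_apply]
          rw [Finset.sum_comm]
          exact Finset.sum_congr rfl fun p _ => Finset.sum_congr rfl fun q _ => by ring
        rw [pt_mul, coeff_pt, hk, Finset.sum_smul]
        refine Finset.sum_congr rfl fun p _ => ?_
        rw [Finset.sum_smul]
        refine Finset.sum_congr rfl fun q _ => ?_
        rw [coeff_pt, coeff_pt, smul_mul_smul_comm, smul_smul]
      | add y z hy hz =>
        simp only [mul_add, map_add, smul_add, Finset.sum_add_distrib, hy, hz]
    | add x z hx hz =>
      simp only [add_mul, map_add, smul_add, Finset.sum_add_distrib, hx, hz]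
  rw [e]
  exact Submodule.sum_mem _ fun p _ => Submodule.sum_mem _ fun q _ => Submodule.smul_mem _ _
    (mul_mem_LocBil (fjet_mem_LocLin _) (fjet_mem_LocLin _))

theorem isLoc₂_poisson : IsLoc₂ (poisson : Forms n m U →ₗ[ℂ] Forms n m U →ₗ[ℂ] Forms n m U) := by
  intro l
  have e : (poisson (U := U)).compr₂ (coeff l) = ∑ i : Fin n,
      (((wedge (U := U)).compr₂ (coeff l)).compl₁₂ (formOp (dZ i) LinearMap.id)
        (formOp (dW i) LinearMap.id)
      + (-1 : ℂ) • ((wedge (U := U)).compr₂ (coeff l)).compl₁₂ (formOp (dW i) LinearMap.id)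
        (formOp (dZ i) LinearMap.id)) := by
    ext1 x; ext1 y
    rw [LinearMap.compr₂_apply, poisson_apply, map_sum, LinearMap.sum_apply, LinearMap.sum_apply]
    refine Finset.sum_congr rfl fun i _ => ?_
    rw [map_sub, sub_eq_add_neg, ← neg_one_smul ℂ (coeff l _)]
    rfl
  rw [e]
  exact Submodule.sum_mem _ fun i _ => Submodule.add_mem _
    (LocBil.comp (isLoc₂_wedge l) (isLoc_formOp (dZ_mem i) _) (isLoc_formOp (dW_mem i) _))
    (Submodule.smul_mem _ _
      (LocBil.comp (isLoc₂_wedge l) (isLoc_formOp (dW_mem i) _) (isLoc_formOp (dZ_mem i) _)))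

end Jets

open GSym

/-! ## Locality -/

section Projections

variable {V X : Type} [AddCommGroup V] [Module ℂ V] [SuperSpace V] [AddCommGroup X] [Module ℂ X]

/-- The projection to the homogeneous part of parity `c`. -/
def prj (c : Bool) : V →ₗ[ℂ] V := (1 / 2 : ℂ) • (LinearMap.id + sg c • par)

theorem par_prj (c : Bool) (v : V) : Par c (prj c v) := by
  simp only [Par, prj, LinearMap.smul_apply, LinearMap.add_apply, LinearMap.id_apply, map_smul,
    map_add, par_par]
  cases c <;> simp only [sg_true, sg_false] <;> module

theorem prj_add_prj (v : V) : prj false v + prj true v = v := by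
  simp only [prj, LinearMap.smul_apply, LinearMap.add_apply, LinearMap.id_apply, sg_true, sg_false]
  module

theorem Kills.mon_eq_zero {p k : ℕ} {f : GSym V →ₗ[ℂ] X} (hf : Kills p f) (hk : p ≤ k)
    (φ : Fin k → V) : f (mon φ) = 0 := by
  induction p generalizing k f with
  | zero =>
    have : f = 0 := hf
    rw [this, LinearMap.zero_apply]
  | succ p ih =>
    obtain ⟨k, rfl⟩ : ∃ k', k = k' + 1 := ⟨k - 1, by omega⟩
    rw [mon_succ, ← prj_add_prj (φ 0), map_add, add_mul, map_add]
    have h : ∀ c, f (ι (prj c (φ 0)) * mon fun i => φ i.succ) = 0 := fun c =>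
      ih (hf c _ (par_prj c _)) (by omega) _
    rw [h, h, add_zero]

end Projections

section Locality

variable {n m : ℕ}

theorem LocLin.comp {U : Opens (Spacetime n m)} {D : Forms n m U →ₗ[ℂ] Smooth U}
    (hD : D ∈ LocLin U) {L : Forms n m U →ₗ[ℂ] Forms n m U} (hL : IsLoc L) :
    D ∘ₗ L ∈ LocLin U := by
  induction hD using Submodule.span_induction with
  | mem D hD =>
    obtain ⟨f, j, rfl⟩ := hD
    rw [LinearMap.comp_assoc]
    exact mul_mem_LocLin (hL.fjet j) f
  | zero => exact Submodule.zero_mem _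
  | add D E _ _ hD hE => exact Submodule.add_mem _ hD hE
  | smul c D _ hD => exact Submodule.smul_mem _ _ hD

theorem IsLoc.comp {U : Opens (Spacetime n m)} {L M : Forms n m U →ₗ[ℂ] Forms n m U}
    (hL : IsLoc L) (hM : IsLoc M) : IsLoc (L ∘ₗ M) := fun l => LocLin.comp (hL l) hM

/-- Parity projections are of order zero: they only change the functional on the exterior algebra.
Splitting fields by parity therefore preserves locality. -/
theorem isLoc_prj {U : Opens (Spacetime n m)} (c : Bool) :
    IsLoc (prj c : Forms n m U →ₗ[ℂ] Forms n m U) := fun l => by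
  have e : coeff l ∘ₗ (prj c : Forms n m U →ₗ[ℂ] Forms n m U)
      = fjet ((1 / 2 : ℂ) • (l + sg c • (l ∘ₗ par)), []) := by
    ext1 a
    rw [LinearMap.comp_apply, fjet_nil]
    induction a using forms_induction with
    | pt f k =>
      rw [prj, LinearMap.smul_apply, LinearMap.add_apply, LinearMap.smul_apply, map_smul, map_add,
        map_smul, coeff_par, LinearMap.id_apply, coeff_pt, coeff_pt, coeff_pt, smul_smul,
        ← add_smul, smul_smul]
      rfl
    | add a b ha hb => rw [map_add, map_add, map_add, ha, hb]
  rw [e]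
  exact fjet_mem_LocLin _

theorem pA_prj (c : Bool) (φ : FieldsC n m) : pA (inclC (prj c φ)) = prj (!c) (pA (inclC φ)) := by
  simp only [prj, LinearMap.smul_apply, LinearMap.add_apply, LinearMap.id_apply, map_smul, map_add,
    inclC_par, pA_par]
  cases c <;> simp

theorem pB_prj (c : Bool) (φ : FieldsC n m) :
    pB (inclC (prj c φ)) = prj (xor c (pty m)) (pB (inclC φ)) := by
  simp only [prj, LinearMap.smul_apply, LinearMap.add_apply, LinearMap.id_apply, map_smul, map_add,
    inclC_par, pB_par]
  cases c <;> cases pty m <;> simp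

/-- Derivatives of a coefficient are coefficients of another compactly supported form, so
integrability of coefficients covers all jets. -/
theorem fjet_mem_FormsC (j : FJet n m) {a : Forms n m ⊤} (ha : a ∈ FormsC n m) :
    ∃ a' ∈ FormsC n m, fjet j a = coeff j.1 a' := by
  obtain ⟨l, vs⟩ := j
  induction vs with
  | nil => exact ⟨a, ha, rfl⟩
  | cons v vs ih =>
    obtain ⟨a', ha', e⟩ := ih
    refine ⟨formOp (dirDeriv v) LinearMap.id a', formOp_mem (dirDeriv_mem v) _ ha', ?_⟩
    rw [coeff_formOp, fjet_cons, LinearMap.comp_apply, e, LinearMap.comp_id]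

theorem coeff_mul_left {U : Opens (Spacetime n m)} (l : Module.Dual ℂ (Lam n m)) (f : Smooth U)
    (a : Forms n m U) : coeff l (pt f 1 * a) = f * coeff l a := by
  induction a using forms_induction with
  | pt g k => rw [pt_mul, coeff_pt, coeff_pt, one_mul, mul_smul_comm]
  | add a b ha hb => rw [mul_add, map_add, ha, hb, map_add, mul_add]

/-- Integrability is what makes the integrals in `locFun_one` and `locFun_two` additive in the
differential operator. -/
theorem integrable_LocLin {D : Forms n m ⊤ →ₗ[ℂ] Smooth (⊤ : Opens (Spacetime n m))} (hD : D ∈ LocLin ⊤) {a : Forms n m ⊤}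
    (ha : a ∈ FormsC n m) :
    MeasureTheory.Integrable (fun x : Spacetime n m => (D a).1 ⟨x, trivial⟩) := by
  induction hD using Submodule.span_induction with
  | mem D hD =>
    obtain ⟨f, j, rfl⟩ := hD
    obtain ⟨a', ha', e⟩ := fjet_mem_FormsC j ha
    have e2 : (LinearMap.mulLeft ℂ f ∘ₗ fjet j) a = coeff j.1 (pt f 1 * a') := by
      rw [coeff_mul_left, ← e]
      rfl
    rw [e2]
    exact integrable_of_FormsC (mul_mem_FormsC' ha' _) _
  | zero => exact MeasureTheory.integrable_zero _ _ _
  | add D E _ _ hD hE => exact hD.add hE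
  | smul c D _ hD => exact hD.smul c

/-- The functions of `k` fields which are integrals of local densities. -/
def LocFun (n m k : ℕ) : Submodule ℂ ((Fin k → FieldsC n m) → ℂ) :=
  Submodule.span ℂ {T : (Fin k → FieldsC n m) → ℂ |
    ∃ (f : Smooth (⊤ : Opens (Spacetime n m))) (j : Fin k → JetIndex n m),
      ∀ φ, T φ = ∫ x : Spacetime n m,
        f.1 ⟨x, trivial⟩ * ∏ i, (jet (j i) (inclC (φ i))).1 ⟨x, trivial⟩}

theorem locFun_one {D : Forms n m ⊤ →ₗ[ℂ] Smooth (⊤ : Opens (Spacetime n m))} (hD : D ∈ LocLin ⊤) :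
    (fun φ : Fin 1 → FieldsC n m =>
      ∫ x : Spacetime n m, (D (pB (inclC (φ 0)))).1 ⟨x, trivial⟩) ∈ LocFun n m 1 := by
  induction hD using Submodule.span_induction with
  | mem D hD =>
    obtain ⟨f, j, rfl⟩ := hD
    refine Submodule.subset_span ⟨f, fun _ => (false, j), fun φ => ?_⟩
    simp only [Fin.prod_univ_one, jet_eq]
    rfl
  | zero =>
    convert Submodule.zero_mem _
    exact MeasureTheory.integral_zero _ _
  | add D E hD' hE' hD hE =>
    convert Submodule.add_mem _ hD hE using 1
    ext φ
    exact MeasureTheory.integral_add (integrable_LocLin hD' (φ 0).2.2)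
      (integrable_LocLin hE' (φ 0).2.2)
  | smul c D _ hD =>
    convert Submodule.smul_mem _ c hD using 1
    ext φ
    exact MeasureTheory.integral_const_mul c _

/-- The flag `s` records which of the two arguments fills the B-slot; the polarised quadratic
functional contains both placements. -/
theorem locFun_two {B : Forms n m ⊤ →ₗ[ℂ] Forms n m ⊤ →ₗ[ℂ] Smooth (⊤ : Opens (Spacetime n m))} (hB : B ∈ LocBil ⊤)
    (s : Bool) :
    (fun φ : Fin 2 → FieldsC n m => ∫ x : Spacetime n m,
      (B (pB (inclC (φ (if s then 1 else 0)))) (pA (inclC (φ (if s then 0 else 1))))).1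
        ⟨x, trivial⟩) ∈ LocFun n m 2 := by
  induction hB using Submodule.span_induction with
  | mem B hB =>
    obtain ⟨f, j, j', rfl⟩ := hB
    cases s
    · refine Submodule.subset_span ⟨f, ![(false, j), (true, j')], fun φ => ?_⟩
      simp only [Fin.prod_univ_two, jet_eq]
      refine congrArg _ (funext fun x => ?_)
      exact mul_assoc _ _ _
    · refine Submodule.subset_span ⟨f, ![(true, j'), (false, j)], fun φ => ?_⟩
      simp only [Fin.prod_univ_two, jet_eq]
      refine congrArg _ (funext fun x => ?_)
      refine (mul_assoc _ _ _).trans ?_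
      congr 1
      exact mul_comm _ _
  | zero =>
    convert Submodule.zero_mem _
    exact MeasureTheory.integral_zero _ _
  | add B C hB' hC' hB hC =>
    convert Submodule.add_mem _ hB hC using 1
    ext φ
    exact MeasureTheory.integral_add (integrable_LocLin (apply_mem_LocLin hB' _) (φ _).1.2)
      (integrable_LocLin (apply_mem_LocLin hC' _) (φ _).1.2)
  | smul c B _ hB =>
    convert Submodule.smul_mem _ c hB using 1
    ext φ
    exact MeasureTheory.integral_const_mul c _

/-- The density of `∫ L a ∧ M b`. -/
def dens (L M : Forms n m ⊤ →ₗ[ℂ] Forms n m ⊤) : Forms n m ⊤ →ₗ[ℂ] Forms n m ⊤ →ₗ[ℂ] 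
    Smooth (⊤ : Opens (Spacetime n m)) :=
  ((wedge (U := (⊤ : Opens (Spacetime n m)))).compr₂ (coeff (U := (⊤ : Opens (Spacetime n m)))
    topLam)).compl₁₂ L M

theorem dens_mem {L M : Forms n m ⊤ →ₗ[ℂ] Forms n m ⊤} (hL : IsLoc L) (hM : IsLoc M) :
    dens L M ∈ LocBil (⊤ : Opens (Spacetime n m)) :=
  LocBil.comp (isLoc₂_wedge _) hL hM

theorem intMul_eq {b : Forms n m ⊤} (hb : b ∈ FormsC n m) (t : Forms n m ⊤) :
    intMul b t = 4 ^ n * ∫ x : Spacetime n m, (coeff topLam (b * t)).1 ⟨x, trivial⟩ :=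
  intExt_of_mem (mul_mem_FormsC hb t)

theorem intMul_pB (φ : FieldsC n m) (t : Forms n m ⊤) :
    intMul (pB (inclC φ)) t
      = 4 ^ n * ∫ x : Spacetime n m, (coeff topLam (pB (inclC φ) * t)).1 ⟨x, trivial⟩ :=
  intMul_eq φ.2.2 t

theorem tX_ι (x : LdR n) (φ : FieldsC n m) :
    tX m x (ι φ) = poisson (pullU ⊤ x.1) (pA (inclC φ)) := by
  simp [tX_eq, cA]

theorem kills_tX (x : LdR n) : Kills 2 (tX m x) := by
  rw [tX_eq]
  exact (kills_lin (poisson (pullU ⊤ x.1) ∘ₗ pA ∘ₗ inclC)).add (kills_const _).succ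

theorem cB_one : cB n m 1 = 0 := by simp [cB]

theorem cB_ι (φ : FieldsC n m) : cB n m (ι φ) = pB (inclC φ) := by simp [cB]

theorem cB_mul (φ ψ : FieldsC n m) : cB n m (ι φ * ι ψ) = 0 := by simp [cB]

theorem locFun_constant {i : Bool} {x : LdR n} (hx : ParX i x) :
    (fun φ : Fin 1 → FieldsC n m => conv intMul (cB n m) (tX m x) (ι (φ 0))) ∈ LocFun n m 1 := by
  have hT := parMap_tX (m := m) hx
  have key : ∀ c, (fun φ : Fin 1 → FieldsC n m =>
      conv intMul (cB n m) (tX m x) (ι (prj c (φ 0)))) ∈ LocFun n m 1 := by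
    intro c
    -- In symmetric degree one B meets only the fixed form T(1). Freezing that argument of the
    -- bilinear density leaves a linear differential operator in B.
    have hD := apply_mem_LocLin (flip_mem_LocBil
      (dens_mem (isLoc_prj (n := n) (m := m) (xor c (pty m))) isLoc_id)) (tX m x 1)
    convert (LocFun n m 1).smul_mem (sg ((!i) && c) * 4 ^ n) (locFun_one hD) using 1
    ext φ
    rw [conv_ι _ _ hT (par_prj c _), cB_one, map_zero, LinearMap.zero_apply, add_zero, cB_ι,
      intMul_pB, pB_prj, smul_eq_mul, ← mul_assoc]
    rfl
  convert (LocFun n m 1).add_mem (key false) (key true) using 1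
  ext φ
  rw [Pi.add_apply, ← map_add, ← map_add, prj_add_prj]

theorem intMul_prj_poisson_prj (a : Forms n m ⊤) (c d : Bool) (φ ψ : FieldsC n m) :
    intMul (pB (inclC (prj c φ))) (poisson a (pA (inclC (prj d ψ))))
      = 4 ^ n * ∫ y : Spacetime n m, (dens (prj (xor c (pty m)))
          (poisson a ∘ₗ prj (!d)) (pB (inclC φ)) (pA (inclC ψ))).1 ⟨y, trivial⟩ := by
  rw [intMul_pB, pB_prj, pA_prj]
  rfl

theorem conv_intMul_ι_ι {i c d : Bool} {x : LdR n} (hx : ParX i x)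
    {φ ψ : FieldsC n m} (hφ : Par c φ) (hψ : Par d ψ) :
    conv intMul (cB n m) (tX m x) (ι φ * ι ψ)
      = sg ((!i) && c) • intMul (pB (inclC φ)) (poisson (pullU ⊤ x.1) (pA (inclC ψ)))
        + sg (xor (!i) c && d) • intMul (pB (inclC ψ))
          (poisson (pullU ⊤ x.1) (pA (inclC φ))) := by
  rw [conv_ι_ι intMul (cB n m) (parMap_tX hx) hφ hψ, cB_one, cB_mul, cB_ι, cB_ι, tX_ι, tX_ι]
  simp only [map_zero, LinearMap.zero_apply, smul_zero, zero_add, add_zero]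

theorem locFun_quadratic_hom {i : Bool} {x : LdR n} (hx : ParX i x) (c d : Bool) :
    (fun φ : Fin 2 → FieldsC n m =>
      conv intMul (cB n m) (tX m x) (ι (prj c (φ 0)) * ι (prj d (φ 1)))) ∈ LocFun n m 2 := by
  have hB : ∀ c d, dens (prj (xor c (pty m))) (poisson (pullU (m := m) ⊤ x.1) ∘ₗ prj (!d))
      ∈ LocBil (⊤ : Opens (Spacetime n m)) :=
    fun c d => dens_mem (n := n) (m := m) (isLoc_prj _) ((isLoc₂_poisson.apply _).comp (isLoc_prj _))
  have e : ∀ φ : Fin 2 → FieldsC n m, _ := fun φ =>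
    conv_intMul_ι_ι (m := m) hx (par_prj c (φ 0)) (par_prj d (φ 1))
  simp only [e, intMul_prj_poisson_prj, smul_eq_mul, ← mul_assoc]
  exact (LocFun n m 2).add_mem
    ((LocFun n m 2).smul_mem (sg ((!i) && c) * 4 ^ n) (locFun_two (hB c d) false))
    ((LocFun n m 2).smul_mem (sg (xor (!i) c && d) * 4 ^ n) (locFun_two (hB d c) true))

theorem locFun_quadratic {i : Bool} {x : LdR n} (hx : ParX i x) :
    (fun φ : Fin 2 → FieldsC n m => conv intMul (cB n m) (tX m x) (ι (φ 0) * ι (φ 1)))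
      ∈ LocFun n m 2 := by
  convert (LocFun n m 2).add_mem
    ((LocFun n m 2).add_mem (locFun_quadratic_hom hx false false)
      (locFun_quadratic_hom hx false true))
    ((LocFun n m 2).add_mem (locFun_quadratic_hom hx true false)
      (locFun_quadratic_hom hx true true)) using 1
  ext φ
  rw [Pi.add_apply, Pi.add_apply, Pi.add_apply, ← map_add, ← mul_add, ← map_add, ← map_add,
    ← mul_add, ← map_add, ← map_add, ← add_mul, ← map_add, prj_add_prj, prj_add_prj]

theorem Phi_mem_Oloc_hom {i : Bool} {x : LdR n} (hx : ParX i x) : Phi n m x ∈ Oloc n m := by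
  have hT := parMap_tX (m := m) hx
  refine ⟨Phi_one x, fun k => ?_⟩
  change _ ∈ LocFun n m (k + 1)
  rw [Phi_apply, intB_eq hT]
  match k with
  | 0 =>
    simp only [mon_succ, mon_zero, mul_one]
    exact locFun_constant hx
  | 1 =>
    simp only [mon_succ, mon_zero, mul_one]
    exact locFun_quadratic hx
  -- Each of B and T sees at most one field, so the components of symmetric degree three and more
  -- vanish.
  | k + 2 =>
    convert (LocFun n m (k + 3)).zero_mem
    exact Kills.mon_eq_zero (kills_conv intMul 1 1 (kills_lin (pB ∘ₗ inclC)) (kills_tX x) hT)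
      (by omega) _

theorem Phi_mem_Oloc (x : LdR n) : Phi n m x ∈ Oloc n m := by
  induction x using LdR_induction with
  | hom i x hx => exact Phi_mem_Oloc_hom hx
  | add x y hx hy => rw [map_add]; exact Submodule.add_mem _ hx hy

theorem isInnerAction_Phi : IsInnerAction (Phi n m) where
  isLocal := Phi_mem_Oloc
  degree _ _ := hasDegree_Phi
  diff := isBVBracket_diff
  bracket := isBVBracket_bracket

end Locality

open GSym

/-! ## Bounds on graded-symmetric algebras -/

section Sizes

variable {V X Y Z : Type} [AddCommGroup V] [Module ℂ V] [SuperSpace V] [AddCommGroup X]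
  [Module ℂ X]

/-- `P v c` expresses that the size of `v` is at most `c`. -/
structure IsGauge (P : X → ℝ → Prop) : Prop where
  nonneg : ∀ {v c}, P v c → 0 ≤ c
  zero : P 0 0
  add : ∀ {v w c d}, P v c → P w d → P (v + w) (c + d)
  smul : ∀ (a : ℂ) {v c}, P v c → P (a • v) (‖a‖ * c)
  mono : ∀ {v c d}, P v c → c ≤ d → P v d

/-- The projective size of the elements of symmetric degree at most `k`. -/
inductive Size (P : V → ℝ → Prop) : ℕ → GSym V → ℝ → Prop
  | one {k : ℕ} : Size P k 1 1
  | mul {k : ℕ} {v : V} {w : GSym V} {c d : ℝ} : P v c → Size P k w d →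
      Size P (k + 1) (ι v * w) (c * d)
  | add {k : ℕ} {w w' : GSym V} {c d : ℝ} : Size P k w c → Size P k w' d →
      Size P k (w + w') (c + d)
  | smul {k : ℕ} (a : ℂ) {w : GSym V} {c : ℝ} : Size P k w c → Size P k (a • w) (‖a‖ * c)
  | mono {k k' : ℕ} {w : GSym V} {c d : ℝ} : Size P k w c → k ≤ k' → c ≤ d → Size P k' w d

/-- The projective size of the elements of `GSym V ⊗ GSym V` of degree at most `k`. -/
inductive Size₂ (P : V → ℝ → Prop) : ℕ → GSym V ⊗[ℂ] GSym V → ℝ → Prop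
  | tmul {i j k : ℕ} {x y : GSym V} {c d : ℝ} : Size P i x c → Size P j y d → i + j ≤ k →
      Size₂ P k (x ⊗ₜ y) (c * d)
  | add {k : ℕ} {s t : GSym V ⊗[ℂ] GSym V} {c d : ℝ} : Size₂ P k s c → Size₂ P k t d →
      Size₂ P k (s + t) (c + d)
  | smul {k : ℕ} (a : ℂ) {t : GSym V ⊗[ℂ] GSym V} {c : ℝ} : Size₂ P k t c →
      Size₂ P k (a • t) (‖a‖ * c)
  | mono {k k' : ℕ} {t : GSym V ⊗[ℂ] GSym V} {c d : ℝ} : Size₂ P k t c → k ≤ k' → c ≤ d →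
      Size₂ P k' t d

variable {P P' : V → ℝ → Prop} {k : ℕ}

theorem Size.nonneg (hP : IsGauge P) {w : GSym V} {c : ℝ} (h : Size P k w c) : 0 ≤ c := by
  induction h with
  | one => exact zero_le_one
  | mul hv _ h => exact mul_nonneg (hP.nonneg hv) h
  | add _ _ h h' => exact add_nonneg h h'
  | smul a _ h => exact mul_nonneg (norm_nonneg a) h
  | mono _ _ hc h => exact h.trans hc

theorem Size.imp (hPP : ∀ v c, P v c → P' v c) {w : GSym V} {c : ℝ} (h : Size P k w c) :
    Size P' k w c := by
  induction h with
  | one => exact .one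
  | mul hv _ h => exact .mul (hPP _ _ hv) h
  | add _ _ h h' => exact .add h h'
  | smul a _ h => exact .smul a h
  | mono _ hk hc h => exact .mono h hk hc

theorem Size.par (hp : ∀ v c, P v c → P (par v) c) {w : GSym V} {c : ℝ} (h : Size P k w c) :
    Size P k (SuperSpace.par w) c := by
  induction h with
  | one => rw [par_one]; exact .one
  | mul hv _ h => rw [par_mul, par_ι]; exact .mul (hp _ _ hv) h
  | add _ _ h h' => rw [map_add]; exact .add h h'
  | smul a _ h => rw [map_smul]; exact .smul a h
  | mono _ hk hc h => exact .mono h hk hc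

theorem Size.parPow (hp : ∀ v c, P v c → P (SuperSpace.par v) c) (b : Bool) {w : GSym V} {c : ℝ}
    (h : Size P k w c) : Size P k (PoissonBF.parPow b w) c := by
  cases b
  · exact h
  · exact h.par hp

theorem gauge_ev_od (hP : IsGauge P) (hp : ∀ v c, P v c → P (par v) c) {v : V} {c : ℝ}
    (h : P v c) : P (ev v) c ∧ P (od v) c := by
  have hn : P (-par v) c := by
    have := hP.smul (-1) (hp v c h)
    rwa [neg_one_smul, norm_neg, norm_one, one_mul] at this
  have e : ‖(1 / 2 : ℂ)‖ * (c + c) = c := by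
    rw [norm_div, norm_one, Complex.norm_ofNat]
    ring
  constructor
  · have := hP.smul (1 / 2) (hP.add h (hp v c h))
    rwa [e] at this
  · have := hP.smul (1 / 2) (hP.add h hn)
    rwa [e, ← sub_eq_add_neg] at this

/-- Each of the three terms in the definition of `stepComul` is bounded by c d, hence the factor 3.
Invariance of the gauge under parity controls the even and odd parts of `v` and the parity of the
left factor. -/
theorem Size₂.stepComul (hP : IsGauge P) (hp : ∀ v c, P v c → P (par v) c) {v : V} {c : ℝ}
    (hv : P v c) {t : GSym V ⊗[ℂ] GSym V} {d : ℝ} (h : Size₂ P k t d) :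
    Size₂ P (k + 1) (GSym.stepComul v t) (3 * c * d) := by
  induction h with
  | @tmul i j k x y a b hx hy hk =>
    obtain ⟨he, ho⟩ := gauge_ev_od hP hp hv
    have h1 := Size₂.tmul (Size.mul hv hx) hy (by omega : i + 1 + j ≤ k + 1)
    have h2 := Size₂.tmul hx (Size.mul he hy) (by omega : i + (j + 1) ≤ k + 1)
    have h3 := Size₂.tmul (hx.par hp) (Size.mul ho hy) (by omega : i + (j + 1) ≤ k + 1)
    exact ((h1.add h2).add h3).mono le_rfl (by ring_nf; rfl)
  | add _ _ h h' => rw [map_add]; exact (h.add h').mono le_rfl (by ring_nf; rfl)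
  | smul a _ h => rw [map_smul]; exact (h.smul a).mono le_rfl (by ring_nf; rfl)
  | mono _ hk hc h =>
    exact h.mono (by omega) (mul_le_mul_of_nonneg_left hc
      (mul_nonneg zero_le_three (hP.nonneg hv)))

theorem Size.comul (hP : IsGauge P) (hp : ∀ v c, P v c → P (SuperSpace.par v) c) {w : GSym V}
    {c : ℝ} (h : Size P k w c) : Size₂ P k (GSym.comul w) (3 ^ k * c) := by
  induction h with
  | @one k =>
    rw [comul_one]
    exact (Size₂.tmul (k := k) (Size.one (k := 0)) (Size.one (k := 0)) (by omega)).mono le_rfl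
      (by rw [mul_one, mul_one]; exact one_le_pow₀ (by norm_num))
  | mul hv _ h =>
    rw [comul_ι_mul]
    exact (h.stepComul hP hp hv).mono le_rfl (by ring_nf; rfl)
  | add _ _ h h' => rw [map_add]; exact (h.add h').mono le_rfl (by ring_nf; rfl)
  | smul a _ h => rw [map_smul]; exact (h.smul a).mono le_rfl (by ring_nf; rfl)
  | @mono k k' w c d hw hk hc h =>
    exact h.mono hk (mul_le_mul (pow_le_pow_right₀ (by norm_num) hk) hc (hw.nonneg hP)
      (by positivity))

theorem Size.aug (hP : IsGauge P) {w : GSym V} {c : ℝ} (h : Size P k w c) :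
    ‖GSym.aug w‖ ≤ c := by
  induction h with
  | one => simp
  | mul hv hw _ =>
    rw [aug_ι_mul, norm_zero]
    exact mul_nonneg (hP.nonneg hv) (hw.nonneg hP)
  | add _ _ h h' => rw [map_add]; exact (norm_add_le _ _).trans (add_le_add h h')
  | smul a _ h => rw [map_smul, norm_smul]; exact mul_le_mul_of_nonneg_left h (norm_nonneg a)
  | mono _ _ hc h => exact h.trans hc

theorem Size.lin (hP : IsGauge P) {w : GSym V} {c : ℝ} (h : Size P k w c) : P (GSym.lin w) c := by
  induction h with
  | one => rw [lin_one]; exact hP.mono hP.zero zero_le_one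
  | mul hv hw _ =>
    rw [lin_ι_mul]
    refine hP.mono (hP.smul _ hv) ?_
    rw [mul_comm]
    exact mul_le_mul_of_nonneg_left (hw.aug hP) (hP.nonneg hv)
  | add _ _ h h' => rw [map_add]; exact hP.add h h'
  | smul a _ h => rw [map_smul]; exact hP.smul a h
  | mono _ _ hc h => exact hP.mono h hc

theorem size_mon (φ : Fin k → V) (c : Fin k → ℝ) (h : ∀ i, P (φ i) (c i)) :
    Size P k (mon φ) (∏ i, c i) := by
  induction k with
  | zero => rw [mon_zero, Fin.prod_univ_zero]; exact .one
  | succ k ih =>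
    rw [mon_succ, Fin.prod_univ_succ]
    exact .mul (h 0) (ih _ _ fun i => h i.succ)

/-- Passes from estimates on monomials to all elements with a size bound. In the product step the
leading letter is absorbed into `F`, so `F` and its constant are generalised; all lengths up to `k`
are needed since `Size` bounds the degree only from above. -/
theorem Size.norm_le {w : GSym V} {c : ℝ} (h : Size P k w c)
    {F : Module.Dual ℂ (GSym V)} {C : ℝ} (hF : ∀ r ≤ k, ∀ (φ : Fin r → V) (d : Fin r → ℝ),
      (∀ i, P (φ i) (d i)) → ‖F (mon φ)‖ ≤ C * ∏ i, d i) : ‖F w‖ ≤ C * c := by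
  induction h generalizing F C with
  | one => simpa [mon_zero] using hF 0 (Nat.zero_le _) Fin.elim0 Fin.elim0 fun i => i.elim0
  | @mul k v w c d hv hw h =>
    rw [← mul_assoc]
    refine h (F := cut v F) fun r hr φ e he => ?_
    have := hF (r + 1) (by omega) (Fin.cons v φ) (Fin.cons c e)
      (Fin.cases hv he)
    rwa [mon_succ, Fin.prod_univ_succ, ← mul_assoc] at this
  | add _ _ h h' =>
    rw [map_add, mul_add]
    exact (norm_add_le _ _).trans (add_le_add (h hF) (h' hF))
  | smul a _ h =>
    rw [map_smul, norm_smul, mul_left_comm]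
    exact mul_le_mul_of_nonneg_left (h hF) (norm_nonneg a)
  | mono hw hk hc h =>
    refine (h fun r hr => hF r (hr.trans hk)).trans (mul_le_mul_of_nonneg_left hc ?_)
    have := hF 0 (Nat.zero_le _) Fin.elim0 Fin.elim0 fun i => i.elim0
    rw [Fin.prod_univ_zero, mul_one] at this
    exact (norm_nonneg _).trans this

/-- `D` may lose derivatives: the value is measured in the weaker gauge `P'`. The letters it leaves
untouched satisfy `P'` as well, by `hPP`. -/
theorem Size.lins (hP : IsGauge P) (hp : ∀ v c, P v c → P (SuperSpace.par v) c)
    (hPP : ∀ v c, P v c → P' v c) {D : GSym V →ₗ[ℂ] V} {M : ℝ} (hM : 0 ≤ M)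
    (hD : ∀ w c, Size P k w c → P' (D w) (M * c)) {w : GSym V} {c : ℝ} (h : Size P k w c) :
    Size P' (k + 1) (GSym.lins D w) (M * (3 ^ k * c)) := by
  have key : ∀ (j : ℕ) (t : GSym V ⊗[ℂ] GSym V) (e : ℝ), Size₂ P j t e → j ≤ k →
      Size P' (k + 1) (TensorProduct.lift (LinearMap.mul ℂ (GSym V))
        (TensorProduct.map (ι ∘ₗ D) LinearMap.id t)) (M * e) := by
    intro j t e ht hj
    induction ht with
    | tmul hx hy hk =>
      rw [← mul_assoc]
      exact (Size.mul (hD _ _ (hx.mono (by omega) le_rfl)) (hy.imp hPP)).mono (by omega) le_rfl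
    | add _ _ h h' => rw [map_add, map_add, mul_add]; exact (h hj).add (h' hj)
    | smul a _ h => rw [map_smul, map_smul, mul_left_comm]; exact (h hj).smul a
    | mono _ hk hc h => exact (h (hk.trans hj)).mono le_rfl (mul_le_mul_of_nonneg_left hc hM)
  exact key k _ _ (h.comul hP hp) le_rfl

theorem Size.conv [AddCommGroup Y] [Module ℂ Y] [SuperSpace Y] [AddCommGroup Z] [Module ℂ Z]
    (hP : IsGauge P) (hp : ∀ v c, P v c → P (SuperSpace.par v) c) {Q : X → ℝ → Prop}
    {Q' : Y → ℝ → Prop} {R : Z → ℝ → Prop} (hR : IsGauge R) {β : X →ₗ[ℂ] Y →ₗ[ℂ] Z} {N : ℝ}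
    (hN : 0 ≤ N) (hβ : ∀ x y c d, Q x c → Q' y d → R (β x y) (N * (c * d)))
    {f : GSym V →ₗ[ℂ] X} {g : GSym V →ₗ[ℂ] Y} {γ : Bool} (hγ : ParMap γ g) {M M' : ℝ}
    (hM : 0 ≤ M) (hM' : 0 ≤ M') (hf : ∀ w c, Size P k w c → Q (f w) (M * c))
    (hg : ∀ w c, Size P k w c → Q' (g w) (M' * c)) {w : GSym V} {c : ℝ} (h : Size P k w c) :
    R (PoissonBF.conv β f g w) (N * M * M' * 3 ^ k * c) := by
  have hK : 0 ≤ N * M * M' := mul_nonneg (mul_nonneg hN hM) hM'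
  have key : ∀ (j : ℕ) (t : GSym V ⊗[ℂ] GSym V) (e : ℝ), Size₂ P j t e → j ≤ k →
      R (TensorProduct.lift (β.compl₁₂ (f ∘ₗ PoissonBF.parPow γ) g) t) (N * M * M' * e) := by
    intro j t e ht hj
    induction ht with
    | tmul hx hy hk =>
      refine hR.mono (hβ _ _ _ _ (hf _ _ ((hx.parPow hp γ).mono (by omega) le_rfl))
        (hg _ _ (hy.mono (by omega) le_rfl))) (by ring_nf; rfl)
    | add _ _ h h' => rw [map_add, mul_add]; exact hR.add (h hj) (h' hj)
    | smul a _ h => rw [map_smul, mul_left_comm]; exact hR.smul a (h hj)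
    | mono _ hk hc h => exact hR.mono (h (hk.trans hj)) (mul_le_mul_of_nonneg_left hc hK)
  rw [conv_apply β f hγ, mul_assoc]
  exact key k _ _ (h.comul hP hp) le_rfl

end Sizes

open GSym

/-! ## Continuity of the vector fields -/

section Continuity

variable {n m : ℕ} {U : Opens (Spacetime n m)}

theorem continuous_smooth (f : Smooth U) : Continuous f.1 := by
  have h := f.2.continuousOn.domRestrict
  exact h.congr fun x => extendZero_apply f.1 x

/-- The jets of the form `a` with labels in `S` are bounded by `c` on `K`. -/
def JetBound (K : Set U) (S : List (FJet n m)) (a : Forms n m U) (c : ℝ) : Prop :=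
  0 ≤ c ∧ ∀ j ∈ S, ∀ x ∈ K, ‖(fjet j a).1 x‖ ≤ c

theorem isGauge_jetBound (K : Set U) (S : List (FJet n m)) : IsGauge (JetBound K S) where
  nonneg h := h.1
  zero := ⟨le_rfl, fun j _ x _ => by rw [map_zero]; exact norm_zero.le⟩
  add h h' := ⟨add_nonneg h.1 h'.1, fun j hj x hx => by
    rw [map_add]
    exact (norm_add_le _ _).trans (add_le_add (h.2 j hj x hx) (h'.2 j hj x hx))⟩
  smul a _ _ h := ⟨mul_nonneg (norm_nonneg a) h.1, fun j hj x hx => by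
    rw [map_smul]
    exact (norm_smul_le a _).trans (mul_le_mul_of_nonneg_left (h.2 j hj x hx) (norm_nonneg a))⟩
  mono h hc := ⟨h.1.trans hc, fun j hj x hx => (h.2 j hj x hx).trans hc⟩

theorem JetBound.subset {K : Set U} {S S' : List (FJet n m)} (hS : S ⊆ S') {a : Forms n m U}
    {c : ℝ} (h : JetBound K S' a c) : JetBound K S a c :=
  ⟨h.1, fun j hj => h.2 j (hS hj)⟩

/-- The label of the jet coordinate `j` precomposed with the parity involution. -/
def parJet (j : FJet n m) : FJet n m := (j.1 ∘ₗ par, j.2)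

theorem parJet_parJet (j : FJet n m) : parJet (parJet j) = j := by
  refine Prod.ext (LinearMap.ext fun l => ?_) rfl
  change j.1 (par (par l)) = j.1 l
  rw [par_par]

theorem fjet_par (j : FJet n m) (a : Forms n m U) : fjet j (par a) = fjet (parJet j) a := by
  obtain ⟨l, vs⟩ := j
  induction vs with
  | nil => exact coeff_par l a
  | cons v vs ih =>
    rw [fjet_cons, LinearMap.comp_apply, ih]
    rfl

/-- The closure of a list of labels under the parity involution. -/
def sat (S : List (FJet n m)) : List (FJet n m) := S ++ S.map parJet

/-- Precomposition with parity is an involution on labels, so a saturated list is stable under it.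
This supplies the parity invariance assumed in the size estimates. -/
theorem JetBound.par {K : Set U} {S : List (FJet n m)} {a : Forms n m U} {c : ℝ}
    (h : JetBound K (sat S) a c) : JetBound K (sat S) (SuperSpace.par a) c := by
  refine ⟨h.1, fun j hj x hx => ?_⟩
  rw [fjet_par]
  refine h.2 _ ?_ x hx
  rw [sat, List.mem_append, List.mem_map] at hj ⊢
  rcases hj with hj | ⟨i, hi, rfl⟩
  · exact Or.inr ⟨j, hj, rfl⟩
  · rw [parJet_parJet]
    exact Or.inl hi

/-- The jets of the components of the field `φ` with labels in `sat S` are bounded by `c` on `K`. -/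
def FieldBound (K : Set U) (S : List (FJet n m)) (φ : Fields n m U) (c : ℝ) : Prop :=
  JetBound K (sat S) (pA φ) c ∧ JetBound K (sat S) (pB φ) c

theorem isGauge_fieldBound (K : Set U) (S : List (FJet n m)) : IsGauge (FieldBound K S) where
  nonneg h := h.1.1
  zero := ⟨(isGauge_jetBound _ _).zero, (isGauge_jetBound _ _).zero⟩
  add h h' := ⟨(isGauge_jetBound _ _).add h.1 h'.1, (isGauge_jetBound _ _).add h.2 h'.2⟩
  smul a _ _ h := ⟨(isGauge_jetBound _ _).smul a h.1, (isGauge_jetBound _ _).smul a h.2⟩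
  mono h hc := ⟨(isGauge_jetBound _ _).mono h.1 hc, (isGauge_jetBound _ _).mono h.2 hc⟩

theorem FieldBound.par {K : Set U} {S : List (FJet n m)} (φ : Fields n m U) (c : ℝ)
    (h : FieldBound K S φ c) : FieldBound K S (SuperSpace.par φ) c := by
  have hn : ∀ {a : Forms n m U} (b : Bool), JetBound K (sat S) a c →
      JetBound K (sat S) (sg b • a) c := fun b ha => by
    have := (isGauge_jetBound _ _).smul (sg b) ha
    rwa [show ‖sg b‖ = 1 by cases b <;> simp [sg], one_mul] at this
  refine ⟨?_, ?_⟩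
  · rw [pA_par, ← neg_one_smul ℂ]
    exact hn true h.1.par
  · rw [pB_par]
    exact hn _ h.2.par

theorem FieldBound.subset {K : Set U} {S S' : List (FJet n m)} (hS : S ⊆ S') (φ : Fields n m U)
    (c : ℝ) (h : FieldBound K S' φ c) : FieldBound K S φ c := by
  have : sat S ⊆ sat S' := List.append_subset.2
    ⟨fun _ h => List.subset_append_left _ _ (hS h),
      fun _ h => List.subset_append_right _ _ (List.map_subset _ hS h)⟩
  exact ⟨h.1.subset this, h.2.subset this⟩

theorem exists_bound {K : Set U} (hK : IsCompact K) (f : Smooth U) :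
    ∃ M : ℝ, 0 ≤ M ∧ ∀ x ∈ K, ‖f.1 x‖ ≤ M := by
  obtain ⟨M, hM⟩ := hK.exists_bound_of_continuousOn (continuous_smooth f).continuousOn
  exact ⟨max M 0, le_max_right _ _, fun x hx => (hM x hx).trans (le_max_left _ _)⟩

/-- The smooth coefficients of the operator are bounded on the compact set, and finitely many jets
occur. -/
theorem exists_bound_LocLin {K : Set U} (hK : IsCompact K) {D : Forms n m U →ₗ[ℂ] Smooth U}
    (hD : D ∈ LocLin U) : ∃ (S : List (FJet n m)) (M : ℝ), 0 ≤ M ∧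
      ∀ a c, JetBound K S a c → ∀ x ∈ K, ‖(D a).1 x‖ ≤ M * c := by
  induction hD using Submodule.span_induction with
  | mem D hD =>
    obtain ⟨f, j, rfl⟩ := hD
    obtain ⟨M, hM, hf⟩ := exists_bound hK f
    refine ⟨[j], M, hM, fun a c h x hx => ?_⟩
    refine (norm_mul_le (f.1 x) ((fjet j a).1 x)).trans ?_
    exact mul_le_mul (hf x hx) (h.2 j (List.mem_singleton_self j) x hx) (norm_nonneg _) hM
  | zero => exact ⟨[], 0, le_rfl, fun a c h x hx => by rw [zero_mul]; exact norm_zero.le⟩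
  | add D E _ _ hD hE =>
    obtain ⟨S, M, hM, hD⟩ := hD
    obtain ⟨S', M', hM', hE⟩ := hE
    refine ⟨S ++ S', M + M', add_nonneg hM hM', fun a c h x hx => ?_⟩
    rw [add_mul]
    exact (norm_add_le _ _).trans (add_le_add
      (hD a c (h.subset (List.subset_append_left _ _)) x hx)
      (hE a c (h.subset (List.subset_append_right _ _)) x hx))
  | smul b D _ hD =>
    obtain ⟨S, M, hM, hD⟩ := hD
    refine ⟨S, ‖b‖ * M, mul_nonneg (norm_nonneg b) hM, fun a c h x hx => ?_⟩
    rw [mul_assoc]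
    exact (norm_smul_le b _).trans (mul_le_mul_of_nonneg_left (hD a c h x hx) (norm_nonneg b))

theorem exists_bound_LocBil {K : Set U} (hK : IsCompact K)
    {B : Forms n m U →ₗ[ℂ] Forms n m U →ₗ[ℂ] Smooth U} (hB : B ∈ LocBil U) :
    ∃ (S : List (FJet n m)) (M : ℝ), 0 ≤ M ∧ ∀ a b c d, JetBound K S a c → JetBound K S b d →
      ∀ x ∈ K, ‖(B a b).1 x‖ ≤ M * (c * d) := by
  induction hB using Submodule.span_induction with
  | mem B hB =>
    obtain ⟨f, j, j', rfl⟩ := hB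
    obtain ⟨M, hM, hf⟩ := exists_bound hK f
    refine ⟨[j, j'], M, hM, fun a b c d h h' x hx => ?_⟩
    refine (norm_mul_le (f.1 x * (fjet j a).1 x) ((fjet j' b).1 x)).trans ?_
    rw [← mul_assoc]
    refine mul_le_mul ((norm_mul_le (f.1 x) ((fjet j a).1 x)).trans ?_)
      (h'.2 j' (by simp) x hx) (norm_nonneg _) (mul_nonneg hM h.1)
    exact mul_le_mul (hf x hx) (h.2 j (by simp) x hx) (norm_nonneg _) hM
  | zero => exact ⟨[], 0, le_rfl, fun a b c d h h' x hx => by rw [zero_mul]; exact norm_zero.le⟩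
  | add B C _ _ hB hC =>
    obtain ⟨S, M, hM, hB⟩ := hB
    obtain ⟨S', M', hM', hC⟩ := hC
    refine ⟨S ++ S', M + M', add_nonneg hM hM', fun a b c d h h' x hx => ?_⟩
    rw [add_mul]
    exact (norm_add_le _ _).trans (add_le_add
      (hB a b c d (h.subset (List.subset_append_left _ _))
        (h'.subset (List.subset_append_left _ _)) x hx)
      (hC a b c d (h.subset (List.subset_append_right _ _))
        (h'.subset (List.subset_append_right _ _)) x hx))
  | smul e B _ hB =>
    obtain ⟨S, M, hM, hB⟩ := hB
    refine ⟨S, ‖e‖ * M, mul_nonneg (norm_nonneg e) hM, fun a b c d h h' x hx => ?_⟩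
    rw [mul_assoc]
    exact (norm_smul_le e _).trans
      (mul_le_mul_of_nonneg_left (hB a b c d h h' x hx) (norm_nonneg e))

theorem IsLoc.exists_bound {K : Set U} (hK : IsCompact K) {L : Forms n m U →ₗ[ℂ] Forms n m U}
    (hL : IsLoc L) (S' : List (FJet n m)) : ∃ (S : List (FJet n m)) (M : ℝ), 0 ≤ M ∧
      ∀ a c, JetBound K S a c → JetBound K S' (L a) (M * c) := by
  induction S' with
  | nil => exact ⟨[], 0, le_rfl, fun a c h => ⟨by rw [zero_mul], fun j hj => by simp at hj⟩⟩
  | cons j S' ih =>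
    obtain ⟨S₁, M₁, hM₁, h₁⟩ := ih
    obtain ⟨S₂, M₂, hM₂, h₂⟩ := exists_bound_LocLin hK (hL.fjet j)
    refine ⟨S₁ ++ S₂, M₁ + M₂, add_nonneg hM₁ hM₂, fun a c h =>
      ⟨mul_nonneg (add_nonneg hM₁ hM₂) h.1, fun i hi x hx => ?_⟩⟩
    rcases List.mem_cons.1 hi with rfl | hi
    · refine (h₂ a c (h.subset (List.subset_append_right _ _)) x hx).trans ?_
      exact mul_le_mul_of_nonneg_right (by linarith) h.1
    · refine ((h₁ a c (h.subset (List.subset_append_left _ _))).2 i hi x hx).trans ?_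
      exact mul_le_mul_of_nonneg_right (by linarith) h.1

theorem IsLoc₂.exists_bound {K : Set U} (hK : IsCompact K)
    {B : Forms n m U →ₗ[ℂ] Forms n m U →ₗ[ℂ] Forms n m U} (hB : IsLoc₂ B)
    (S' : List (FJet n m)) : ∃ (S : List (FJet n m)) (M : ℝ), 0 ≤ M ∧ ∀ a b c d,
      JetBound K S a c → JetBound K S b d → JetBound K S' (B a b) (M * (c * d)) := by
  induction S' with
  | nil => exact ⟨[], 0, le_rfl, fun a b c d h h' =>
      ⟨by rw [zero_mul], fun j hj => by simp at hj⟩⟩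
  | cons j S' ih =>
    obtain ⟨S₁, M₁, hM₁, h₁⟩ := ih
    obtain ⟨S₂, M₂, hM₂, h₂⟩ := exists_bound_LocBil hK (hB.fjet j)
    refine ⟨S₁ ++ S₂, M₁ + M₂, add_nonneg hM₁ hM₂, fun a b c d h h' =>
      ⟨mul_nonneg (add_nonneg hM₁ hM₂) (mul_nonneg h.1 h'.1), fun i hi x hx => ?_⟩⟩
    have hcd := mul_nonneg h.1 h'.1
    rcases List.mem_cons.1 hi with rfl | hi
    · refine (h₂ a b c d (h.subset (List.subset_append_right _ _))
        (h'.subset (List.subset_append_right _ _)) x hx).trans ?_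
      exact mul_le_mul_of_nonneg_right (by linarith) hcd
    · refine ((h₁ a b c d (h.subset (List.subset_append_left _ _))
        (h'.subset (List.subset_append_left _ _))).2 i hi x hx).trans ?_
      exact mul_le_mul_of_nonneg_right (by linarith) hcd

theorem exists_jetBound {K : Set U} (hK : IsCompact K) (S : List (FJet n m)) (a : Forms n m U) :
    ∃ M : ℝ, JetBound K S a M := by
  induction S with
  | nil => exact ⟨0, le_rfl, fun j hj => by simp at hj⟩
  | cons j S ih =>
    obtain ⟨M, hM⟩ := ih
    obtain ⟨N, hN, h⟩ := PoissonBF.exists_bound hK (fjet j a)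
    refine ⟨M + N, add_nonneg hM.1 hN, fun i hi x hx => ?_⟩
    rcases List.mem_cons.1 hi with rfl | hi
    · linarith [h x hx, hM.1]
    · linarith [hM.2 i hi x hx]

/-- Form-valued functionals of the fields which are continuous in each symmetric degree, for the
topology of uniform convergence of all derivatives on `K`. -/
def ContOn (K : Set U) (f : GSym (Fields n m U) →ₗ[ℂ] Forms n m U) : Prop :=
  ∀ (k : ℕ) (S' : List (FJet n m)), ∃ (S : List (FJet n m)) (M : ℝ), 0 ≤ M ∧
    ∀ w c, Size (FieldBound K S) k w c → JetBound K S' (f w) (M * c)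

variable {K : Set U}

theorem Size.fieldBound_subset {S S' : List (FJet n m)} {k : ℕ} {w : GSym (Fields n m U)} {c : ℝ}
    (h : Size (FieldBound K S') k w c) (hS : S ⊆ S') : Size (FieldBound K S) k w c :=
  h.imp (FieldBound.subset hS)

theorem ContOn.add {f g : GSym (Fields n m U) →ₗ[ℂ] Forms n m U} (hf : ContOn K f)
    (hg : ContOn K g) : ContOn K (f + g) := fun k S' => by
  obtain ⟨S₁, M₁, hM₁, h₁⟩ := hf k S'
  obtain ⟨S₂, M₂, hM₂, h₂⟩ := hg k S'
  refine ⟨S₁ ++ S₂, M₁ + M₂, add_nonneg hM₁ hM₂, fun w c h => ?_⟩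
  rw [add_mul]
  exact (isGauge_jetBound _ _).add (h₁ w c (h.fieldBound_subset (List.subset_append_left _ _)))
    (h₂ w c (h.fieldBound_subset (List.subset_append_right _ _)))

theorem ContOn.smul {f : GSym (Fields n m U) →ₗ[ℂ] Forms n m U} (hf : ContOn K f) (a : ℂ) :
    ContOn K (a • f) := fun k S' => by
  obtain ⟨S, M, hM, h₁⟩ := hf k S'
  refine ⟨S, ‖a‖ * M, mul_nonneg (norm_nonneg a) hM, fun w c h => ?_⟩
  rw [mul_assoc]
  exact (isGauge_jetBound _ _).smul a (h₁ w c h)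

theorem ContOn.comp (hK : IsCompact K) {f : GSym (Fields n m U) →ₗ[ℂ] Forms n m U}
    (hf : ContOn K f) {L : Forms n m U →ₗ[ℂ] Forms n m U} (hL : IsLoc L) :
    ContOn K (L ∘ₗ f) := fun k S' => by
  obtain ⟨S₁, M₁, hM₁, h₁⟩ := hL.exists_bound hK S'
  obtain ⟨S₂, M₂, hM₂, h₂⟩ := hf k S₁
  refine ⟨S₂, M₁ * M₂, mul_nonneg hM₁ hM₂, fun w c h => ?_⟩
  rw [mul_assoc]
  exact h₁ _ _ (h₂ w c h)

theorem contOn_const (hK : IsCompact K) (a : Forms n m U) :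
    ContOn K (const a : GSym (Fields n m U) →ₗ[ℂ] Forms n m U) := fun k S' => by
  obtain ⟨M, hM⟩ := exists_jetBound hK S' a
  refine ⟨[], M, hM.1, fun w c h => ?_⟩
  refine (isGauge_jetBound _ _).mono ((isGauge_jetBound _ _).smul (aug w) hM) ?_
  rw [mul_comm]
  exact mul_le_mul_of_nonneg_left (h.aug (isGauge_fieldBound _ _)) hM.1

theorem contOn_fA : ContOn K (fA U) := fun _ S' =>
  ⟨S', 1, zero_le_one, fun w c h => by
    rw [one_mul]
    exact (h.lin (isGauge_fieldBound _ _)).1.subset (List.subset_append_left _ _)⟩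

theorem contOn_fB : ContOn K (fB U) := fun _ S' =>
  ⟨S', 1, zero_le_one, fun w c h => by
    rw [one_mul]
    exact (h.lin (isGauge_fieldBound _ _)).2.subset (List.subset_append_left _ _)⟩

theorem ContOn.conv (hK : IsCompact K) {β : Forms n m U →ₗ[ℂ] Forms n m U →ₗ[ℂ] Forms n m U}
    (hβ : IsLoc₂ β) {f g : GSym (Fields n m U) →ₗ[ℂ] Forms n m U} {γ : Bool} (hγ : ParMap γ g)
    (hf : ContOn K f) (hg : ContOn K g) : ContOn K (PoissonBF.conv β f g) := fun k S' => by
  obtain ⟨S₀, N, hN, h₀⟩ := hβ.exists_bound hK S'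
  obtain ⟨S₁, M₁, hM₁, h₁⟩ := hf k S₀
  obtain ⟨S₂, M₂, hM₂, h₂⟩ := hg k S₀
  refine ⟨S₁ ++ S₂, N * M₁ * M₂ * 3 ^ k, by positivity, fun w c h => ?_⟩
  exact h.conv (isGauge_fieldBound _ _) FieldBound.par (isGauge_jetBound _ _) hN h₀ hγ hM₁ hM₂
    (fun w c h => h₁ w c (h.fieldBound_subset (List.subset_append_left _ _)))
    (fun w c h => h₂ w c (h.fieldBound_subset (List.subset_append_right _ _)))

theorem contOn_xVF (hK : IsCompact K) (x : LdR n) :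
    ContOn K (pA ∘ₗ xVF U x) ∧ ContOn K (pB ∘ₗ xVF U x) := by
  constructor
  · have e : pA ∘ₗ xVF U x = poisson (pullU U x.1) ∘ₗ fA U + const (-pullU U (par x.2)) := by
      ext1 w
      rw [xVF_eq, LinearMap.comp_apply, LinearMap.add_apply, map_add, LinearMap.comp_apply,
        pA_actL]
      simp only [const_apply, map_smul, map_neg, pA_iA, LinearMap.add_apply]
      rfl
    rw [e]
    exact (contOn_fA.comp hK (isLoc₂_poisson.apply _)).add (contOn_const hK _)
  · have e : pB ∘ₗ xVF U x = poisson (parPow (!pty m) (pullU U x.1)) ∘ₗ fB U := by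
      ext1 w
      rw [xVF_eq, LinearMap.comp_apply, LinearMap.add_apply, map_add, LinearMap.comp_apply,
        pB_actL]
      simp only [const_apply, map_smul, map_neg, pB_iA, neg_zero, smul_zero, add_zero]
      rfl
    rw [e]
    exact contOn_fB.comp hK (isLoc₂_poisson.apply _)

theorem contOn_sVF (hK : IsCompact K) :
    ContOn K (pA ∘ₗ sVF U) ∧ ContOn K (pB ∘ₗ sVF U) := by
  constructor
  · have e : pA ∘ₗ sVF U = dForm ∘ₗ fA U + (1 / 2 : ℂ) • conv poisson (fA U) (fA U) := by
      ext1 w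
      change _ + sg (!pty m) • (0 : Forms n m U) = _
      rw [smul_zero, add_zero]
      rfl
    rw [e]
    exact (contOn_fA.comp hK isLoc_dForm).add
      ((contOn_fA.conv hK isLoc₂_poisson parMap_fA contOn_fA).smul _)
  · have e : pB ∘ₗ sVF U = sg (!pty m) • (dForm ∘ₗ fB U + conv poisson (fA U) (fB U)) := by
      ext1 w
      exact zero_add _
    rw [e]
    exact ((contOn_fB.comp hK isLoc_dForm).add
      (contOn_fA.conv hK isLoc₂_poisson parMap_fB contOn_fB)).smul _

end Continuity

open GSym

/-! ## The action on observables -/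

section Observables

variable {n m : ℕ} {U : Opens (Spacetime n m)}

theorem fieldBound_of_jets {K : Set U} {S : List (FJet n m)} {φ : Fields n m U} {c : ℝ} (hc : 0 ≤ c)
    (h : ∀ j ∈ (sat S).map (fun j => (true, j)) ++ (sat S).map (fun j => (false, j)), ∀ x ∈ K,
      ‖(jet j φ).1 x‖ ≤ c) : FieldBound K S φ c := by
  refine ⟨⟨hc, fun j hj x hx => ?_⟩, ⟨hc, fun j hj x hx => ?_⟩⟩
  · have := h (true, j) (List.mem_append_left _ (List.mem_map_of_mem hj)) x hx
    rwa [jet_eq] at this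
  · have := h (false, j) (List.mem_append_right _ (List.mem_map_of_mem hj)) x hx
    rwa [jet_eq] at this

theorem FieldBound.jet_le {K : Set U} {S : List (FJet n m)} {φ : Fields n m U} {c : ℝ}
    (h : FieldBound K S φ c) {j : JetIndex n m} (hj : j.2 ∈ S) {x : U} (hx : x ∈ K) :
    ‖(jet j φ).1 x‖ ≤ c := by
  obtain ⟨b, j⟩ := j
  rw [jet_eq]
  cases b
  · exact h.2.2 j (List.mem_append_left _ hj) x hx
  · exact h.1.2 j (List.mem_append_left _ hj) x hx

theorem FieldBound.mono_set {K K' : Set U} (hK : K ⊆ K') {S : List (FJet n m)} {φ : Fields n m U}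
    {c : ℝ} (h : FieldBound K' S φ c) : FieldBound K S φ c :=
  ⟨⟨h.1.1, fun j hj x hx => h.1.2 j hj x (hK hx)⟩,
    ⟨h.2.1, fun j hj x hx => h.2.2 j hj x (hK hx)⟩⟩

/-- Membership in `Obs` gives separate data in each symmetric degree; here they are merged for all
degrees below `k`. Passing to |C'| keeps the merged constant nonnegative. -/
theorem exists_bound_of_mem_Obs {F : Module.Dual ℂ (GSym (Fields n m U))} (hF : F ∈ Obs U)
    (k : ℕ) : ∃ (K : Set U) (S : List (FJet n m)) (C : ℝ), IsCompact K ∧ 0 ≤ C ∧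
      ∀ r < k, ∀ (φ : Fin r → Fields n m U) (c : Fin r → ℝ),
        (∀ i, FieldBound K S (φ i) (c i)) → ‖F (mon φ)‖ ≤ C * ∏ i, c i := by
  induction k with
  | zero => exact ⟨∅, [], 0, isCompact_empty, le_rfl, fun r hr => absurd hr (Nat.not_lt_zero r)⟩
  | succ k ih =>
    obtain ⟨K, S, C, hK, hC, h⟩ := ih
    obtain ⟨K', J, C', hK', h'⟩ := hF k
    refine ⟨K ∪ K', S ++ J.map Prod.snd, C + |C'|, hK.union hK',
      add_nonneg hC (abs_nonneg _), fun r hr φ c hφ => ?_⟩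
    have hc : 0 ≤ ∏ i, c i := Finset.prod_nonneg fun i _ => (hφ i).1.1
    rcases Nat.lt_succ_iff_lt_or_eq.1 hr with hr | rfl
    · refine (h r hr φ c fun i => ?_).trans
        (mul_le_mul_of_nonneg_right (le_add_of_nonneg_right (abs_nonneg _)) hc)
      exact FieldBound.subset (List.subset_append_left _ _) _ _
        ((hφ i).mono_set Set.subset_union_left)
    · refine (h' φ c (fun i => (hφ i).1.1) fun i j hj x hx => ?_).trans
        (mul_le_mul_of_nonneg_right ((le_abs_self C').trans (le_add_of_nonneg_left hC)) hc)
      exact (hφ i).jet_le (List.mem_append_right _ (List.mem_map_of_mem hj)) (Or.inr hx)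

theorem mem_Obs_of_size {F : Module.Dual ℂ (GSym (Fields n m U))}
    (h : ∀ k, ∃ (K : Set U) (S : List (FJet n m)) (C : ℝ), IsCompact K ∧
      ∀ w c, Size (FieldBound K S) k w c → ‖F w‖ ≤ C * c) : F ∈ Obs U := fun k => by
  obtain ⟨K, S, C, hK, h⟩ := h k
  exact ⟨K, (sat S).map (fun j => (true, j)) ++ (sat S).map (fun j => (false, j)), C, hK,
    fun φ c hc hφ => h _ _ (size_mon φ c fun i => fieldBound_of_jets (hc i) (hφ i))⟩

/-- Over each compact set the jets of D(w) are controlled by jets of the letters on the same set.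
The set that bounds `F` thus also serves for `F ∘ₗ rins D`; only the list of jets and the constant
grow. -/
theorem comp_rins_mem_Obs {i : Bool} {D : GSym (Fields n m U) →ₗ[ℂ] Fields n m U}
    (hi : ParMap i D) (hD : ∀ K, IsCompact K → ContOn K (pA ∘ₗ D) ∧ ContOn K (pB ∘ₗ D))
    {F : Module.Dual ℂ (GSym (Fields n m U))} (hF : F ∈ Obs U) : F ∘ₗ rins D ∈ Obs U := by
  refine mem_Obs_of_size fun k => ?_
  -- Insertion of D raises the symmetric degree to at most k + 1, and the merged bound covers the
  -- degrees strictly below k + 2.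
  obtain ⟨K, S, C, hK, hC, h⟩ := exists_bound_of_mem_Obs hF (k + 2)
  obtain ⟨S₁, M₁, hM₁, h₁⟩ := (hD K hK).1 k (sat S)
  obtain ⟨S₂, M₂, hM₂, h₂⟩ := (hD K hK).2 k (sat S)
  have hM : 0 ≤ M₁ + M₂ := add_nonneg hM₁ hM₂
  refine ⟨K, S ++ (S₁ ++ S₂), C * ((M₁ + M₂) * 3 ^ k), hK, fun w c hw => ?_⟩
  have hDw : ∀ w c, Size (FieldBound K (S ++ (S₁ ++ S₂))) k w c →
      FieldBound K S (D w) ((M₁ + M₂) * c) := fun w c hw => by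
    have hc := hw.nonneg (isGauge_fieldBound _ _)
    have hw' := hw.fieldBound_subset (List.subset_append_right _ _)
    exact ⟨(isGauge_jetBound _ _).mono
        (h₁ w c (hw'.fieldBound_subset (List.subset_append_left _ _)))
        (mul_le_mul_of_nonneg_right (le_add_of_nonneg_right hM₂) hc),
      (isGauge_jetBound _ _).mono
        (h₂ w c (hw'.fieldBound_subset (List.subset_append_right _ _)))
        (mul_le_mul_of_nonneg_right (le_add_of_nonneg_left hM₁) hc)⟩
  rw [LinearMap.comp_apply, rins_eq_lins hi, mul_assoc, mul_assoc]
  exact ((hw.parPow FieldBound.par i).lins (isGauge_fieldBound _ _) FieldBound.par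
    (FieldBound.subset (List.subset_append_left _ _)) hM hDw).norm_le
    fun r hr φ d hφ => h r (by omega) φ d hφ

theorem comp_rins_sVF_mem_Obs (F : Module.Dual ℂ (GSym (Fields n m U))) (hF : F ∈ Obs U) :
    F ∘ₗ rins (sVF U) ∈ Obs U :=
  comp_rins_mem_Obs parMap_sVF (fun _ => contOn_sVF) hF

theorem comp_rins_xVF_mem_Obs (x : LdR n) (F : Module.Dual ℂ (GSym (Fields n m U)))
    (hF : F ∈ Obs U) : F ∘ₗ rins (xVF U x) ∈ Obs U := by
  induction x using LdR_induction with
  | hom i x hx => exact comp_rins_mem_Obs (parMap_xVF hx) (fun _ hK => contOn_xVF hK x) hF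
  | add x y hx hy =>
    rw [map_add, rins_add, LinearMap.comp_add]
    exact Submodule.add_mem _ hx hy

/-- The differential `{S, -}_{BV}` on the classical observables. -/
def obsDiff (n m : ℕ) : ObsOp n m := fun U =>
  -(Module.Dual.transpose (R := ℂ) (rins (sVF U))).restrict comp_rins_sVF_mem_Obs

/-- The operators `{Φ(x), -}_{BV}` on the classical observables. -/
def obsAct (n m : ℕ) : LdR n →ₗ[ℂ] ObsOp n m where
  toFun x U := -(Module.Dual.transpose (R := ℂ) (rins (xVF U x))).restrict
    (comp_rins_xVF_mem_Obs x)
  map_add' x y := by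
    funext U
    ext O w
    change -(O.1 (rins (xVF U (x + y)) w)) = -(O.1 (rins (xVF U x) w)) + -(O.1 (rins (xVF U y) w))
    rw [map_add, rins_add, LinearMap.add_apply, map_add, neg_add]
  map_smul' a x := by
    funext U
    ext O w
    change -(O.1 (rins (xVF U (a • x)) w)) = a • -(O.1 (rins (xVF U x) w))
    rw [map_smul, rins_smul, LinearMap.smul_apply, map_smul, smul_neg]

theorem obsAct_apply (x : LdR n) (O : Obs U) :
    (obsAct n m x U O).1 = -(O.1 ∘ₗ rins (xVF U x)) := rfl

theorem isBVAction_obsDiff : IsBVAction (actionS n m) (obsDiff n m) :=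
  ⟨sLVF n m, isHamiltonian_sVF, fun _ _ => rfl⟩

theorem isBVAction_obsAct (x : LdR n) : IsBVAction (Phi n m x) (obsAct n m x) :=
  ⟨xLVF m x, isHamiltonian_Phi x, fun _ _ => rfl⟩

/-- The operators are minus transposes of `rins`. Transposition reverses compositions, and together
with the sign this turns the right-hand side of `rins_comm` into the graded commutator. -/
theorem obsAct_diff {j : ℤ} {x : LdR n} (hx : x ∈ dRDeg n j) :
    obsAct n m (dRDiff x)
      = obsDiff n m * obsAct n m x - (-1 : ℂ) ^ j • (obsAct n m x * obsDiff n m) := by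
  have hp := parX_of_mem hx
  funext U
  ext O w
  have h := rins_comm (parMap_sVF (U := U)) (parMap_xVF (U := U) hp)
  rw [Bool.true_and, ← sVF_bracket hp] at h
  change -(O.1 (rins (xVF U (dRDiff x)) w))
    = - -(O.1 (rins (xVF U x) (rins (sVF U) w)))
      - (-1 : ℂ) ^ j • - -(O.1 (rins (sVF U) (rins (xVF U x) w)))
  rw [h, LinearMap.sub_apply, LinearMap.smul_apply, Module.End.mul_apply, Module.End.mul_apply,
    map_sub, map_smul, sg_pty, neg_neg, neg_neg, neg_sub]

theorem obsAct_bracket {i j : ℤ} {x y : LdR n} (hx : x ∈ dRDeg n i) (hy : y ∈ dRDeg n j) :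
    obsAct n m (dRBracket x y)
      = obsAct n m x * obsAct n m y - (-1 : ℂ) ^ (i * j) • (obsAct n m y * obsAct n m x) := by
  have hpx := parX_of_mem hx
  have hpy := parX_of_mem hy
  have hs : sg (pty i && pty j) = (-1 : ℂ) ^ (i * j) := by
    rw [← sg_pty]
    congr 1
    simp only [pty, Int.odd_mul, Bool.decide_and]
  funext U
  ext O w
  have h := rins_comm (parMap_xVF (U := U) hpx) (parMap_xVF (U := U) hpy)
  rw [← xVF_bracket hpx hpy] at h
  change -(O.1 (rins (xVF U (dRBracket x y)) w))
    = - -(O.1 (rins (xVF U y) (rins (xVF U x) w)))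
      - (-1 : ℂ) ^ (i * j) • - -(O.1 (rins (xVF U x) (rins (xVF U y) w)))
  rw [h, LinearMap.sub_apply, LinearMap.smul_apply, Module.End.mul_apply, Module.End.mul_apply,
    map_sub, map_smul, hs, neg_neg, neg_neg, neg_sub]

theorem isDeRhamAction_obsAct : IsDeRhamAction (obsDiff n m) (obsAct n m) where
  derivation _ x hx := isDerivation_of_eq hx fun _ O => obsAct_apply x O
  diff _ _ := obsAct_diff
  bracket _ _ _ hx _ hy := obsAct_bracket hx hy

end Observables

end

end PoissonBF

theorem mainTheorem3 (n m : ℕ) :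
    ∃ Φ : PoissonBF.LdR n →ₗ[ℂ] PoissonBF.Functional n m,
      (∀ α : PoissonBF.L n, Φ (α, 0) = PoissonBF.funP m α) ∧
      (∀ (k : ℤ) (α : PoissonBF.L n), α ∈ PoissonBF.formsDeg ⊤ k →
        Φ (0, α) = (-1 : ℂ) ^ (k + 1) • PoissonBF.funQ m α) ∧
      PoissonBF.IsInnerAction Φ ∧
      ∃ (δ : PoissonBF.ObsOp n m) (ρ : PoissonBF.LdR n →ₗ[ℂ] PoissonBF.ObsOp n m),
        PoissonBF.IsBVAction (PoissonBF.actionS n m) δ ∧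
        (∀ x, PoissonBF.IsBVAction (Φ x) (ρ x)) ∧
        PoissonBF.IsDeRhamAction δ ρ := by
  exact ⟨PoissonBF.Phi n m, PoissonBF.Phi_left, fun k α hα => PoissonBF.Phi_right hα,
    PoissonBF.isInnerAction_Phi, PoissonBF.obsDiff n m, PoissonBF.obsAct n m,
    PoissonBF.isBVAction_obsDiff, PoissonBF.isBVAction_obsAct, PoissonBF.isDeRhamAction_obsAct⟩
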